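/- **Hybrid systems.** A hybrid system $\mathcal H=(C,F,D,G)$ on $\mathbb R^m$ is written $x\in C,\ \dot x\in F(x)$; $x\in D,\ x^+\in G(x)$, where $F,G$ are set-valued. A compact hybrid time domain is a set $\bigcup_{j=0}^{J-1}[t_j,t_{j+1}]\times\{j\}$ with $0=t_0\le t_1\le\dots\le t_J$; a hybrid time domain is a set $E\subset\mathbb R_{\ge0}\times\mathbb Z_{\ge0}$ such that $E\cap([0,T]\times\{0,\dots,J\})$ is a compact hybrid time domain for every $(T,J)\in E$. A solution of $\mathcal H$ is a function $x$ on a nonempty hybrid time domain $\operatorname{dom}x$ with $x(0,0)\in C\cup D$ such that, writing $I_j=\{t:(t,j)\in\operatorname{dom}x\}$: for each $j$ for which $I_j$ has nonempty interior, $x(\cdot,j)$ is locally absolutely continuous on $I_j$, $x(t,j)\in C$ for all $t\in I_j$ and $\dot x(t,j)\in F(x(t,j))$ for almost all $t\in I_j$; and whenever $(t,j),(t,j+1)\in\operatorname{dom}x$, $x(t,j)\in D$ and $x(t,j+1)\in G(x(t,j))$. **Stability.** A function $\beta:\mathbb R_{\ge0}^2\to\mathbb R_{\ge0}$ is of class $\mathcal{KL}$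 if it is nondecreasing in its first and nonincreasing in its second argument, $\lim_{r\to0^+}\beta(r,s)=0$ for each $s$ and $\lim_{s\to\infty}\beta(r,s)=0$ for each $r$. For a compact set $\mathcal A$ contained in an open set $\mathcal B$, a proper indicator of $\mathcal A$ on $\mathcal B$ is a continuous $\omega:\mathcal B\to\mathbb R_{\ge0}$ that vanishes exactly on $\mathcal A$ and is unbounded along every sequence in $\mathcal B$ that approaches the boundary of $\mathcal B$ or is unbounded. $\mathcal A$ is *uniformly asymptotically stable (UAS) with basin of attraction $\mathcal B$* for $\mathcal H$ if for every proper indicator $\omega$ of $\mathcal A$ on $\mathcal B$ there is $\beta\in\mathcal{KL}$ such that every solution $x$ of $\mathcal H$ with $x(0,0)\in\mathcal B$ stays in $\mathcal B$ and satisfies $\omega(x(t,j))\le\beta(\omega(x(0,0)),t+j)$ for all $(t,j)\in\operatorname{dom}x$. **The oscillatory system.** Let $n=n_1+n_2$, $C,D\subset\mathbb R^{n}$, $\Phi:\mathbb R^{n_2}\rightrightarrows\mathbb R^{n_2}$, $G:\mathbb R^n\rightrightarrows\mathbb R^n$, and let $\phi_1,\phi_2$ be $\mathbb R^{n_1}$-valued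 functions of $(x,z,\tau_1,\tau_2)\in\mathbb R^{n_1}\times\mathbb R^{n_2}\times\mathbb R_{\ge0}^2$. Write $\theta=(x,z)$, $\tau=(\tau_1,\tau_2)$. For $\varepsilon>0$ let $\mathcal H_\varepsilon$ be the hybrid system with state $(\theta,\tau)$ that flows for $(\theta,\tau)\in C\times\mathbb R_{\ge0}^2$ by $$\dot x=\varepsilon^{-1}\phi_1(x,z,\tau)+\phi_2(x,z,\tau),\quad \dot z\in\Phi(z),\quad \dot\tau_1=\varepsilon^{-1},\quad \dot\tau_2=\varepsilon^{-2},$$ and jumps for $(\theta,\tau)\in D\times\mathbb R_{\ge0}^2$ by $\theta^+\in G(\theta)$, $\tau^+=\tau$. **Assumptions.** 1. $C$ and $D$ are closed; relative to $C$, the map $(x,z)\mapsto\Phi(z)$ is outer semicontinuous and locally bounded, with nonempty convex values on $C$; relative to $D$, $G$ is outer semicontinuous and locally bounded, with nonempty values on $D$. 2. There are $\delta^*,T_1,T_2>0$ such that on $C_{\delta^*}\times\mathbb R^2_{\ge0}$, where $C_{\delta^*}$ is the set of points whose closed Euclidean ball of radius $\delta^*$ meets $C$: (a) $\phi_1$ and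 $\phi_2$ are continuous and locally Lipschitz with respect to $z$; $\phi_2$ is locally Lipschitz with respect to $(x,\tau_1)$; $\phi_1$ is continuously differentiable with respect to $(x,\tau_1)$, with differential continuous in all variables and locally Lipschitz with respect to $(x,\tau_1)$ (all Lipschitz constants being locally uniform in the remaining variables); (b) $\phi_1,\phi_2$ are $T_1$-periodic in $\tau_1$ and $T_2$-periodic in $\tau_2$; (c) $\int_0^{T_2}\phi_1(x,z,\tau_1,s)\,ds=0$. **The average.** Let $u_1(\theta,\tau)=\int_0^{\tau_2}\phi_1(\theta,\tau_1,s)\,ds$, $[u_1,\phi_1]_x=\partial_x\phi_1\cdot u_1-\partial_xu_1\cdot\phi_1$, and $$\bar f(\theta)=\frac1{T_1T_2}\int_0^{T_1}\!\!\int_0^{T_2}\Big(\phi_2+\tfrac12[u_1,\phi_1]_x\Big)(\theta,\tau)\,d\tau_2\,d\tau_1 .$$ The second-order average system $\mathcal H_2^{\rm ave}$ is the hybrid system $\theta\in C,\ \dot\theta\in\{\bar f(\theta)\}\times\Phi(z)$; $\theta\in D,\ \theta^+\in G(\theta)$. **Theorem.** Under Assumptions 1 and 2, let $\mathcal A\subset\mathbb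 R^n$ be compact. If $\mathcal A$ is UAS with basin of attraction $\mathcal B_{\mathcal A}$ (an open set containing $\mathcal A$) for $\mathcal H_2^{\rm ave}$, then $\mathcal A$ is semi-globally practically asymptotically stable as $\varepsilon\to0^+$ with respect to $\mathcal B_{\mathcal A}$ for $\mathcal H_\varepsilon$: for each proper indicator $\omega$ of $\mathcal A$ on $\mathcal B_{\mathcal A}$ there is $\beta\in\mathcal{KL}$ such that for each compact $K\subset\mathcal B_{\mathcal A}$ and each $\nu>0$ there is $\varepsilon^*>0$ such that for all $\varepsilon\in(0,\varepsilon^*]$, every solution $(\theta,\tau)$ of $\mathcal H_\varepsilon$ with $\theta(0,0)\in K$ satisfies $\theta(t,j)\in\mathcal B_{\mathcal A}$ and $$\omega(\theta(t,j))\le\beta(\omega(\theta(0,0)),t+j)+\nu\qquad\text{for all }(t,j)\in\operatorname{dom}(\theta,\tau).$$ -/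

import Mathlib

open Set Filter Topology MeasureTheory

/-! ### Hybrid dynamical systems and their solutions -/

/-- The data `(C, F, D, G)` of a hybrid system
`x ∈ C, ẋ ∈ F(x)`; `x ∈ D, x⁺ ∈ G(x)`. -/
structure HybridSystem (E : Type*) where
  /-- flow set -/
  C : Set E
  /-- flow map -/
  F : E → Set E
  /-- jump set -/
  D : Set E
  /-- jump map -/
  G : E → Set E

/-- `E = ⋃_{j=0}^{J-1} [t_j, t_{j+1}] × {j}` with `0 = t_0 ≤ t_1 ≤ ⋯ ≤ t_J`. -/
def IsCompactHybridTimeDomain (E : Set (ℝ × ℕ)) : Prop :=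
  ∃ (J : ℕ) (t : ℕ → ℝ), t 0 = 0 ∧ (∀ j < J, t j ≤ t (j + 1)) ∧
    E = {p | p.2 < J ∧ p.1 ∈ Icc (t p.2) (t (p.2 + 1))}

/-- A subset `E` of `[0,∞) × ℕ` all of whose truncations `E ∩ ([0,T] × {0,…,J})`,
`(T,J) ∈ E`, are compact hybrid time domains. -/
def IsHybridTimeDomain (E : Set (ℝ × ℕ)) : Prop :=
  (∀ p ∈ E, 0 ≤ p.1) ∧
    ∀ p ∈ E, IsCompactHybridTimeDomain (E ∩ {q | q.1 ∈ Icc 0 p.1 ∧ q.2 ≤ p.2})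

/-- A hybrid arc. Only the values of `val` on `dom` carry meaning. -/
structure HybridArc (E : Type*) [NormedAddCommGroup E] where
  dom : Set (ℝ × ℕ)
  dom_nonempty : dom.Nonempty
  isHybridTimeDomain : IsHybridTimeDomain dom
  val : ℝ → ℕ → E
  /-- local absolute continuity on each `I_j` with nonempty interior -/
  locallyAbsolutelyContinuous :
    ∀ j : ℕ, (interior {t : ℝ | (t, j) ∈ dom}).Nonempty →
      ∀ a b : ℝ, a ≤ b → Icc a b ⊆ {t : ℝ | (t, j) ∈ dom} →
        AbsolutelyContinuousOnInterval (fun t => val t j) a b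

/-- The interval `I_j = {t : (t,j) ∈ dom x}`. -/
def HybridArc.flowInterval {E : Type*} [NormedAddCommGroup E] (x : HybridArc E) (j : ℕ) :
    Set ℝ :=
  {t | (t, j) ∈ x.dom}

/-- The hybrid arc `x` is a solution of the hybrid system `H` (not necessarily maximal). -/
def HybridSystem.IsSolution {E : Type*} [NormedAddCommGroup E] [NormedSpace ℝ E]
    (H : HybridSystem E) (x : HybridArc E) : Prop :=
  x.val 0 0 ∈ H.C ∪ H.D ∧
  (∀ j : ℕ, (interior (x.flowInterval j)).Nonempty →
    (∀ t ∈ x.flowInterval j, x.val t j ∈ H.C) ∧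
    (∀ᵐ t : ℝ, t ∈ x.flowInterval j →
      ∃ v ∈ H.F (x.val t j),
        HasDerivWithinAt (fun s => x.val s j) v (x.flowInterval j) t)) ∧
  (∀ (t : ℝ) (j : ℕ), (t, j) ∈ x.dom → (t, j + 1) ∈ x.dom →
    x.val t j ∈ H.D ∧ x.val t (j + 1) ∈ H.G (x.val t j))

/-! ### Regularity of set-valued maps, relative to a set -/

/-- `M` is outer semicontinuous relative to `K`. -/
def OuterSemicontinuousRel {X Y : Type*} [TopologicalSpace X] [TopologicalSpace Y]
    (M : X → Set Y) (K : Set X) : Prop :=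
  ∀ (u : ℕ → X) (s : ℕ → Y) (p : X) (y : Y), (∀ i, u i ∈ K) → p ∈ K →
    Tendsto u atTop (𝓝 p) → (∀ i, s i ∈ M (u i)) → Tendsto s atTop (𝓝 y) → y ∈ M p

/-- `M` is locally bounded relative to `K`. -/
def LocallyBoundedRel {X Y : Type*} [TopologicalSpace X] [Bornology Y]
    (M : X → Set Y) (K : Set X) : Prop :=
  ∀ p ∈ K, ∃ N ∈ 𝓝 p, Bornology.IsBounded (⋃ q ∈ N ∩ K, M q)

/-! ### Stability notions -/

/-- Class `KL` functions; only the values at nonnegative arguments matter. -/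
def IsClassKL (β : ℝ → ℝ → ℝ) : Prop :=
  (∀ r s, 0 ≤ r → 0 ≤ s → 0 ≤ β r s) ∧
  (∀ r r' s, 0 ≤ r → r ≤ r' → 0 ≤ s → β r s ≤ β r' s) ∧
  (∀ r s s', 0 ≤ r → 0 ≤ s → s ≤ s' → β r s' ≤ β r s) ∧
  (∀ s, 0 ≤ s → Tendsto (fun r => β r s) (𝓝[>] 0) (𝓝 0)) ∧
  (∀ r, 0 ≤ r → Tendsto (fun s => β r s) atTop (𝓝 0))

/-- `ω` is a proper indicator function for `A` on `B`; only the values of `ω` on `B` matter.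
(`Metric.infEDist y ∅ = ∞`, so no sequence approaches an empty boundary.) -/
def IsProperIndicator {E : Type*} [NormedAddCommGroup E] (A B : Set E) (ω : E → ℝ) : Prop :=
  ContinuousOn ω B ∧ (∀ x ∈ B, 0 ≤ ω x) ∧ (∀ x ∈ B, ω x = 0 ↔ x ∈ A) ∧
  ∀ u : ℕ → E, (∀ i, u i ∈ B) →
    (Tendsto (fun i => Metric.infEDist (u i) (frontier B)) atTop (𝓝 0) ∨
      ¬ Bornology.IsBounded (range u)) →
    ¬ BddAbove (range fun i => ω (u i))

/-- `A` is uniformly asymptotically stable with basin of attraction `B` for `H`.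
Since `ω` lives on `B`, the bound includes that solutions starting in `B` stay in `B`. -/
def HybridSystem.IsUAS {E : Type*} [NormedAddCommGroup E] [NormedSpace ℝ E]
    (H : HybridSystem E) (A B : Set E) : Prop :=
  IsCompact A ∧ IsOpen B ∧ A ⊆ B ∧
  ∀ ω : E → ℝ, IsProperIndicator A B ω →
    ∃ β : ℝ → ℝ → ℝ, IsClassKL β ∧
      ∀ x : HybridArc E, H.IsSolution x → x.val 0 0 ∈ B →
        ∀ (t : ℝ) (j : ℕ), (t, j) ∈ x.dom →
          x.val t j ∈ B ∧ ω (x.val t j) ≤ β (ω (x.val 0 0)) (t + j)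

/-- For a family `H ε` of hybrid systems with state `(θ, τ) ∈ E × P`, the set `A ⊆ E` is
semi-globally practically asymptotically stable as `ε → 0⁺` with respect to the basin `B`. -/
def IsSGPAS {E P : Type*} [NormedAddCommGroup E] [NormedSpace ℝ E]
    [NormedAddCommGroup P] [NormedSpace ℝ P]
    (H : ℝ → HybridSystem (E × P)) (A B : Set E) : Prop :=
  IsCompact A ∧ IsOpen B ∧ A ⊆ B ∧
  ∀ ω : E → ℝ, IsProperIndicator A B ω →
    ∃ β : ℝ → ℝ → ℝ, IsClassKL β ∧
      ∀ K : Set E, IsCompact K → K ⊆ B → ∀ ν : ℝ, 0 < ν →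
        ∃ ε₀ : ℝ, 0 < ε₀ ∧ ∀ ε : ℝ, 0 < ε → ε ≤ ε₀ →
          ∀ y : HybridArc (E × P), (H ε).IsSolution y → (y.val 0 0).1 ∈ K →
            ∀ (t : ℝ) (j : ℕ), (t, j) ∈ y.dom →
              (y.val t j).1 ∈ B ∧
                ω (y.val t j).1 ≤ β (ω (y.val 0 0).1) (t + j) + ν

/-! ### The oscillatory hybrid system and its second-order average -/

/-- `θ = (x, z) ∈ ℝ^{n₁} × ℝ^{n₂}`. -/
abbrev OscState (n₁ n₂ : ℕ) : Type :=
  EuclideanSpace ℝ (Fin n₁) × EuclideanSpace ℝ (Fin n₂)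

/-- The data of the oscillatory hybrid system: flow set `C`, jump set `D`, the flow map `Φ` of
`z`, the jump map `G`, and the functions `φ₁, φ₂` of `(x, z, τ₁, τ₂)`. -/
structure OscillatoryData (n₁ n₂ : ℕ) where
  C : Set (OscState n₁ n₂)
  D : Set (OscState n₁ n₂)
  Φ : EuclideanSpace ℝ (Fin n₂) → Set (EuclideanSpace ℝ (Fin n₂))
  G : OscState n₁ n₂ → Set (OscState n₁ n₂)
  φ₁ : EuclideanSpace ℝ (Fin n₁) → EuclideanSpace ℝ (Fin n₂) → ℝ → ℝ →
    EuclideanSpace ℝ (Fin n₁)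
  φ₂ : EuclideanSpace ℝ (Fin n₁) → EuclideanSpace ℝ (Fin n₂) → ℝ → ℝ →
    EuclideanSpace ℝ (Fin n₁)

/-- `C_δ`: the points whose closed Euclidean `δ`-ball meets `C`. -/
def euclideanInflation {n₁ n₂ : ℕ} (C : Set (OscState n₁ n₂)) (δ : ℝ) :
    Set (OscState n₁ n₂) :=
  {θ | ∃ θ' ∈ C, ‖θ'.1 - θ.1‖ ^ 2 + ‖θ'.2 - θ.2‖ ^ 2 ≤ δ ^ 2}

/-- `S × [0,∞)²`. -/
def withPhases {E : Type*} (S : Set E) : Set (E × (ℝ × ℝ)) :=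
  S ×ˢ (Ici 0 ×ˢ Ici 0)

/-- `g(x, z, τ₁, τ₂)` is locally Lipschitz with respect to `(x, τ₁)` on `S`: near each point of
`S` there is one constant that serves all nearby frozen `(z, τ₂)`. -/
def LocallyLipschitzInXTau {n₁ n₂ : ℕ} {V : Type*} [NormedAddCommGroup V]
    (g : EuclideanSpace ℝ (Fin n₁) → EuclideanSpace ℝ (Fin n₂) → ℝ → ℝ → V)
    (S : Set (OscState n₁ n₂ × (ℝ × ℝ))) : Prop :=
  ∀ p ∈ S, ∃ U ∈ 𝓝 p, ∃ L : ℝ, ∀ x x' z τ₁ τ₁' τ₂,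
    ((x, z), (τ₁, τ₂)) ∈ U ∩ S → ((x', z), (τ₁', τ₂)) ∈ U ∩ S →
      ‖g x z τ₁ τ₂ - g x' z τ₁' τ₂‖ ≤ L * (‖x - x'‖ + |τ₁ - τ₁'|)

/-- `g(x, z, τ₁, τ₂)` is locally Lipschitz with respect to `z` on `S`: near each point of
`S` there is one constant that serves all nearby frozen `(x, τ₁, τ₂)`. -/
def LocallyLipschitzInZ {n₁ n₂ : ℕ} {V : Type*} [NormedAddCommGroup V]
    (g : EuclideanSpace ℝ (Fin n₁) → EuclideanSpace ℝ (Fin n₂) → ℝ → ℝ → V)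
    (S : Set (OscState n₁ n₂ × (ℝ × ℝ))) : Prop :=
  ∀ p ∈ S, ∃ U ∈ 𝓝 p, ∃ L : ℝ, ∀ x z z' τ₁ τ₂,
    ((x, z), (τ₁, τ₂)) ∈ U ∩ S → ((x, z'), (τ₁, τ₂)) ∈ U ∩ S →
      ‖g x z τ₁ τ₂ - g x z' τ₁ τ₂‖ ≤ L * ‖z - z'‖

/-- `g` is differentiable with respect to `(x, τ₁)` on `S`, and the differential is continuous
and locally Lipschitz with respect to `(x, τ₁)`. -/
def IsC1InXTau {n₁ n₂ : ℕ} {V : Type*} [NormedAddCommGroup V] [NormedSpace ℝ V]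
    (g : EuclideanSpace ℝ (Fin n₁) → EuclideanSpace ℝ (Fin n₂) → ℝ → ℝ → V)
    (S : Set (OscState n₁ n₂ × (ℝ × ℝ))) : Prop :=
  ∃ g' : EuclideanSpace ℝ (Fin n₁) → EuclideanSpace ℝ (Fin n₂) → ℝ → ℝ →
      (EuclideanSpace ℝ (Fin n₁) × ℝ →L[ℝ] V),
    (∀ x z τ₁ τ₂, ((x, z), (τ₁, τ₂)) ∈ S →
      HasFDerivWithinAt (fun q : EuclideanSpace ℝ (Fin n₁) × ℝ => g q.1 z q.2 τ₂)
        (g' x z τ₁ τ₂) {q | ((q.1, z), (q.2, τ₂)) ∈ S} (x, τ₁)) ∧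
    ContinuousOn (fun p : OscState n₁ n₂ × (ℝ × ℝ) => g' p.1.1 p.1.2 p.2.1 p.2.2) S ∧
    LocallyLipschitzInXTau g' S

namespace OscillatoryData

variable {n₁ n₂ : ℕ} (S : OscillatoryData n₁ n₂)

/-- The regularity assumption on `C, D, Φ, G`. -/
structure BasicAssumption : Prop where
  isClosed_C : IsClosed S.C
  isClosed_D : IsClosed S.D
  osc_Φ : OuterSemicontinuousRel (fun θ : OscState n₁ n₂ => S.Φ θ.2) S.C
  locallyBounded_Φ : LocallyBoundedRel (fun θ : OscState n₁ n₂ => S.Φ θ.2) S.C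
  convex_Φ : ∀ θ ∈ S.C, Convex ℝ (S.Φ θ.2)
  nonempty_Φ : ∀ θ ∈ S.C, (S.Φ θ.2).Nonempty
  osc_G : OuterSemicontinuousRel S.G S.D
  locallyBounded_G : LocallyBoundedRel S.G S.D
  nonempty_G : ∀ θ ∈ S.D, (S.G θ).Nonempty

/-- The smoothness, periodicity and zero-average assumption on `φ₁, φ₂` over `C_δ × [0,∞)²`.
The conditions at `δ` contain those at every smaller radius. -/
structure OscillationAssumption (δ T₁ T₂ : ℝ) : Prop where
  δ_pos : 0 < δ
  T₁_pos : 0 < T₁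
  T₂_pos : 0 < T₂
  continuous_φ₁ : ContinuousOn
    (fun p : OscState n₁ n₂ × (ℝ × ℝ) => S.φ₁ p.1.1 p.1.2 p.2.1 p.2.2)
    (withPhases (euclideanInflation S.C δ))
  continuous_φ₂ : ContinuousOn
    (fun p : OscState n₁ n₂ × (ℝ × ℝ) => S.φ₂ p.1.1 p.1.2 p.2.1 p.2.2)
    (withPhases (euclideanInflation S.C δ))
  c1_φ₁ : IsC1InXTau S.φ₁ (withPhases (euclideanInflation S.C δ))
  c0_φ₂ : LocallyLipschitzInXTau S.φ₂ (withPhases (euclideanInflation S.C δ))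
  c0_z_φ₁ : LocallyLipschitzInZ S.φ₁ (withPhases (euclideanInflation S.C δ))
  c0_z_φ₂ : LocallyLipschitzInZ S.φ₂ (withPhases (euclideanInflation S.C δ))
  periodic₁_φ₁ : ∀ x z τ₁ τ₂, (x, z) ∈ euclideanInflation S.C δ → 0 ≤ τ₁ → 0 ≤ τ₂ →
    S.φ₁ x z (τ₁ + T₁) τ₂ = S.φ₁ x z τ₁ τ₂
  periodic₂_φ₁ : ∀ x z τ₁ τ₂, (x, z) ∈ euclideanInflation S.C δ → 0 ≤ τ₁ → 0 ≤ τ₂ →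
    S.φ₁ x z τ₁ (τ₂ + T₂) = S.φ₁ x z τ₁ τ₂
  periodic₁_φ₂ : ∀ x z τ₁ τ₂, (x, z) ∈ euclideanInflation S.C δ → 0 ≤ τ₁ → 0 ≤ τ₂ →
    S.φ₂ x z (τ₁ + T₁) τ₂ = S.φ₂ x z τ₁ τ₂
  periodic₂_φ₂ : ∀ x z τ₁ τ₂, (x, z) ∈ euclideanInflation S.C δ → 0 ≤ τ₁ → 0 ≤ τ₂ →
    S.φ₂ x z τ₁ (τ₂ + T₂) = S.φ₂ x z τ₁ τ₂
  zeroAverage : ∀ x z τ₁, (x, z) ∈ euclideanInflation S.C δ → 0 ≤ τ₁ →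
    ∫ s in (0 : ℝ)..T₂, S.φ₁ x z τ₁ s = 0

/-- `f_ε = ε⁻¹ φ₁ + φ₂`. -/
noncomputable def vectorField (ε : ℝ) (x : EuclideanSpace ℝ (Fin n₁))
    (z : EuclideanSpace ℝ (Fin n₂)) (τ₁ τ₂ : ℝ) : EuclideanSpace ℝ (Fin n₁) :=
  ε⁻¹ • S.φ₁ x z τ₁ τ₂ + S.φ₂ x z τ₁ τ₂

/-- The original oscillatory hybrid system with parameter `ε`, with state `((x, z), (τ₁, τ₂))`. -/
noncomputable def original (ε : ℝ) : HybridSystem (OscState n₁ n₂ × (ℝ × ℝ)) where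
  C := withPhases S.C
  F := fun p => (({S.vectorField ε p.1.1 p.1.2 p.2.1 p.2.2} : Set (EuclideanSpace ℝ (Fin n₁))) ×ˢ
    S.Φ p.1.2) ×ˢ {(ε⁻¹, (ε ^ 2)⁻¹)}
  D := withPhases S.D
  G := fun p => S.G p.1 ×ˢ {p.2}

/-- `u₁(x, z, τ₁, τ₂) = ∫_0^{τ₂} φ₁(x, z, τ₁, s) ds`. -/
noncomputable def u₁ (x : EuclideanSpace ℝ (Fin n₁)) (z : EuclideanSpace ℝ (Fin n₂))
    (τ₁ τ₂ : ℝ) : EuclideanSpace ℝ (Fin n₁) :=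
  ∫ s in (0 : ℝ)..τ₂, S.φ₁ x z τ₁ s

/-- The Lie bracket `[u₁, φ₁]_x = ∂ₓφ₁ · u₁ - ∂ₓu₁ · φ₁`. -/
noncomputable def lieBracket (x : EuclideanSpace ℝ (Fin n₁)) (z : EuclideanSpace ℝ (Fin n₂))
    (τ₁ τ₂ : ℝ) : EuclideanSpace ℝ (Fin n₁) :=
  fderiv ℝ (fun y => S.φ₁ y z τ₁ τ₂) x (S.u₁ x z τ₁ τ₂) -
    fderiv ℝ (fun y => S.u₁ y z τ₁ τ₂) x (S.φ₁ x z τ₁ τ₂)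

/-- The second-order average mapping
`f̄ = (T₁T₂)⁻¹ ∫_0^{T₁} ∫_0^{T₂} (φ₂ + ½ [u₁, φ₁]_x) dτ₂ dτ₁`. It is used only on `C`, which
lies in the interior of `C_δ`, so the derivatives in the bracket exist there. -/
noncomputable def averageMap (T₁ T₂ : ℝ) (θ : OscState n₁ n₂) : EuclideanSpace ℝ (Fin n₁) :=
  (T₁ * T₂)⁻¹ • ∫ τ₁ in (0 : ℝ)..T₁, ∫ τ₂ in (0 : ℝ)..T₂,
    (S.φ₂ θ.1 θ.2 τ₁ τ₂ + (1 / 2 : ℝ) • S.lieBracket θ.1 θ.2 τ₁ τ₂)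

/-- The second-order average hybrid system. -/
noncomputable def average (T₁ T₂ : ℝ) : HybridSystem (OscState n₁ n₂) where
  C := S.C
  F := fun θ => ({S.averageMap T₁ T₂ θ} : Set (EuclideanSpace ℝ (Fin n₁))) ×ˢ S.Φ θ.2
  D := S.D
  G := S.G

end OscillatoryData

/-! ### Absolutely continuous functions -/

/-! The proof has two independent halves. The first shows that solutions of the oscillatory system
that stay bounded on bounded hybrid time converge, as ε → 0, to solutions of the average
(`HasChainLimits`, proved in `OscillatoryData.hasChainLimits`). The second,
`HasChainLimits.isSGPAS`, derives practical stability from this convergence and a bound on jumps,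
and knows nothing of oscillations.

Averaging. A period of the fast phase lasts ε²T₂. In the time σ = (r - s)/ε² the equation reads x' =
ε φ₁(x, z, τ₁ + εσ, σ) + ε² φ₂. To first order x moves by ε u₁(σ), and this closes up after a period
because φ₁ has zero mean. Inserting it into the expansion of φ₁ leaves the displacement ε² ∫
(∂ₓφ₁·u₁ + σ ∂_{τ₁}φ₁ + φ₂) dσ (`IsPeriodicField.exists_window`). The variable z moves only by O(ε²)
in that time, so a Lipschitz bound in z is enough. Summing over windows and averaging over the slow
phase (`IsPeriodicField.exists_averaging`) kills the ∂_{τ₁} term by T₁-periodicity, and an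
integration by parts turns ∂ₓφ₁·u₁ into half the Lie bracket (`IsPeriodicField.fullAverage_eq`).

Limits. Although x has speed of order 1/ε, its increments are at most c(t - s) + O(ε). The curves
are therefore Lipschitz up to a vanishing error and have Lipschitz limits along an ultrafilter
(`IsLimitCurve.exists`). The averaged increments determine the derivative of the limit of x.
Difference quotients of z are means of velocities in Φ, so they lie in closed convex neighbourhoods
of the limiting value of Φ. Jumps pass to the limit because D is closed and G is outer
semicontinuous (`OscillatoryData.exists_limit_segment`, `OscillatoryData.hasChainLimits`).

Stability. By contradiction and compactness, the KL bound of the average holds for small ε up to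
hybrid time 2T with a little slack (`HasChainLimits.exists_forall_le`). T is so large that solutions
from a sublevel set containing K are in {ω ≤ η} at some time between T and T + 1. Restarting from
there again and again covers all later times. -/

theorem AbsolutelyContinuousOnInterval.comp_lipschitzWith {X Y : Type*} [PseudoMetricSpace X]
    [PseudoMetricSpace Y] {f : ℝ → X} {g : X → Y} {K : NNReal} {a b : ℝ}
    (hf : AbsolutelyContinuousOnInterval f a b) (hg : LipschitzWith K g) :
    AbsolutelyContinuousOnInterval (fun t => g (f t)) a b := by
  refine squeeze_zero (fun t => Finset.sum_nonneg fun i _ => dist_nonneg) (fun t => ?_)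
    (by simpa using Tendsto.const_mul (K : ℝ) hf)
  rw [Finset.mul_sum]
  exact Finset.sum_le_sum fun i _ => hg.dist_le_mul _ _

theorem AbsolutelyContinuousOnInterval.comp_add_right {X : Type*} [PseudoMetricSpace X]
    {f : ℝ → X} {a b c : ℝ} (hf : AbsolutelyContinuousOnInterval f (a + c) (b + c)) :
    AbsolutelyContinuousOnInterval (fun t => f (t + c)) a b := by
  rw [absolutelyContinuousOnInterval_iff] at hf ⊢
  intro ε hε
  obtain ⟨δ, hδ, h⟩ := hf ε hε
  refine ⟨δ, hδ, fun E hE hlen => ?_⟩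
  refine h (E.1, fun i => ((E.2 i).1 + c, (E.2 i).2 + c)) ⟨?_, ?_⟩ (by simpa using hlen)
  · intro i hi
    have := hE.1 i hi
    simp only [mem_uIcc] at this ⊢
    constructor
    · rcases this.1 with h | h
      · left; constructor <;> linarith
      · right; constructor <;> linarith
    · rcases this.2 with h | h
      · left; constructor <;> linarith
      · right; constructor <;> linarith
  · intro i hi j hj hij
    have := hE.2 hi hj hij
    simp only [Function.onFun] at this ⊢
    rw [Set.disjoint_left] at this ⊢
    intro x hx hx'
    refine this (a := x - c) ?_ ?_
    · simp only [mem_uIoc] at hx ⊢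
      rcases hx with h | h
      · left; constructor <;> linarith
      · right; constructor <;> linarith
    · simp only [mem_uIoc] at hx' ⊢
      rcases hx' with h | h
      · left; constructor <;> linarith
      · right; constructor <;> linarith

/-- Mean value theorem: the average slope of an absolutely continuous function lies in every closed
convex set that contains almost all derivatives. -/
theorem AbsolutelyContinuousOnInterval.slope_mem {V : Type*} [NormedAddCommGroup V]
    [NormedSpace ℝ V] {f : ℝ → V} {a b : ℝ} (hab : a < b)
    (hf : AbsolutelyContinuousOnInterval f a b) {s : Set V} (hs : Convex ℝ s) (hc : IsClosed s)
    (h : ∀ᵐ t : ℝ, t ∈ Icc a b → ∃ v ∈ s, HasDerivWithinAt f v (Icc a b) t) :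
    (b - a)⁻¹ • (f b - f a) ∈ s := by
  -- A functional `l` that separates the slope strictly from `s` reduces the claim to the scalar
  -- function `l ∘ f`, for which the fundamental theorem of calculus holds. No vector-valued
  -- integral is needed.
  by_contra hn
  obtain ⟨l, u, hlu, hul⟩ := geometric_hahn_banach_closed_point hs hc hn
  have hac : AbsolutelyContinuousOnInterval (fun t => l (f t)) a b :=
    hf.comp_lipschitzWith l.lipschitz
  -- Away from the endpoints the one-sided derivative is a genuine `deriv`.
  have hne : ∀ᵐ t : ℝ, t ≠ a ∧ t ≠ b := by
    filter_upwards [compl_mem_ae_iff.mpr (measure_singleton a),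
      compl_mem_ae_iff.mpr (measure_singleton b)] with t h1 h2 using ⟨h1, h2⟩
  have hle : ∫ t in a..b, deriv (fun t => l (f t)) t ≤ ∫ _t in a..b, u := by
    refine intervalIntegral.integral_mono_ae_restrict hab.le hac.intervalIntegrable_deriv (by simp)
      ?_
    rw [Filter.EventuallyLE, ae_restrict_iff' measurableSet_Icc]
    filter_upwards [h, hne] with t ht htn htab
    obtain ⟨v, hv, hd⟩ := ht htab
    have hnhds : Icc a b ∈ 𝓝 t :=
      Icc_mem_nhds (lt_of_le_of_ne htab.1 (Ne.symm htn.1)) (lt_of_le_of_ne htab.2 htn.2)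
    have hd' := l.hasFDerivAt.comp_hasDerivAt t (hd.hasDerivAt hnhds)
    have : deriv (fun t => l (f t)) t = l v := hd'.deriv
    rw [this]
    exact (hlu v hv).le
  rw [hac.integral_deriv_eq_sub, intervalIntegral.integral_const, smul_eq_mul] at hle
  rw [map_smul, map_sub, smul_eq_mul] at hul
  have hpos : 0 < b - a := sub_pos.mpr hab
  have : (b - a)⁻¹ * (l (f b) - l (f a)) ≤ u := by
    rw [inv_mul_le_iff₀ hpos]
    exact hle
  linarith

/-- This is `slope_mem` for the closed ball of radius `c`. -/
theorem AbsolutelyContinuousOnInterval.norm_sub_le {V : Type*} [NormedAddCommGroup V]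
    [NormedSpace ℝ V] {f : ℝ → V} {a b c : ℝ} (hab : a ≤ b)
    (hf : AbsolutelyContinuousOnInterval f a b)
    (h : ∀ᵐ t : ℝ, t ∈ Icc a b → ∃ v, ‖v‖ ≤ c ∧ HasDerivWithinAt f v (Icc a b) t) :
    ‖f b - f a‖ ≤ c * (b - a) := by
  rcases hab.eq_or_lt with rfl | hab
  · simp
  have := hf.slope_mem hab (convex_closedBall (0 : V) c) Metric.isClosed_closedBall (by
    filter_upwards [h] with t ht htab
    obtain ⟨v, hv, hd⟩ := ht htab
    exact ⟨v, by simpa using hv, hd⟩)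
  have hpos : 0 < b - a := sub_pos.mpr hab
  rw [mem_closedBall_zero_iff, norm_smul, norm_inv, Real.norm_of_nonneg hpos.le,
    inv_mul_le_iff₀ hpos] at this
  linarith

/-! ### Set-valued maps -/

theorem LocallyBoundedRel.exists_norm_le {X Y : Type*} [TopologicalSpace X]
    [NormedAddCommGroup Y] {M : X → Set Y} {K L : Set X} (hM : LocallyBoundedRel M K)
    (hL : IsCompact L) (hLK : L ⊆ K) : ∃ c, 0 ≤ c ∧ ∀ p ∈ L, ∀ v ∈ M p, ‖v‖ ≤ c := by
  refine hL.induction_on (p := fun s => ∃ c, 0 ≤ c ∧ ∀ p ∈ s, p ∈ L → ∀ v ∈ M p, ‖v‖ ≤ c)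
    ⟨0, le_rfl, by simp⟩ ?_ ?_ ?_ |>.imp fun c hc => ⟨hc.1, fun p hp => hc.2 p hp hp⟩
  · rintro s t hst ⟨c, hc0, hc⟩
    exact ⟨c, hc0, fun p hp => hc p (hst hp)⟩
  · rintro s t ⟨c, hc0, hc⟩ ⟨d, hd0, hd⟩
    refine ⟨max c d, le_max_of_le_left hc0, fun p hp hpL v hv => ?_⟩
    rcases hp with hp | hp
    · exact (hc p hp hpL v hv).trans (le_max_left _ _)
    · exact (hd p hp hpL v hv).trans (le_max_right _ _)
  · intro p hp
    obtain ⟨N, hN, hb⟩ := hM p (hLK hp)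
    obtain ⟨c, hc⟩ := hb.exists_norm_le
    refine ⟨N, mem_nhdsWithin_of_mem_nhds hN, max c 0, le_max_right _ _, fun q hq hqL v hv => ?_⟩
    exact (hc v (mem_biUnion (show q ∈ N ∩ K from ⟨hq, hLK hqL⟩) hv)).trans (le_max_left _ _)

/-- Outer semicontinuity is defined by sequences, whereas the limits below are along ultrafilters.
In metric spaces a sequence can be extracted: for each `n`, pick an index at which both families are
within 1/(n+1) of their limits. -/
theorem OuterSemicontinuousRel.mem_of_tendsto {ι X Y : Type*} [PseudoMetricSpace X]
    [PseudoMetricSpace Y] {M : X → Set Y} {K : Set X} (hM : OuterSemicontinuousRel M K)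
    {l : Filter ι} [l.NeBot] {u : ι → X} {s : ι → Y} {p : X} {y : Y} (hp : p ∈ K)
    (hu : Tendsto u l (𝓝 p)) (hs : Tendsto s l (𝓝 y)) (huK : ∀ᶠ i in l, u i ∈ K)
    (hsM : ∀ᶠ i in l, s i ∈ M (u i)) : y ∈ M p := by
  have key : ∀ n : ℕ, ∃ i, dist (u i) p < 1 / (n + 1) ∧ dist (s i) y < 1 / (n + 1) ∧ u i ∈ K ∧
      s i ∈ M (u i) := by
    intro n
    have hn : (0 : ℝ) < 1 / (n + 1) := by positivity
    exact ((Metric.tendsto_nhds.mp hu _ hn).and ((Metric.tendsto_nhds.mp hs _ hn).and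
      (huK.and hsM))).exists
  choose i h1 h2 h3 h4 using key
  refine hM (fun n => u (i n)) (fun n => s (i n)) p y h3 hp ?_ h4 ?_
  · exact tendsto_iff_dist_tendsto_zero.mpr (squeeze_zero (fun _ => dist_nonneg)
      (fun n => (h1 n).le) tendsto_one_div_add_atTop_nhds_zero_nat)
  · exact tendsto_iff_dist_tendsto_zero.mpr (squeeze_zero (fun _ => dist_nonneg)
      (fun n => (h2 n).le) tendsto_one_div_add_atTop_nhds_zero_nat)

theorem OuterSemicontinuousRel.isClosed {X Y : Type*} [PseudoMetricSpace X]
    [PseudoMetricSpace Y] {M : X → Set Y} {K : Set X} (hM : OuterSemicontinuousRel M K)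
    {p : X} (hp : p ∈ K) : IsClosed (M p) := by
  refine IsSeqClosed.isClosed fun s y hs hy => ?_
  exact hM (fun _ => p) s p y (fun _ => hp) hp tendsto_const_nhds hs hy

/-- A family bounded along an ultrafilter converges along it. -/
theorem Ultrafilter.exists_tendsto_of_norm_le {ι E : Type*} [NormedAddCommGroup E] [ProperSpace E]
    (U : Ultrafilter ι) {u : ι → E} {c : ℝ} (h : ∀ᶠ i in (U : Filter ι), ‖u i‖ ≤ c) :
    ∃ p, Tendsto u U (𝓝 p) := by
  have hc : IsCompact (Metric.closedBall (0 : E) c) := isCompact_closedBall 0 c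
  have := isCompact_iff_ultrafilter_le_nhds.mp hc (U.map u) (by
    simp only [Ultrafilter.coe_map, le_principal_iff, Filter.mem_map]
    filter_upwards [h] with i hi
    simpa using hi)
  obtain ⟨p, -, hp⟩ := this
  exact ⟨p, hp⟩

/-- An outer semicontinuous, locally bounded map is upper semicontinuous. -/
theorem OuterSemicontinuousRel.exists_subset_cthickening {X Y : Type*} [PseudoMetricSpace X]
    [NormedAddCommGroup Y] [ProperSpace Y] {M : X → Set Y} {K : Set X}
    (hM : OuterSemicontinuousRel M K) (hb : LocallyBoundedRel M K) {p : X} (hp : p ∈ K) {σ : ℝ}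
    (hσ : 0 < σ) :
    ∃ κ > 0, ∀ q ∈ K, dist q p < κ → M q ⊆ Metric.cthickening σ (M p) := by
  by_contra! hcon
  have key : ∀ n : ℕ, ∃ q ∈ K, dist q p < 1 / (n + 1) ∧ ∃ v ∈ M q,
      v ∉ Metric.cthickening σ (M p) := by
    intro n
    obtain ⟨q, hq, hd, hns⟩ := hcon (1 / (n + 1)) (by positivity)
    exact ⟨q, hq, hd, not_subset.mp hns⟩
  choose q hqK hqd v hv hvn using key
  have hq : Tendsto q atTop (𝓝 p) :=
    tendsto_iff_dist_tendsto_zero.mpr (squeeze_zero (fun _ => dist_nonneg)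
      (fun n => (hqd n).le) tendsto_one_div_add_atTop_nhds_zero_nat)
  obtain ⟨N, hN, hbd⟩ := hb p hp
  obtain ⟨c, hc⟩ := hbd.exists_norm_le
  -- Convergence along a free ultrafilter replaces the passage to a subsequence of the bounded `v
  -- n`.
  have hUle : (hyperfilter ℕ : Filter ℕ) ≤ atTop := Nat.hyperfilter_le_atTop
  have hbnd : ∀ᶠ n in atTop, ‖v n‖ ≤ c := by
    filter_upwards [hq hN] with n hn
    exact hc _ (mem_biUnion (show q n ∈ N ∩ K from ⟨hn, hqK n⟩) (hv n))
  obtain ⟨y, hy⟩ := (hyperfilter ℕ).exists_tendsto_of_norm_le (hUle hbnd)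
  have hyM : y ∈ M p := hM.mem_of_tendsto hp (hq.mono_left hUle) hy (.of_forall hqK) (.of_forall hv)
  have hyt : y ∈ Metric.thickening σ (M p) := Metric.self_subset_thickening hσ _ hyM
  obtain ⟨n, hn⟩ := (hy.eventually (Metric.isOpen_thickening.mem_nhds hyt)).exists
  exact hvn n (Metric.thickening_subset_cthickening _ _ hn)

/-! ### Solutions on compact hybrid time domains -/

/-- `x` flows on `[a, b]`; there is no condition on a degenerate interval. -/
def HybridSystem.IsFlowSegment {E : Type*} [NormedAddCommGroup E] [NormedSpace ℝ E]
    (H : HybridSystem E) (x : ℝ → E) (a b : ℝ) : Prop :=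
  a < b → AbsolutelyContinuousOnInterval x a b ∧ (∀ t ∈ Icc a b, x t ∈ H.C) ∧
    ∀ᵐ t : ℝ, t ∈ Icc a b → ∃ v ∈ H.F (x t), HasDerivWithinAt x v (Icc a b) t

/-- A solution on the compact hybrid time domain `⋃_{k ≤ J} [t k, t (k + 1)] × {k}`, where `x k` is
the curve followed on the `k`-th interval. -/
structure HybridSystem.IsChain {E : Type*} [NormedAddCommGroup E] [NormedSpace ℝ E]
    (H : HybridSystem E) (J : ℕ) (t : ℕ → ℝ) (x : ℕ → ℝ → E) : Prop where
  zero : t 0 = 0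
  start : x 0 0 ∈ H.C ∪ H.D
  le : ∀ k ≤ J, t k ≤ t (k + 1)
  flow : ∀ k ≤ J, H.IsFlowSegment (x k) (t k) (t (k + 1))
  jump : ∀ k < J, x k (t (k + 1)) ∈ H.D ∧ x (k + 1) (t (k + 1)) ∈ H.G (x k (t (k + 1)))

section

variable {E : Type*} [NormedAddCommGroup E] [NormedSpace ℝ E] {H : HybridSystem E}

theorem HybridSystem.IsFlowSegment.mono {x : ℝ → E} {a b c d : ℝ} (h : H.IsFlowSegment x a b)
    (hac : a ≤ c) (hdb : d ≤ b) : H.IsFlowSegment x c d := by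
  intro hcd
  obtain ⟨h1, h2, h3⟩ := h (by linarith)
  have hsub : Icc c d ⊆ Icc a b := Icc_subset_Icc hac hdb
  refine ⟨h1.mono ?_, fun t ht => h2 t (hsub ht), ?_⟩
  · rwa [uIcc_of_le hcd.le, uIcc_of_le (by linarith)]
  · filter_upwards [h3] with t ht htcd
    obtain ⟨v, hv, hd⟩ := ht (hsub htcd)
    exact ⟨v, hv, hd.mono hsub⟩

theorem HybridSystem.IsFlowSegment.comp_add_right {x : ℝ → E} {a b c : ℝ}
    (h : H.IsFlowSegment x (a + c) (b + c)) : H.IsFlowSegment (fun t => x (t + c)) a b := by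
  intro hab
  obtain ⟨h1, h2, h3⟩ := h (by linarith)
  refine ⟨h1.comp_add_right, fun t ht => h2 _ ⟨by linarith [ht.1], by linarith [ht.2]⟩, ?_⟩
  have h4 := (measurePreserving_add_right (volume : Measure ℝ) c).quasiMeasurePreserving.ae h3
  filter_upwards [h4] with t ht htab
  obtain ⟨v, hv, hd⟩ := ht ⟨by linarith [htab.1], by linarith [htab.2]⟩
  refine ⟨v, hv, ?_⟩
  have hs : HasDerivWithinAt (fun r : ℝ => r + c) 1 (Icc a b) t :=
    (hasDerivWithinAt_id t _).add_const c
  have hmaps : MapsTo (fun r : ℝ => r + c) (Icc a b) (Icc (a + c) (b + c)) :=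
    fun r hr => ⟨by simpa using hr.1, by simpa using hr.2⟩
  have := HasDerivWithinAt.scomp t hd hs hmaps
  simpa [Function.comp_def] using this

theorem HybridSystem.IsFlowSegment.continuousOn {x : ℝ → E} {a b : ℝ}
    (h : H.IsFlowSegment x a b) : ContinuousOn x (Icc a b) := by
  rcases lt_or_ge a b with hab | hab
  · have := (h hab).1.continuousOn
    rwa [uIcc_of_le hab.le] at this
  · exact (Set.subsingleton_Icc_of_ge hab).continuousOn x

theorem HybridSystem.IsChain.monotone {J : ℕ} {t : ℕ → ℝ} {x : ℕ → ℝ → E} (h : H.IsChain J t x)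
    {i j : ℕ} (hij : i ≤ j) (hj : j ≤ J + 1) : t i ≤ t j := by
  induction j, hij using Nat.le_induction with
  | base => exact le_rfl
  | succ n hn ih => exact (ih (by omega)).trans (h.le n (by omega))

theorem HybridSystem.IsChain.nonneg {J : ℕ} {t : ℕ → ℝ} {x : ℕ → ℝ → E} (h : H.IsChain J t x)
    {j : ℕ} (hj : j ≤ J + 1) : 0 ≤ t j :=
  h.zero ▸ h.monotone (Nat.zero_le j) hj

/-- Every state of a chain is the final state of a truncation. Statements about final states of all
chains therefore control all intermediate times as well. -/
theorem HybridSystem.IsChain.trunc {J : ℕ} {t : ℕ → ℝ} {x : ℕ → ℝ → E} (h : H.IsChain J t x)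
    {k : ℕ} (hk : k ≤ J) {s : ℝ} (hs : s ∈ Icc (t k) (t (k + 1))) :
    H.IsChain k (Function.update t (k + 1) s) x where
  zero := by simpa using h.zero
  start := h.start
  le i hi := by
    rw [Function.update_of_ne (by omega)]
    rcases hi.eq_or_lt with rfl | hi'
    · simpa using hs.1
    · rw [Function.update_of_ne (by omega)]
      exact h.le i (by omega)
  flow i hi := by
    rw [Function.update_of_ne (by omega)]
    rcases hi.eq_or_lt with rfl | hi'
    · simpa using (h.flow i hk).mono le_rfl hs.2
    · rw [Function.update_of_ne (by omega)]
      exact h.flow i (by omega)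
  jump i hi := by
    rw [Function.update_of_ne (by omega)]
    exact h.jump i (by omega)

/-- Restarting at time `s` requires a state in C ∪ D. The hypothesis `hlt` provides it: either some
flow remains after `s`, and the state is in C, or a jump follows, and it is in D. -/
theorem HybridSystem.IsChain.tail {J : ℕ} {t : ℕ → ℝ} {x : ℕ → ℝ → E} (h : H.IsChain J t x)
    {k : ℕ} (hk : k ≤ J) {s : ℝ} (hs : s ∈ Icc (t k) (t (k + 1))) (hlt : s < t (k + 1) ∨ k < J) :
    H.IsChain (J - k) (fun i => if i = 0 then 0 else t (i + k) - s)
      (fun i r => x (i + k) (r + s)) where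
  zero := by simp
  start := by
    simp only [zero_add]
    rcases hs.2.lt_or_eq with h1 | h1
    · exact Or.inl (((h.flow k hk) (lt_of_le_of_lt hs.1 h1)).2.1 s hs)
    · have hkJ : k < J := by
        rcases hlt with h2 | h2
        · exact absurd h1 h2.ne
        · exact h2
      right
      rw [h1]
      exact (h.jump k hkJ).1
  le i hi := by
    rcases Nat.eq_zero_or_pos i with rfl | hi'
    · simp only [if_true, zero_add, one_ne_zero, if_false]
      rw [add_comm 1 k]
      linarith [hs.2]
    · simp only [hi'.ne', Nat.succ_ne_zero, if_false]
      have := h.le (i + k) (by omega)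
      rw [show i + 1 + k = i + k + 1 by ring]
      linarith
  flow i hi := by
    rcases Nat.eq_zero_or_pos i with rfl | hi'
    · simp only [if_true, zero_add, one_ne_zero, if_false]
      refine HybridSystem.IsFlowSegment.comp_add_right ?_
      rw [zero_add, sub_add_cancel, add_comm 1 k]
      exact (h.flow k hk).mono hs.1 le_rfl
    · simp only [hi'.ne', Nat.succ_ne_zero, if_false]
      refine HybridSystem.IsFlowSegment.comp_add_right ?_
      rw [sub_add_cancel, sub_add_cancel, show i + 1 + k = i + k + 1 by ring]
      exact h.flow (i + k) (by omega)
  jump i hi := by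
    simp only [Nat.succ_ne_zero, if_false, sub_add_cancel]
    rw [show i + 1 + k = i + k + 1 by ring]
    exact h.jump (i + k) (by omega)

theorem HybridSystem.IsSolution.exists_isChain {y : HybridArc E} (hy : H.IsSolution y) {T : ℝ}
    {J : ℕ} (hT : (T, J) ∈ y.dom) :
    ∃ t, H.IsChain J t (fun k s => y.val s k) ∧ t (J + 1) = T := by
  obtain ⟨J', t, ht0, htm, hE⟩ := y.isHybridTimeDomain.2 _ hT
  have hmem : ∀ s k, ((s, k) ∈ y.dom ∧ s ∈ Icc 0 T ∧ k ≤ J) ↔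
      (k < J' ∧ s ∈ Icc (t k) (t (k + 1))) := by
    intro s k
    have := Set.ext_iff.mp hE (s, k)
    simpa using this
  have hJJ : J < J' := ((hmem T J).mp ⟨hT, ⟨y.isHybridTimeDomain.1 _ hT, le_rfl⟩, le_rfl⟩).1
  -- A further interval would put a point with jump index J + 1 into the truncation, which only has
  -- indices up to J.
  have hJ' : J' = J + 1 := by
    by_contra hne
    have := ((hmem (t (J + 1)) (J + 1)).mpr
      ⟨by omega, le_rfl, htm _ (by omega)⟩).2.2
    omega
  subst hJ'
  have hTJ : t (J + 1) = T := by
    apply le_antisymm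
    · exact ((hmem (t (J + 1)) J).mpr ⟨by omega, htm _ (by omega), le_rfl⟩).2.1.2
    · exact ((hmem T J).mp ⟨hT, ⟨y.isHybridTimeDomain.1 _ hT, le_rfl⟩, le_rfl⟩).2.2
  have hsub : ∀ k ≤ J, Icc (t k) (t (k + 1)) ⊆ y.flowInterval k := fun k hk s hs =>
    ((hmem s k).mpr ⟨by omega, hs⟩).1
  refine ⟨t, ⟨ht0, hy.1, fun k hk => htm k (by omega), ?_, ?_⟩, hTJ⟩
  · intro k hk hlt
    have hint : (interior (y.flowInterval k)).Nonempty :=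
      (nonempty_Ioo.mpr hlt).mono (interior_Icc (a := t k) ▸ interior_mono (hsub k hk))
    refine ⟨y.locallyAbsolutelyContinuous k hint _ _ hlt.le (hsub k hk), ?_, ?_⟩
    · exact fun s hs => (hy.2.1 k hint).1 s (hsub k hk hs)
    · filter_upwards [(hy.2.1 k hint).2] with s hs hsk
      obtain ⟨v, hv, hd⟩ := hs (hsub k hk hsk)
      exact ⟨v, hv, hd.mono (hsub k hk)⟩
  · intro k hk
    refine hy.2.2 _ k (hsub k hk.le ⟨htm _ (by omega), le_rfl⟩)
      (hsub (k + 1) (by omega) ⟨le_rfl, htm _ (by omega)⟩)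

/-- Through this direction the stability of the average applies to the chains obtained as limits.
The converse `exists_isChain` serves the solutions of the oscillatory system. -/
theorem HybridSystem.IsChain.exists_isSolution {J : ℕ} {t : ℕ → ℝ} {x : ℕ → ℝ → E}
    (h : H.IsChain J t x) :
    ∃ y : HybridArc E, H.IsSolution y ∧ (t (J + 1), J) ∈ y.dom ∧ ∀ s k, y.val s k = x k s := by
  have hI : ∀ k, {s : ℝ | (s, k) ∈ {p : ℝ × ℕ | p.2 ≤ J ∧ p.1 ∈ Icc (t p.2) (t (p.2 + 1))}} =
      {s | k ≤ J ∧ s ∈ Icc (t k) (t (k + 1))} := fun k => rfl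
  have hint : ∀ k, (interior {s : ℝ | k ≤ J ∧ s ∈ Icc (t k) (t (k + 1))}).Nonempty →
      k ≤ J ∧ t k < t (k + 1) := by
    rintro k ⟨s, hs⟩
    have hk : k ≤ J := (interior_subset hs).1
    refine ⟨hk, ?_⟩
    have : {s : ℝ | k ≤ J ∧ s ∈ Icc (t k) (t (k + 1))} = Icc (t k) (t (k + 1)) := by
      ext r; simp [hk]
    rw [this, interior_Icc] at hs
    exact hs.1.trans hs.2
  refine ⟨{
    dom := {p | p.2 ≤ J ∧ p.1 ∈ Icc (t p.2) (t (p.2 + 1))}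
    dom_nonempty := ⟨(t 0, 0), Nat.zero_le _, le_rfl, h.le 0 (Nat.zero_le _)⟩
    isHybridTimeDomain := ⟨?_, ?_⟩
    val := fun s k => x k s
    locallyAbsolutelyContinuous := ?_ }, ?_, ?_, fun s k => rfl⟩
  · rintro ⟨s, k⟩ ⟨hk, hs⟩
    exact (h.nonneg (by simp at hk; omega)).trans hs.1
  · rintro ⟨T, K⟩ ⟨hK, hT⟩
    simp only at hK hT
    have htr := h.trunc hK hT
    refine ⟨K + 1, Function.update t (K + 1) T, htr.zero, fun j hj => htr.le j (by omega), ?_⟩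
    ext ⟨s, k⟩
    simp only [mem_inter_iff, mem_ofPred_eq]
    constructor
    · rintro ⟨⟨hk, hs⟩, hsT, hkK⟩
      refine ⟨by omega, ?_⟩
      rw [Function.update_of_ne (by omega)]
      rcases hkK.eq_or_lt with rfl | hlt
      · simpa using ⟨hs.1, hsT.2⟩
      · rwa [Function.update_of_ne (by omega)]
    · rintro ⟨hk, hs⟩
      rw [Function.update_of_ne (by omega)] at hs
      have hk' : k ≤ K := by omega
      rcases hk'.eq_or_lt with rfl | hlt
      · simp only [Function.update_self] at hs
        exact ⟨⟨hK, hs.1, hs.2.trans hT.2⟩, ⟨(h.nonneg (by omega)).trans hs.1, hs.2⟩, le_rfl⟩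
      · rw [Function.update_of_ne (by omega)] at hs
        exact ⟨⟨by omega, hs⟩, ⟨(h.nonneg (by omega)).trans hs.1,
          hs.2.trans ((h.monotone (by omega) (by omega)).trans hT.1)⟩, hk'⟩
  · intro k hk a b hab hsub
    rw [hI k] at hk hsub
    obtain ⟨hkJ, hlt⟩ := hint k hk
    refine ((h.flow k hkJ) hlt).1.mono ?_
    rw [uIcc_of_le hab, uIcc_of_le hlt.le]
    exact fun s hs => (hsub hs).2
  · refine ⟨h.start, ?_, ?_⟩
    · intro k hk
      change (interior {s : ℝ | k ≤ J ∧ s ∈ Icc (t k) (t (k + 1))}).Nonempty at hk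
      obtain ⟨hkJ, hlt⟩ := hint k hk
      obtain ⟨h1, h2, h3⟩ := (h.flow k hkJ) hlt
      refine ⟨fun s hs => h2 s hs.2, ?_⟩
      filter_upwards [h3] with s hs hsk
      obtain ⟨v, hv, hd⟩ := hs hsk.2
      exact ⟨v, hv, hd.mono fun r hr => hr.2⟩
    · rintro s k ⟨hk, hs⟩ ⟨hk', hs'⟩
      simp only at hk hs hk' hs'
      obtain rfl : s = t (k + 1) := le_antisymm hs.2 hs'.1
      exact h.jump k (by omega)
  · exact ⟨le_rfl, h.le J le_rfl, le_rfl⟩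

/-- Hybrid time `s + k` takes a value in each interval of length one below its final value. -/
theorem HybridSystem.IsChain.exists_time_mem_Icc {J : ℕ} {t : ℕ → ℝ} {x : ℕ → ℝ → E}
    (h : H.IsChain J t x) {c : ℝ} (hc : 0 ≤ c) (hcJ : c ≤ t (J + 1) + J) :
    ∃ k ≤ J, ∃ s ∈ Icc (t k) (t (k + 1)), s + k ∈ Icc c (c + 1) := by
  classical
  have hex : ∃ k, c ≤ t (k + 1) + k := ⟨J, hcJ⟩
  have hk := Nat.find_spec hex
  have hkJ : Nat.find hex ≤ J := Nat.find_min' hex hcJ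
  have hmin := fun m => Nat.find_min hex (m := m)
  generalize Nat.find hex = k at hk hkJ hmin
  -- Interval `k` is the first whose end reaches hybrid time `c`. Its start may already exceed `c`
  -- because of the jump before it, but by minimality of `k` by less than one.
  refine ⟨k, hkJ, max (t k) (c - k), ⟨le_max_left _ _, max_le (h.le k hkJ) (by linarith)⟩, ?_⟩
  rw [max_add, sub_add_cancel]
  refine ⟨le_max_right _ _, max_le ?_ (by linarith)⟩
  rcases Nat.eq_zero_or_pos k with rfl | hpos
  · simp [h.zero]; linarith
  · have := hmin (k - 1) (by omega)
    rw [Nat.sub_add_cancel hpos, Nat.cast_pred hpos] at this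
    linarith

/-- A chain of long duration is the concatenation of one of duration between `c` and `c + 1` and
another one. -/
theorem HybridSystem.IsChain.exists_split {J : ℕ} {t : ℕ → ℝ} {x : ℕ → ℝ → E}
    (h : H.IsChain J t x) {c : ℝ} (hc : 0 ≤ c) (hcJ : c + 1 < t (J + 1) + J) :
    ∃ (J₁ J₂ : ℕ) (t₁ t₂ : ℕ → ℝ) (x₁ x₂ : ℕ → ℝ → E), H.IsChain J₁ t₁ x₁ ∧ H.IsChain J₂ t₂ x₂ ∧
      x₁ 0 0 = x 0 0 ∧ x₁ J₁ (t₁ (J₁ + 1)) = x₂ 0 0 ∧ x₂ J₂ (t₂ (J₂ + 1)) = x J (t (J + 1)) ∧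
      t₁ (J₁ + 1) + J₁ ∈ Icc c (c + 1) ∧
      (t₁ (J₁ + 1) + J₁) + (t₂ (J₂ + 1) + J₂) = t (J + 1) + J := by
  obtain ⟨k, hk, s, hs, hsk⟩ := h.exists_time_mem_Icc hc (by linarith)
  have hlt : s < t (k + 1) ∨ k < J := by
    -- If nothing remained after the splitting point, the whole chain would last at most `c + 1`.
    by_contra! hcon
    obtain rfl : k = J := le_antisymm hk hcon.2
    linarith [hsk.2, hcon.1]
  refine ⟨k, J - k, _, _, _, _, h.trunc hk hs, h.tail hk hs hlt, rfl, ?_, ?_, ?_, ?_⟩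
  · simp
  · simp only [Nat.succ_ne_zero, if_false, sub_add_cancel]
    rw [Nat.sub_add_cancel hk, show J - k + 1 + k = J + 1 by omega]
  · simpa using hsk
  · simp only [Function.update_self, Nat.succ_ne_zero, if_false]
    rw [show J - k + 1 + k = J + 1 by omega, Nat.cast_sub hk]
    ring

end

/-! ### From limits of solutions to practical stability -/

/-- Bounded solutions of `H ε` on compact time domains converge, as `ε → 0`, to solutions of `H₀`.
Convergence is expressed along ultrafilters. -/
def HasChainLimits {E P : Type*} [NormedAddCommGroup E] [NormedSpace ℝ E]
    [NormedAddCommGroup P] [NormedSpace ℝ P] (H : ℝ → HybridSystem (E × P))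
    (H₀ : HybridSystem E) : Prop :=
  ∀ (U : Ultrafilter ℕ) (ε : ℕ → ℝ) (J : ℕ) (t : ℕ → ℕ → ℝ) (x : ℕ → ℕ → ℝ → E × P) (T ρ : ℝ),
    (∀ i, 0 < ε i) → Tendsto ε U (𝓝 0) →
    (∀ᶠ i in (U : Filter ℕ), (H (ε i)).IsChain J (t i) (x i) ∧ t i (J + 1) ≤ T ∧
      ∀ k ≤ J, ∀ s ∈ Icc (t i k) (t i (k + 1)), ‖(x i k s).1‖ ≤ ρ) →
    ∃ (t' : ℕ → ℝ) (x' : ℕ → ℝ → E), H₀.IsChain J t' x' ∧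
      Tendsto (fun i => t i (J + 1)) U (𝓝 (t' (J + 1))) ∧
      Tendsto (fun i => (x i 0 0).1) U (𝓝 (x' 0 0)) ∧
      Tendsto (fun i => (x i J (t i (J + 1))).1) U (𝓝 (x' J (t' (J + 1))))

/-- A function with finitely many values is constant on a set of the ultrafilter. This fixes the
number of jumps along a family of chains. -/
theorem Ultrafilter.exists_eventually_eq_of_le {ι : Type*} (U : Ultrafilter ι) {J : ι → ℕ} {N : ℕ}
    (h : ∀ i, J i ≤ N) : ∃ j, ∀ᶠ i in (U : Filter ι), J i = j := by
  obtain ⟨j, -, hj⟩ := isCompact_iff_ultrafilter_le_nhds.mp (finite_Iic N).isCompact (U.map J)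
    (by simp only [Ultrafilter.coe_map, le_principal_iff, Filter.mem_map]
        exact univ_mem' h)
  rw [nhds_discrete, Ultrafilter.coe_map, le_pure_iff] at hj
  exact ⟨j, hj⟩

/-- An unbounded sequence in the sublevel set, or one whose limit leaves B and hence lies on the
frontier, would make ω unbounded by properness, while ω ≤ `c` along it. -/
theorem IsProperIndicator.isCompact_sublevel {E : Type*} [NormedAddCommGroup E]
    [ProperSpace E] {A B : Set E} {ω : E → ℝ}
    (hω : IsProperIndicator A B ω) (hB : IsOpen B) (c : ℝ) : IsCompact {x ∈ B | ω x ≤ c} := by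
  have hbdd : Bornology.IsBounded {x ∈ B | ω x ≤ c} := by
    by_contra hnb
    have : ∀ n : ℕ, ∃ x ∈ {x ∈ B | ω x ≤ c}, (n : ℝ) < ‖x‖ := by
      intro n
      by_contra! hcon
      exact hnb (isBounded_iff_forall_norm_le.mpr ⟨n, hcon⟩)
    choose u hu hun using this
    refine hω.2.2.2 u (fun i => (hu i).1) (Or.inr fun hb => ?_) ⟨c, ?_⟩
    · obtain ⟨C, hC⟩ := hb.exists_norm_le
      obtain ⟨n, hn⟩ := exists_nat_gt C
      linarith [hun n, hC (u n) (mem_range_self n)]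
    · rintro _ ⟨i, rfl⟩
      exact (hu i).2
  refine Metric.isCompact_of_isClosed_isBounded (IsSeqClosed.isClosed fun u p hu hp => ?_) hbdd
  have hpB : p ∈ B := by
    by_contra hpn
    have hfr : p ∈ frontier B := by
      rw [hB.frontier_eq]
      exact ⟨mem_closure_of_tendsto hp (.of_forall fun i => (hu i).1), hpn⟩
    refine hω.2.2.2 u (fun i => (hu i).1) (Or.inl ?_) ⟨c, ?_⟩
    · refine tendsto_of_tendsto_of_tendsto_of_le_of_le tendsto_const_nhds
        (tendsto_iff_edist_tendsto_0.mp hp) (fun _ => zero_le) fun i =>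
        Metric.infEDist_le_edist_of_mem hfr
    · rintro _ ⟨i, rfl⟩
      exact (hu i).2
  refine ⟨hpB, le_of_tendsto (((hω.1.continuousAt (hB.mem_nhds hpB)).tendsto).comp hp)
    (.of_forall fun i => (hu i).2)⟩

section

variable {E P : Type*} [NormedAddCommGroup E] [NormedSpace ℝ E]
    [NormedAddCommGroup P] [NormedSpace ℝ P]

/-- A chain that ends outside an open set has a first point outside it. -/
theorem HybridSystem.IsChain.exists_first_notMem {H : HybridSystem (E × P)} {J : ℕ} {t : ℕ → ℝ}
    {x : ℕ → ℝ → E × P} (h : H.IsChain J t x) {O : Set E} (hO : IsOpen O)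
    (hn : (x J (t (J + 1))).1 ∉ O) :
    ∃ k ≤ J, ∃ s ∈ Icc (t k) (t (k + 1)), (x k s).1 ∉ O ∧
      ∀ k' ≤ k, ∀ s' ∈ Icc (t k') (t (k' + 1)), k' < k ∨ s' < s → (x k' s').1 ∈ O := by
  classical
  have hex : ∃ k, k ≤ J ∧ ∃ s ∈ Icc (t k) (t (k + 1)), (x k s).1 ∉ O :=
    ⟨J, le_rfl, t (J + 1), ⟨h.le J le_rfl, le_rfl⟩, hn⟩
  obtain ⟨hkJ, s₀, hs₀, hs₀n⟩ := Nat.find_spec hex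
  have hmin := fun m => Nat.find_min hex (m := m)
  generalize Nat.find hex = k at hs₀ hkJ hmin hs₀n
  have hcont : ContinuousOn (fun s => (x k s).1) (Icc (t k) (t (k + 1))) :=
    continuous_fst.comp_continuousOn (h.flow k hkJ).continuousOn
  -- In the first interval that contains a bad point, the bad times form a nonempty compact set,
  -- which has a least element.
  have hcl : IsClosed (Icc (t k) (t (k + 1)) ∩ (fun s => (x k s).1) ⁻¹' Oᶜ) :=
    hcont.preimage_isClosed_of_isClosed isClosed_Icc hO.isClosed_compl
  have hcpt : IsCompact (Icc (t k) (t (k + 1)) ∩ (fun s => (x k s).1) ⁻¹' Oᶜ) :=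
    isCompact_Icc.of_isClosed_subset hcl inter_subset_left
  obtain ⟨s, hs, hleast⟩ := hcpt.exists_isLeast ⟨s₀, hs₀, hs₀n⟩
  refine ⟨k, hkJ, s, hs.1, hs.2, fun k' hk' s' hs' hor => ?_⟩
  by_contra hbad
  rcases hk'.eq_or_lt with rfl | hlt
  · have := hleast ⟨hs', hbad⟩
    rcases hor with h1 | h1
    · omega
    · linarith
  · exact hmin k' hlt ⟨by omega, s', hs', hbad⟩

variable {H : ℝ → HybridSystem (E × P)} {H₀ : HybridSystem E}

/-- If the solutions of `H₀` from `K` remain in a bounded open set up to hybrid time `T`, so do those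
of `H ε` for small `ε`. -/
theorem HasChainLimits.exists_forall_mem (hlim : HasChainLimits H H₀)
    (hjump : ∀ ρ, ∃ ρ', ∀ ε p q, p ∈ (H ε).D → ‖p.1‖ ≤ ρ → q ∈ (H ε).G p → ‖q.1‖ ≤ ρ')
    {K O : Set E} (hK : IsCompact K) (hO : IsOpen O) (hOb : Bornology.IsBounded O) {T : ℝ}
    (h₀ : ∀ J t x, H₀.IsChain J t x → x 0 0 ∈ K → t (J + 1) + J ≤ T → x J (t (J + 1)) ∈ O) :
    ∃ ε₀ > 0, ∀ ε, 0 < ε → ε ≤ ε₀ → ∀ J t x, (H ε).IsChain J t x → (x 0 0).1 ∈ K →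
      t (J + 1) + J ≤ T → (x J (t (J + 1))).1 ∈ O := by
  by_contra! hcon
  -- `HasChainLimits` requires bounded chains, so each offending chain is cut at its first exit from
  -- O. Up to that point it is bounded by `c₁` inside O, by `c₂` at the start in K, and by `c₃`
  -- after a jump from O.
  obtain ⟨c₁, hc₁⟩ := hOb.exists_norm_le
  obtain ⟨c₂, hc₂⟩ := hK.isBounded.exists_norm_le
  obtain ⟨c₃, hc₃⟩ := hjump c₁
  have key : ∀ n : ℕ, ∃ ε, 0 < ε ∧ ε ≤ 1 / ((n : ℝ) + 1) ∧ ∃ J t x, (H ε).IsChain J t x ∧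
      (x 0 0).1 ∈ K ∧ t (J + 1) + J ≤ T ∧ (x J (t (J + 1))).1 ∉ O ∧
      ∀ k ≤ J, ∀ s ∈ Icc (t k) (t (k + 1)), ‖(x k s).1‖ ≤ max c₁ (max c₂ c₃) := by
    intro n
    obtain ⟨ε, hε, hεn, J, t, x, hch, hx0, hT, hn⟩ := hcon (1 / (n + 1)) (by positivity)
    obtain ⟨k, hk, s, hs, hsn, hfirst⟩ := hch.exists_first_notMem hO hn
    refine ⟨ε, hε, hεn, k, _, x, hch.trunc hk hs, hx0, ?_, ?_, ?_⟩
    · have h1 : t (k + 1) ≤ t (J + 1) := hch.monotone (by omega) le_rfl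
      have h2 : (k : ℝ) ≤ J := by exact_mod_cast hk
      simp only [Function.update_self]
      linarith [hs.2]
    · simpa using hsn
    · have hbefore : ∀ k' ≤ k, ∀ s' ∈ Icc (t k') (t (k' + 1)), k' < k ∨ s' < s →
          ‖(x k' s').1‖ ≤ c₁ := fun k' hk' s' hs' hor => hc₁ _ (hfirst k' hk' s' hs' hor)
      -- The exit point is either a limit of states in O along a flow, or the initial state, or the
      -- result of a jump from a state in O.
      have hlast : ‖(x k s).1‖ ≤ max c₁ (max c₂ c₃) := by
        rcases hs.1.lt_or_eq with hlt | heq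
        · refine le_max_of_le_left ?_
          have hcont : ContinuousWithinAt (fun r => ‖(x k r).1‖) (Ico (t k) s) s :=
            ((continuous_fst.comp_continuousOn (hch.flow k hk).continuousOn).norm s hs).mono
              fun r hr => ⟨hr.1, hr.2.le.trans hs.2⟩
          refine hcont.closure_le ?_ continuousWithinAt_const fun r hr =>
            hbefore k le_rfl r ⟨hr.1, hr.2.le.trans hs.2⟩ (Or.inr hr.2)
          rw [closure_Ico hlt.ne]
          exact ⟨hlt.le, le_rfl⟩
        · rcases Nat.eq_zero_or_pos k with rfl | hpos
          · rw [hch.zero] at heq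
            rw [← heq]
            exact le_max_of_le_right (le_max_of_le_left (hc₂ _ hx0))
          · obtain ⟨m, rfl⟩ : ∃ m, k = m + 1 := ⟨k - 1, by omega⟩
            obtain ⟨hD, hG⟩ := hch.jump m (by omega)
            rw [← heq]
            refine le_max_of_le_right (le_max_of_le_right (hc₃ ε _ _ hD ?_ hG))
            exact hbefore m (by omega) _ ⟨hch.le m (by omega), le_rfl⟩ (Or.inl (by omega))
      intro k' hk' s' hs'
      rw [Function.update_of_ne (by omega)] at hs'
      rcases hk'.eq_or_lt with rfl | hlt
      · simp only [Function.update_self] at hs'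
        rcases hs'.2.eq_or_lt with rfl | hlt
        · exact hlast
        · exact le_max_of_le_left (hbefore _ le_rfl _ ⟨hs'.1, hs'.2.trans hs.2⟩ (Or.inr hlt))
      · rw [Function.update_of_ne (by omega)] at hs'
        exact le_max_of_le_left (hbefore _ hk' _ hs' (Or.inl hlt))
  choose ε hε hεn J t x hch hx0 hT hn hb using key
  have hUle : (hyperfilter ℕ : Filter ℕ) ≤ atTop := Nat.hyperfilter_le_atTop
  -- The bound on hybrid time also bounds the number of jumps, which is then constant along the
  -- ultrafilter.
  have hJ : ∀ i, J i ≤ ⌈T⌉₊ := by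
    intro i
    have h1 : (J i : ℝ) ≤ T := by linarith [hT i, (hch i).nonneg (le_refl (J i + 1))]
    exact_mod_cast h1.trans (Nat.le_ceil T)
  obtain ⟨j, hj⟩ := (hyperfilter ℕ).exists_eventually_eq_of_le hJ
  have hε0 : Tendsto ε (hyperfilter ℕ : Filter ℕ) (𝓝 0) :=
    (squeeze_zero (fun i => (hε i).le) hεn tendsto_one_div_add_atTop_nhds_zero_nat).mono_left hUle
  obtain ⟨t', x', hch', ht', hx0', hend⟩ := hlim (hyperfilter ℕ) ε j t x T _ hε hε0 (by
    filter_upwards [hj] with i hi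
    subst hi
    exact ⟨hch i, by linarith [hT i, (J i).cast_nonneg (α := ℝ)], hb i⟩)
  have hO' : x' j (t' (j + 1)) ∈ O := by
    refine h₀ j t' x' hch' (hK.isClosed.mem_of_tendsto hx0' (.of_forall hx0)) ?_
    refine le_of_tendsto (ht'.add_const (j : ℝ)) ?_
    filter_upwards [hj] with i hi
    subst hi
    exact hT i
  obtain ⟨i, hi, hi'⟩ := ((hend.eventually (hO.mem_nhds hO')).and hj).exists
  subst hi'
  exact hn i hi

/-- A sequence of counterexamples would converge to a solution of `H₀` that violates its bound.
Since β is monotone but need not be continuous, the arguments are relaxed from ω to 2ω and from s to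
s - 1. The limiting arguments are then eventually dominated, and monotonicity suffices. -/
theorem HasChainLimits.exists_forall_le (hlim : HasChainLimits H H₀)
    (hjump : ∀ ρ, ∃ ρ', ∀ ε p q, p ∈ (H ε).D → ‖p.1‖ ≤ ρ → q ∈ (H ε).G p → ‖q.1‖ ≤ ρ')
    {K O B : Set E} (hK : IsCompact K) (hO : IsOpen O) (hOb : Bornology.IsBounded O)
    (hB : IsOpen B) (hKB : K ⊆ B) (hOB : O ⊆ B) {ω : E → ℝ} (hω : ContinuousOn ω B)
    (hω0 : ∀ x ∈ B, 0 ≤ ω x) {β : ℝ → ℝ → ℝ} (hβ : IsClassKL β) {T : ℝ}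
    (h₀ : ∀ J t x, H₀.IsChain J t x → x 0 0 ∈ K → t (J + 1) + J ≤ T →
      x J (t (J + 1)) ∈ O ∧ ω (x J (t (J + 1))) ≤ β (ω (x 0 0)) (t (J + 1) + J))
    {η : ℝ} (hη : 0 < η) :
    ∃ ε₀ > 0, ∀ ε, 0 < ε → ε ≤ ε₀ → ∀ J t x, (H ε).IsChain J t x → (x 0 0).1 ∈ K →
      t (J + 1) + J ≤ T → (x J (t (J + 1))).1 ∈ O ∧
      ω (x J (t (J + 1))).1 ≤ β (2 * ω (x 0 0).1) (max (t (J + 1) + J - 1) 0) + η := by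
  obtain ⟨ε₁, hε₁, hconf⟩ := hlim.exists_forall_mem hjump hK hO hOb
    fun J t x h1 h2 h3 => (h₀ J t x h1 h2 h3).1
  by_contra! hcon
  obtain ⟨c, hc⟩ := hOb.exists_norm_le
  have key : ∀ n : ℕ, ∃ ε, 0 < ε ∧ ε ≤ 1 / ((n : ℝ) + 1) ∧ ∃ J t x, (H ε).IsChain J t x ∧
      (x 0 0).1 ∈ K ∧ t (J + 1) + J ≤ T ∧
      β (2 * ω (x 0 0).1) (max (t (J + 1) + J - 1) 0) + η < ω (x J (t (J + 1))).1 ∧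
      ∀ k ≤ J, ∀ s ∈ Icc (t k) (t (k + 1)), ‖(x k s).1‖ ≤ c := by
    intro n
    obtain ⟨ε, hε, hεn, J, t, x, hch, hx0, hT, hn⟩ :=
      hcon (min ε₁ (1 / (n + 1))) (lt_min hε₁ (by positivity))
    have hε₁' := hεn.trans (min_le_left _ _)
    refine ⟨ε, hε, hεn.trans (min_le_right _ _), J, t, x, hch, hx0, hT,
      hn (hconf ε hε hε₁' J t x hch hx0 hT), fun k hk s hs => hc _ ?_⟩
    have htr := hch.trunc hk hs
    -- Confinement is known for final states only; applied to truncations it bounds the whole chain.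
    have := hconf ε hε hε₁' k _ x htr hx0 (by
      have h1 : t (k + 1) ≤ t (J + 1) := hch.monotone (by omega) le_rfl
      have h2 : (k : ℝ) ≤ J := by exact_mod_cast hk
      simp only [Function.update_self]
      linarith [hs.2])
    simpa using this
  choose ε hε hεn J t x hch hx0 hT hn hb using key
  have hUle : (hyperfilter ℕ : Filter ℕ) ≤ atTop := Nat.hyperfilter_le_atTop
  have hJ : ∀ i, J i ≤ ⌈T⌉₊ := by
    intro i
    have h1 : (J i : ℝ) ≤ T := by linarith [hT i, (hch i).nonneg (le_refl (J i + 1))]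
    exact_mod_cast h1.trans (Nat.le_ceil T)
  obtain ⟨j, hj⟩ := (hyperfilter ℕ).exists_eventually_eq_of_le hJ
  have hε0 : Tendsto ε (hyperfilter ℕ : Filter ℕ) (𝓝 0) :=
    (squeeze_zero (fun i => (hε i).le) hεn tendsto_one_div_add_atTop_nhds_zero_nat).mono_left hUle
  obtain ⟨t', x', hch', ht', hx0', hend⟩ := hlim (hyperfilter ℕ) ε j t x T _ hε hε0 (by
    filter_upwards [hj] with i hi
    subst hi
    exact ⟨hch i, by linarith [hT i, (J i).cast_nonneg (α := ℝ)], hb i⟩)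
  have hxK : x' 0 0 ∈ K := hK.isClosed.mem_of_tendsto hx0' (.of_forall hx0)
  have hT' : t' (j + 1) + j ≤ T := by
    refine le_of_tendsto (ht'.add_const (j : ℝ)) ?_
    filter_upwards [hj] with i hi
    subst hi
    exact hT i
  obtain ⟨hendO, hendω⟩ := h₀ j t' x' hch' hxK hT'
  have hωend : Tendsto (fun i => ω (x i j (t i (j + 1))).1) (hyperfilter ℕ : Filter ℕ)
      (𝓝 (ω (x' j (t' (j + 1))))) :=
    ((hω.continuousAt (hB.mem_nhds (hOB hendO))).tendsto).comp hend
  have hωst : Tendsto (fun i => ω (x i 0 0).1) (hyperfilter ℕ : Filter ℕ) (𝓝 (ω (x' 0 0))) :=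
    ((hω.continuousAt (hB.mem_nhds (hKB hxK))).tendsto).comp hx0'
  have ht'0 : 0 ≤ t' (j + 1) + j := add_nonneg (hch'.nonneg le_rfl) j.cast_nonneg
  have hge : ∀ᶠ i in (hyperfilter ℕ : Filter ℕ), ω (x' j (t' (j + 1))) + η ≤
      ω (x i j (t i (j + 1))).1 := by
    -- Doubling gains nothing when ω vanishes at the limiting initial state. In that case β(0, ·) =
    -- 0 by monotonicity and the limit at 0⁺, and `η` alone gives the contradiction.
    rcases (hω0 _ (hKB hxK)).eq_or_lt with hz | hpos
    · have hβ0 : β 0 (t' (j + 1) + j) ≤ 0 := by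
        refine ge_of_tendsto (hβ.2.2.2.1 _ ht'0) ?_
        filter_upwards [self_mem_nhdsWithin] with r hr
        exact hβ.2.1 0 r _ le_rfl (le_of_lt hr) ht'0
      filter_upwards [hj] with i hi
      subst hi
      have h1 := hn i
      have h2 := hβ.1 (2 * ω (x i 0 0).1) (max (t i (J i + 1) + J i - 1) 0)
        (by linarith [hω0 _ (hKB (hx0 i))]) (le_max_right _ _)
      rw [← hz] at hendω
      linarith
    · filter_upwards [hj, hωst.eventually (lt_mem_nhds (half_lt_self hpos)),
        (ht'.add_const (j : ℝ)).eventually (gt_mem_nhds (lt_add_one _))] with i hi h1 h2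
      subst hi
      have h3 := hn i
      have h4 : β (ω (x' 0 0)) (t' (J i + 1) + J i) ≤ β (2 * ω (x i 0 0).1) (t' (J i + 1) + J i) :=
        hβ.2.1 _ _ _ hpos.le (by linarith) ht'0
      have h5 : β (2 * ω (x i 0 0).1) (t' (J i + 1) + J i) ≤
          β (2 * ω (x i 0 0).1) (max (t i (J i + 1) + J i - 1) 0) :=
        hβ.2.2.1 _ _ _ (by linarith) (le_max_right _ _) (max_le (by linarith) ht'0)
      linarith
  have := ge_of_tendsto hωend hge
  linarith

/-- The relaxed bound depends only on β, so it can serve as the KL function for all K and ν at once.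
-/
theorem IsClassKL.comp_two_mul_max_sub_one {β : ℝ → ℝ → ℝ} (hβ : IsClassKL β) :
    IsClassKL fun r s => β (2 * r) (max (s - 1) 0) := by
  refine ⟨fun r s hr _ => hβ.1 _ _ (by linarith) (le_max_right _ _),
    fun r r' s hr hrr _ => hβ.2.1 _ _ _ (by linarith) (by linarith) (le_max_right _ _),
    fun r s s' hr _ hss => hβ.2.2.1 _ _ _ (by linarith) (le_max_right _ _)
      (max_le_max (by linarith) le_rfl), fun s _ => ?_, fun r hr => ?_⟩
  · refine (hβ.2.2.2.1 (max (s - 1) 0) (le_max_right _ _)).comp ?_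
    refine tendsto_nhdsWithin_iff.mpr ⟨?_, ?_⟩
    · have : Tendsto (fun r : ℝ => 2 * r) (𝓝 0) (𝓝 (2 * 0)) := tendsto_id.const_mul 2
      rw [mul_zero] at this
      exact this.mono_left nhdsWithin_le_nhds
    · filter_upwards [self_mem_nhdsWithin] with r hr
      simpa using hr
  · refine (hβ.2.2.2.2 (2 * r) (by linarith)).comp ?_
    exact tendsto_atTop_mono (fun s => le_max_left _ _) (tendsto_atTop_add_const_right _ (-1) tendsto_id)

/-- Uniform asymptotic stability of `H₀` is semi-global practical asymptotic stability of `H ε`. -/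
theorem HasChainLimits.isSGPAS [ProperSpace E] (hlim : HasChainLimits H H₀)
    (hjump : ∀ ρ, ∃ ρ', ∀ ε p q, p ∈ (H ε).D → ‖p.1‖ ≤ ρ → q ∈ (H ε).G p → ‖q.1‖ ≤ ρ')
    {A B : Set E} (hUAS : H₀.IsUAS A B) : IsSGPAS H A B := by
  obtain ⟨hA, hB, hAB, hst⟩ := hUAS
  refine ⟨hA, hB, hAB, fun ω hω => ?_⟩
  obtain ⟨β, hβ, hsol⟩ := hst ω hω
  have hβ' := hβ.comp_two_mul_max_sub_one
  have hch₀ : ∀ J t x, H₀.IsChain J t x → x 0 0 ∈ B → x J (t (J + 1)) ∈ B ∧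
      ω (x J (t (J + 1))) ≤ β (ω (x 0 0)) (t (J + 1) + J) := by
    intro J t x h hx
    obtain ⟨y, hy, hdom, hval⟩ := h.exists_isSolution
    have := hsol y hy (by rwa [hval]) _ _ hdom
    rwa [hval, hval] at this
  refine ⟨_, hβ', fun K hK hKB ν hν => ?_⟩
  obtain ⟨m, hm⟩ : ∃ m, ∀ x ∈ K, ω x ≤ m := by
    obtain ⟨m, hm⟩ := (hK.image_of_continuousOn (hω.1.mono hKB)).bddAbove
    exact ⟨m, fun x hx => hm (mem_image_of_mem _ hx)⟩
  -- Starting from ω ≤ `η`, the relaxed bound plus the slack `η / 2` stays below ν. The expression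
  -- `max (0 - 1) 0` is the second argument of the relaxed bound at time 0.
  obtain ⟨η, hη0, hην, hη⟩ : ∃ η > 0, η ≤ ν ∧ β (2 * η) (max (0 - 1) 0) ≤ ν / 2 := by
    have h1 := (hβ'.2.2.2.1 0 le_rfl).eventually (gt_mem_nhds (half_pos hν))
    have h2 : ∀ᶠ r in 𝓝[>] (0 : ℝ), r ∈ Ioc 0 ν := Ioc_mem_nhdsGT hν
    obtain ⟨η, h3, h4⟩ := (h1.and h2).exists
    exact ⟨η, h4.1, h4.2, h3.le⟩
  -- After hybrid time `T` the relaxed bound from ω ≤ max m η is at most `η / 2`. The condition `T ≥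
  -- 1` gives T + 1 ≤ 2T, so a piece of length between T and T + 1 fits into the horizon 2T.
  obtain ⟨T, hT1, hT⟩ : ∃ T ≥ 1, β (2 * max m η) (max (T - 1) 0) ≤ η / 2 := by
    have h1 := (hβ'.2.2.2.2 (max m η) (le_max_of_le_right hη0.le)).eventually
      (gt_mem_nhds (half_pos hη0))
    obtain ⟨T, h2, h3⟩ := (h1.and (eventually_ge_atTop 1)).exists
    exact ⟨T, h3, h2.le⟩
  set R := max m η with hR
  have hR0 : 0 ≤ R := le_max_of_le_right hη0.le
  have hKR : IsCompact {x ∈ B | ω x ≤ R} := hω.isCompact_sublevel hB R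
  -- Solutions of `H₀` from {ω ≤ R} satisfy ω ≤ β(R, 0); the added 1 leaves them inside an open set.
  have hOR : IsOpen {x ∈ B | ω x < β R 0 + 1} :=
    hω.1.isOpen_inter_preimage hB isOpen_Iio
  have hORb : Bornology.IsBounded {x ∈ B | ω x < β R 0 + 1} :=
    (hω.isCompact_sublevel hB (β R 0 + 1)).isBounded.subset fun x hx => ⟨hx.1, le_of_lt hx.2⟩
  obtain ⟨ε₀, hε₀, hfin⟩ := hlim.exists_forall_le hjump hKR hOR hORb hB (fun x hx => hx.1)
    (fun x hx => hx.1) hω.1 hω.2.1 hβ (T := 2 * T) (fun J t x h hx _ => by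
      obtain ⟨h1, h2⟩ := hch₀ J t x h hx.1
      have h0 : 0 ≤ t (J + 1) + J := add_nonneg (h.nonneg le_rfl) J.cast_nonneg
      have h3 := hβ.2.1 _ _ (t (J + 1) + J) (hω.2.1 _ hx.1) hx.2 h0
      have h4 := hβ.2.2.1 R 0 (t (J + 1) + J) hR0 le_rfl h0
      exact ⟨⟨h1, by linarith⟩, h2⟩) (half_pos hη0)
  refine ⟨ε₀, hε₀, fun ε hε hεε => ?_⟩
  replace hfin := hfin ε hε hεε
  have hattr : ∀ J t x, (H ε).IsChain J t x → (x 0 0).1 ∈ B → ω (x 0 0).1 ≤ R →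
      t (J + 1) + J ∈ Icc T (T + 1) →
      (x J (t (J + 1))).1 ∈ B ∧ ω (x J (t (J + 1))).1 ≤ η := by
    intro J t x h hxB hxR ht
    obtain ⟨h1, h2⟩ := hfin J t x h ⟨hxB, hxR⟩ (by linarith [ht.2])
    refine ⟨h1.1, ?_⟩
    have h3 := hβ'.2.1 _ _ (t (J + 1) + J) (hω.2.1 _ hxB) hxR (by linarith [ht.1])
    have h4 := hβ'.2.2.1 R T (t (J + 1) + J) hR0 (by linarith) ht.1
    simp only at h3 h4
    linarith
  have hnear : ∀ J t x, (H ε).IsChain J t x → (x 0 0).1 ∈ B → ω (x 0 0).1 ≤ η →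
      t (J + 1) + J ≤ 2 * T → (x J (t (J + 1))).1 ∈ B ∧ ω (x J (t (J + 1))).1 ≤ ν := by
    intro J t x h hxB hxη ht
    obtain ⟨h1, h2⟩ := hfin J t x h ⟨hxB, hxη.trans (le_max_right _ _)⟩ ht
    have h0 : 0 ≤ t (J + 1) + J := add_nonneg (h.nonneg le_rfl) J.cast_nonneg
    have h3 := hβ'.2.1 _ _ (t (J + 1) + J) (hω.2.1 _ hxB) hxη h0
    have h4 := (hβ'.2.2.1 η 0 (t (J + 1) + J) hη0.le le_rfl h0).trans hη
    simp only at h3 h4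
    exact ⟨h1.1, by linarith⟩
  -- Each restart from {ω ≤ η} uses up at least hybrid time T and ends in {ω ≤ η} again. Induction
  -- on the number of such pieces covers arbitrary durations with one and the same ε.
  have hsmall : ∀ (N : ℕ) J t x, (H ε).IsChain J t x → (x 0 0).1 ∈ B → ω (x 0 0).1 ≤ η →
      t (J + 1) + J ≤ N * T → (x J (t (J + 1))).1 ∈ B ∧ ω (x J (t (J + 1))).1 ≤ ν := by
    intro N
    induction N with
    | zero =>
      intro J t x h hxB hxη ht
      exact hnear J t x h hxB hxη (by push_cast at ht; linarith)
    | succ N ih =>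
      intro J t x h hxB hxη ht
      rcases le_or_gt (t (J + 1) + J) (2 * T) with hle | hgt
      · exact hnear J t x h hxB hxη hle
      · obtain ⟨J₁, J₂, t₁, t₂, x₁, x₂, hc₁, hc₂, e1, e2, e3, e4, e5⟩ :=
          h.exists_split (c := T) (by linarith) (by linarith)
        obtain ⟨h1, h2⟩ := hattr J₁ t₁ x₁ hc₁ (by rwa [e1])
          (by rw [e1]; exact hxη.trans (le_max_right _ _)) e4
        rw [e2] at h1 h2
        rw [← e3]
        refine ih J₂ t₂ x₂ hc₂ h1 h2 ?_
        push_cast at ht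
        linarith [e4.1]
  intro y hy hyK T' J hdom
  obtain ⟨t, hch, rfl⟩ := hy.exists_isChain hdom
  have hyB := hKB hyK
  have hyR : ω (y.val 0 0).1 ≤ R := (hm _ hyK).trans (le_max_left _ _)
  have h0 : 0 ≤ t (J + 1) + J := add_nonneg (hch.nonneg le_rfl) J.cast_nonneg
  rcases le_or_gt (t (J + 1) + J) (2 * T) with hle | hgt
  · obtain ⟨h1, h2⟩ := hfin J t _ hch ⟨hyB, hyR⟩ hle
    exact ⟨h1.1, by linarith⟩
  · obtain ⟨J₁, J₂, t₁, t₂, x₁, x₂, hc₁, hc₂, e1, e2, e3, e4, e5⟩ :=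
      hch.exists_split (c := T) (by linarith) (by linarith)
    obtain ⟨h1, h2⟩ := hattr J₁ t₁ x₁ hc₁ (by rwa [e1]) (by rwa [e1]) e4
    rw [e2] at h1 h2
    obtain ⟨N, hN⟩ := exists_nat_ge (t₂ (J₂ + 1) + J₂)
    obtain ⟨h3, h4⟩ := hsmall N J₂ t₂ x₂ hc₂ h1 h2
      (hN.trans (le_mul_of_one_le_right N.cast_nonneg hT1))
    rw [e3] at h3 h4
    have h5 := hβ'.1 (ω (y.val 0 0).1) (t (J + 1) + J) (hω.2.1 _ hyB) h0
    simp only at h5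
    exact ⟨h3, by linarith⟩

end

/-! ### Averaging of doubly periodic vector fields -/

/-- A function continuous on `O × ℝ²` and periodic in both phases is bounded over compact subsets
of `O`. -/
theorem exists_norm_le_of_periodic {Θ Y : Type*} [PseudoMetricSpace Θ] [NormedAddCommGroup Y]
    {O K : Set Θ} {T₁ T₂ : ℝ} (hT₁ : 0 < T₁) (hT₂ : 0 < T₂) {F : Θ → ℝ → ℝ → Y}
    (hF : ContinuousOn (fun p : Θ × (ℝ × ℝ) => F p.1 p.2.1 p.2.2) (O ×ˢ univ))
    (hp₁ : ∀ θ ∈ O, ∀ a b, F θ (a + T₁) b = F θ a b)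
    (hp₂ : ∀ θ ∈ O, ∀ a b, F θ a (b + T₂) = F θ a b) (hK : IsCompact K) (hKO : K ⊆ O) :
    ∃ c, 0 ≤ c ∧ ∀ θ ∈ K, ∀ a b, ‖F θ a b‖ ≤ c := by
  obtain ⟨c, hc⟩ := (hK.prod ((isCompact_Icc (a := (0 : ℝ)) (b := T₁)).prod
    (isCompact_Icc (a := (0 : ℝ)) (b := T₂)))).exists_bound_of_continuousOn
    (hF.mono (prod_mono hKO (subset_univ _)))
  refine ⟨max c 0, le_max_right _ _, fun θ hθ a b => le_max_of_le_left ?_⟩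
  have h₁ : Function.Periodic (fun a => F θ a b) T₁ := fun a => hp₁ θ (hKO hθ) a b
  obtain ⟨a', ha', e₁⟩ := h₁.exists_mem_Ico₀ hT₁ a
  have h₂ : Function.Periodic (fun b => F θ a' b) T₂ := fun b => hp₂ θ (hKO hθ) a' b
  obtain ⟨b', hb', e₂⟩ := h₂.exists_mem_Ico₀ hT₂ b
  rw [e₁, e₂]
  exact hc (θ, (a', b')) ⟨hθ, Ico_subset_Icc_self ha', Ico_subset_Icc_self hb'⟩

/-- Uniform continuity counterpart of `exists_norm_le_of_periodic`. -/
theorem exists_norm_sub_lt_of_periodic {Θ Y : Type*} [PseudoMetricSpace Θ] [NormedAddCommGroup Y]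
    {O K : Set Θ} {T₁ T₂ : ℝ} (hT₁ : 0 < T₁) (hT₂ : 0 < T₂) {F : Θ → ℝ → ℝ → Y}
    (hF : ContinuousOn (fun p : Θ × (ℝ × ℝ) => F p.1 p.2.1 p.2.2) (O ×ˢ univ))
    (hp₁ : ∀ θ ∈ O, ∀ a b, F θ (a + T₁) b = F θ a b)
    (hp₂ : ∀ θ ∈ O, ∀ a b, F θ a (b + T₂) = F θ a b) (hO : IsOpen O) (hK : IsCompact K)
    (hKO : K ⊆ O) {η : ℝ} (hη : 0 < η) :
    ∃ κ > 0, ∀ θ ∈ K, ∀ θ' ∈ O, ∀ a a' b, dist θ' θ < κ → |a' - a| < κ →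
      ‖F θ' a' b - F θ a b‖ < η := by
  have hQ := hK.prod ((isCompact_Icc (a := (0 : ℝ)) (b := T₁)).prod
    (isCompact_Icc (a := (0 : ℝ)) (b := T₂)))
  -- Only one of the two compared points has to lie in the compact set. The other may leave it
  -- slightly, as `θ'` and the translate of `a'` do.
  have hunif := hQ.uniformContinuousAt_of_continuousAt
    (fun p : Θ × (ℝ × ℝ) => F p.1 p.2.1 p.2.2)
    (fun p hp => hF.continuousAt ((hO.prod isOpen_univ).mem_nhds ⟨hKO hp.1, mem_univ _⟩))
    (Metric.dist_mem_uniformity hη)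
  obtain ⟨κ, hκ, hsub⟩ := Metric.mem_uniformity_dist.mp hunif
  refine ⟨κ, hκ, fun θ hθ θ' hθ' a a' b hd ha => ?_⟩
  have per₁ : ∀ θ ∈ O, ∀ (n : ℤ) a b, F θ (a - n • T₁) b = F θ a b := fun θ hθ n a b =>
    (show Function.Periodic (fun a => F θ a b) T₁ from fun a => hp₁ θ hθ a b).sub_zsmul_eq n
  have per₂ : ∀ θ ∈ O, ∀ (n : ℤ) a b, F θ a (b - n • T₂) = F θ a b := fun θ hθ n a b =>
    (show Function.Periodic (fun b => F θ a b) T₂ from fun b => hp₂ θ hθ a b).sub_zsmul_eq n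
  obtain ⟨n, hn, -⟩ := existsUnique_sub_zsmul_mem_Ico hT₁ a 0
  obtain ⟨m, hm, -⟩ := existsUnique_sub_zsmul_mem_Ico hT₂ b 0
  -- Both slow phases are translated by the same multiple of `T₁`, which preserves their distance.
  rw [← per₁ θ' hθ' n a', ← per₂ θ' hθ' m, ← per₁ θ (hKO hθ) n a, ← per₂ θ (hKO hθ) m,
    ← dist_eq_norm, dist_comm]
  rw [zero_add] at hn hm
  refine hsub (a := (θ, (a - n • T₁, b - m • T₂))) (b := (θ', (a' - n • T₁, b - m • T₂))) ?_
    ⟨hθ, Ico_subset_Icc_self hn, Ico_subset_Icc_self hm⟩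
  rw [Prod.dist_eq, Prod.dist_eq, dist_self, dist_comm θ]
  simp only [dist_sub_right, Real.dist_eq]
  rw [abs_sub_comm]
  exact max_lt hd (max_lt ha hκ)

theorem continuous_subtype_of_continuousOn {Θ Y : Type*} [TopologicalSpace Θ] [TopologicalSpace Y]
    {O : Set Θ} {F : Θ → ℝ → ℝ → Y}
    (hF : ContinuousOn (fun p : Θ × (ℝ × ℝ) => F p.1 p.2.1 p.2.2) (O ×ˢ univ)) :
    Continuous fun q : (O × ℝ) × ℝ => F q.1.1 q.1.2 q.2 :=
  hF.comp_continuous (f := fun q : (O × ℝ) × ℝ => ((q.1.1 : Θ), (q.1.2, q.2)))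
    (by fun_prop) fun q => ⟨q.1.1.2, mem_univ _⟩

theorem continuous_phases_of_continuousOn {Θ Y : Type*} [TopologicalSpace Θ] [TopologicalSpace Y]
    {O : Set Θ} {F : Θ → ℝ → ℝ → Y}
    (hF : ContinuousOn (fun p : Θ × (ℝ × ℝ) => F p.1 p.2.1 p.2.2) (O ×ˢ univ))
    {θ : Θ} (hθ : θ ∈ O) : Continuous fun τ : ℝ × ℝ => F θ τ.1 τ.2 :=
  (continuous_subtype_of_continuousOn hF).comp
    (f := fun τ : ℝ × ℝ => (((⟨θ, hθ⟩ : O), τ.1), τ.2)) (by fun_prop)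

/-- A fast vector field `ε⁻¹ f₁ + f₂` with two phases, both periodic, over the open set `O`;
`g` is the differential of `f₁` with respect to `(x, a)`. -/
structure IsPeriodicField {V W : Type*} [NormedAddCommGroup V] [NormedSpace ℝ V]
    [NormedAddCommGroup W] (O : Set (V × W)) (T₁ T₂ : ℝ) (f₁ f₂ : V × W → ℝ → ℝ → V)
    (g : V × W → ℝ → ℝ → (V × ℝ →L[ℝ] V)) : Prop where
  isOpen : IsOpen O
  T₁_pos : 0 < T₁
  T₂_pos : 0 < T₂
  continuousOn₁ : ContinuousOn (fun p : (V × W) × (ℝ × ℝ) => f₁ p.1 p.2.1 p.2.2) (O ×ˢ univ)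
  continuousOn₂ : ContinuousOn (fun p : (V × W) × (ℝ × ℝ) => f₂ p.1 p.2.1 p.2.2) (O ×ˢ univ)
  continuousOn_deriv : ContinuousOn (fun p : (V × W) × (ℝ × ℝ) => g p.1 p.2.1 p.2.2) (O ×ˢ univ)
  hasFDerivAt : ∀ x z a b, (x, z) ∈ O →
    HasFDerivAt (fun q : V × ℝ => f₁ (q.1, z) q.2 b) (g (x, z) a b) (x, a)
  lipschitz : ∀ θ ∈ O, ∀ a b, ∃ N ∈ 𝓝 (θ, (a, b)), ∃ L : ℝ, ∀ x z z' a b,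
    ((x, z), (a, b)) ∈ N → ((x, z'), (a, b)) ∈ N →
      ‖f₁ (x, z) a b - f₁ (x, z') a b‖ ≤ L * ‖z - z'‖
  periodic₁₁ : ∀ θ ∈ O, ∀ a b, f₁ θ (a + T₁) b = f₁ θ a b
  periodic₁₂ : ∀ θ ∈ O, ∀ a b, f₁ θ a (b + T₂) = f₁ θ a b
  periodic₂₁ : ∀ θ ∈ O, ∀ a b, f₂ θ (a + T₁) b = f₂ θ a b
  periodic₂₂ : ∀ θ ∈ O, ∀ a b, f₂ θ a (b + T₂) = f₂ θ a b
  integral_eq_zero : ∀ θ ∈ O, ∀ a, ∫ s in (0 : ℝ)..T₂, f₁ θ a s = 0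

/-- The second-order average over the fast phase. -/
noncomputable def fastAverage {V W : Type*} [NormedAddCommGroup V] [NormedSpace ℝ V]
    (T₂ : ℝ) (f₁ f₂ : V × W → ℝ → ℝ → V) (g : V × W → ℝ → ℝ → (V × ℝ →L[ℝ] V))
    (θ : V × W) (a : ℝ) : V :=
  T₂⁻¹ • ∫ s in (0 : ℝ)..T₂, (g θ a s (∫ r in (0 : ℝ)..s, f₁ θ a r, s) + f₂ θ a s)

namespace IsPeriodicField

variable {V W : Type*} [NormedAddCommGroup V] [NormedSpace ℝ V] [NormedAddCommGroup W]
  {O K : Set (V × W)} {T₁ T₂ : ℝ} {f₁ f₂ : V × W → ℝ → ℝ → V}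
  {g : V × W → ℝ → ℝ → (V × ℝ →L[ℝ] V)}

/-- `f₁` coincides near the point with its translate, so both have the same differential by
uniqueness. -/
theorem periodic_deriv₁ (h : IsPeriodicField O T₁ T₂ f₁ f₂ g) :
    ∀ θ ∈ O, ∀ a b, g θ (a + T₁) b = g θ a b := by
  rintro ⟨x, z⟩ hθ a b
  have h1 := h.hasFDerivAt x z (a + T₁) b hθ
  have h2 := h.hasFDerivAt x z a b hθ
  have hsh : HasFDerivAt (fun q : V × ℝ => (q.1, q.2 + T₁)) (.id ℝ (V × ℝ)) (x, a) := by
    have : (fun q : V × ℝ => (q.1, q.2 + T₁)) = fun q => q + (0, T₁) := by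
      ext q <;> simp
    rw [this]
    exact (hasFDerivAt_id _).add_const _
  have h3 := HasFDerivAt.comp (x, a) (f := fun q : V × ℝ => (q.1, q.2 + T₁)) h1 hsh
  rw [ContinuousLinearMap.comp_id] at h3
  refine h3.unique (h2.congr_of_eventuallyEq ?_)
  have hev : ∀ᶠ q : V × ℝ in 𝓝 (x, a), (q.1, z) ∈ O :=
    ((continuous_fst.prodMk continuous_const).tendsto (x, a)).eventually (h.isOpen.mem_nhds hθ)
  filter_upwards [hev] with q hq
  exact h.periodic₁₁ _ hq _ _

theorem periodic_deriv₂ (h : IsPeriodicField O T₁ T₂ f₁ f₂ g) :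
    ∀ θ ∈ O, ∀ a b, g θ a (b + T₂) = g θ a b := by
  rintro ⟨x, z⟩ hθ a b
  refine (h.hasFDerivAt x z a (b + T₂) hθ).unique
    ((h.hasFDerivAt x z a b hθ).congr_of_eventuallyEq ?_)
  have hev : ∀ᶠ q : V × ℝ in 𝓝 (x, a), (q.1, z) ∈ O :=
    ((continuous_fst.prodMk continuous_const).tendsto (x, a)).eventually (h.isOpen.mem_nhds hθ)
  filter_upwards [hev] with q hq
  exact h.periodic₁₂ _ hq _ _

theorem continuous_primitive (h : IsPeriodicField O T₁ T₂ f₁ f₂ g) :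
    Continuous fun q : (O × ℝ) × ℝ => ∫ r in (0 : ℝ)..q.2, f₁ q.1.1 q.1.2 r :=
  intervalIntegral.continuous_parametric_primitive_of_continuous
    (f := fun (q : O × ℝ) r => f₁ q.1 q.2 r) (continuous_subtype_of_continuousOn h.continuousOn₁)

theorem continuous_integrand (h : IsPeriodicField O T₁ T₂ f₁ f₂ g) :
    Continuous fun q : (O × ℝ) × ℝ =>
      g q.1.1 q.1.2 q.2 (∫ r in (0 : ℝ)..q.2, f₁ q.1.1 q.1.2 r, q.2) + f₂ q.1.1 q.1.2 q.2 :=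
  ((continuous_subtype_of_continuousOn h.continuousOn_deriv).clm_apply
    (h.continuous_primitive.prodMk continuous_snd)).add (continuous_subtype_of_continuousOn h.continuousOn₂)

theorem continuousOn_fastAverage (h : IsPeriodicField O T₁ T₂ f₁ f₂ g) :
    ContinuousOn (fun p : (V × W) × (ℝ × ℝ) => fastAverage T₂ f₁ f₂ g p.1 p.2.1)
      (O ×ˢ univ) := by
  have hc : Continuous fun q : O × ℝ => fastAverage T₂ f₁ f₂ g q.1 q.2 :=
    (intervalIntegral.continuous_parametric_intervalIntegral_of_continuous'
      (f := fun (q : O × ℝ) s =>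
        g q.1 q.2 s (∫ r in (0 : ℝ)..s, f₁ q.1 q.2 r, s) + f₂ q.1 q.2 s)
      h.continuous_integrand 0 T₂).const_smul _
  rw [continuousOn_iff_continuous_domRestrict]
  exact hc.comp (f := fun p : (O ×ˢ (univ : Set (ℝ × ℝ)) : Set ((V × W) × (ℝ × ℝ))) =>
    ((⟨p.1.1, p.2.1⟩ : O), p.1.2.1)) (by fun_prop)

theorem fastAverage_periodic (h : IsPeriodicField O T₁ T₂ f₁ f₂ g) :
    ∀ θ ∈ O, ∀ a, fastAverage T₂ f₁ f₂ g θ (a + T₁) = fastAverage T₂ f₁ f₂ g θ a := by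
  intro θ hθ a
  simp only [fastAverage, h.periodic_deriv₁ θ hθ, h.periodic₁₁ θ hθ, h.periodic₂₁ θ hθ]

/-- Locally uniform Lipschitz bounds in `z` are uniform over a compact set and all phases. -/
theorem exists_lipschitz (h : IsPeriodicField O T₁ T₂ f₁ f₂ g) (hK : IsCompact K) (hKO : K ⊆ O) :
    ∃ L, 0 ≤ L ∧ ∃ κ > 0, ∀ θ ∈ K, ∀ x z z' a b, dist (x, z) θ < κ → dist (x, z') θ < κ →
      ‖f₁ (x, z) a b - f₁ (x, z') a b‖ ≤ L * ‖z - z'‖ := by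
  have hQ := hK.prod ((isCompact_Icc (a := (0 : ℝ)) (b := T₁)).prod
    (isCompact_Icc (a := (0 : ℝ)) (b := T₂)))
  obtain ⟨κ₀, hκ₀, hthick⟩ := hK.exists_thickening_subset_open h.isOpen hKO
  -- Periodicity reduces the phases to a compact rectangle. The property is put in the form "near
  -- every point of `s`", with one radius for all of `s`, so that it survives unions and can be
  -- proved by induction over the compact set.
  have key : ∃ L, 0 ≤ L ∧ ∃ κ > 0, ∀ p ∈ K ×ˢ (Icc 0 T₁ ×ˢ Icc 0 T₂), ∀ x z z' a b,
      dist ((x, z), (a, b)) p < κ → dist ((x, z'), (a, b)) p < κ →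
      ‖f₁ (x, z) a b - f₁ (x, z') a b‖ ≤ L * ‖z - z'‖ := by
    refine hQ.induction_on (p := fun s => ∃ L, 0 ≤ L ∧ ∃ κ > 0, ∀ p ∈ s, ∀ x z z' a b,
      dist ((x, z), (a, b)) p < κ → dist ((x, z'), (a, b)) p < κ →
      ‖f₁ (x, z) a b - f₁ (x, z') a b‖ ≤ L * ‖z - z'‖) ⟨0, le_rfl, 1, one_pos, by simp⟩ ?_ ?_ ?_
    · rintro s t hst ⟨L, hL, κ, hκ, H⟩
      exact ⟨L, hL, κ, hκ, fun p hp => H p (hst hp)⟩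
    · rintro s t ⟨L, hL, κ, hκ, H⟩ ⟨L', hL', κ', hκ', H'⟩
      refine ⟨max L L', le_max_of_le_left hL, min κ κ', lt_min hκ hκ', ?_⟩
      rintro p (hp | hp) x z z' a b h1 h2
      · exact (H p hp x z z' a b (h1.trans_le (min_le_left _ _))
          (h2.trans_le (min_le_left _ _))).trans (by gcongr; exact le_max_left _ _)
      · exact (H' p hp x z z' a b (h1.trans_le (min_le_right _ _))
          (h2.trans_le (min_le_right _ _))).trans (by gcongr; exact le_max_right _ _)
    · rintro ⟨θ, a, b⟩ hp
      obtain ⟨N, hN, L, HL⟩ := h.lipschitz θ (hKO hp.1) a b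
      obtain ⟨r, hr, hball⟩ := Metric.mem_nhds_iff.mp hN
      -- With half the radius, points close to any centre in this ball remain in the ball of radius
      -- `r`.
      refine ⟨Metric.ball (θ, (a, b)) (r / 2),
        mem_nhdsWithin_of_mem_nhds (Metric.ball_mem_nhds _ (half_pos hr)), max L 0,
        le_max_right _ _, r / 2, half_pos hr, fun q hq x z z' a' b' h1 h2 => ?_⟩
      rw [Metric.mem_ball] at hq
      refine (HL x z z' a' b' (hball ?_) (hball ?_)).trans (by gcongr; exact le_max_left _ _)
      · rw [Metric.mem_ball]
        linarith [dist_triangle ((x, z), (a', b')) q (θ, (a, b))]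
      · rw [Metric.mem_ball]
        linarith [dist_triangle ((x, z'), (a', b')) q (θ, (a, b))]
  obtain ⟨L, hL, κ, hκ, H⟩ := key
  refine ⟨L, hL, min κ κ₀, lt_min hκ hκ₀, fun θ hθ x z z' a b h1 h2 => ?_⟩
  have hO₁ : (x, z) ∈ O := hthick (Metric.mem_thickening_iff.mpr
    ⟨θ, hθ, h1.trans_le (min_le_right _ _)⟩)
  have hO₂ : (x, z') ∈ O := hthick (Metric.mem_thickening_iff.mpr
    ⟨θ, hθ, h2.trans_le (min_le_right _ _)⟩)
  have per₁ : ∀ θ ∈ O, ∀ (n : ℤ) a b, f₁ θ (a - n • T₁) b = f₁ θ a b := fun θ hθ n a b =>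
    (show Function.Periodic (fun a => f₁ θ a b) T₁ from
      fun a => h.periodic₁₁ θ hθ a b).sub_zsmul_eq n
  have per₂ : ∀ θ ∈ O, ∀ (n : ℤ) a b, f₁ θ a (b - n • T₂) = f₁ θ a b := fun θ hθ n a b =>
    (show Function.Periodic (fun b => f₁ θ a b) T₂ from
      fun b => h.periodic₁₂ θ hθ a b).sub_zsmul_eq n
  obtain ⟨n, hn, -⟩ := existsUnique_sub_zsmul_mem_Ico h.T₁_pos a 0
  obtain ⟨m, hm, -⟩ := existsUnique_sub_zsmul_mem_Ico h.T₂_pos b 0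
  rw [zero_add] at hn hm
  rw [← per₁ _ hO₁ n a, ← per₂ _ hO₁ m, ← per₁ _ hO₂ n a, ← per₂ _ hO₂ m]
  refine H (θ, (a - n • T₁, b - m • T₂))
    ⟨hθ, Ico_subset_Icc_self hn, Ico_subset_Icc_self hm⟩ x z z' _ _ ?_ ?_
  · rw [Prod.dist_eq, dist_self]
    exact max_lt (h1.trans_le (min_le_left _ _)) hκ
  · rw [Prod.dist_eq, dist_self]
    exact max_lt (h2.trans_le (min_le_left _ _)) hκ

/-- First-order expansion of `f₁` in `(x, a)`, uniform over a compact set and all phases. -/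
theorem exists_taylor (h : IsPeriodicField O T₁ T₂ f₁ f₂ g) (hK : IsCompact K) (hKO : K ⊆ O) :
    ∃ L, 0 ≤ L ∧ ∀ η > 0, ∃ κ > 0, ∀ x₀ z₀, (x₀, z₀) ∈ K → ∀ x z a₀ a b,
      ‖x - x₀‖ < κ → ‖z - z₀‖ < κ → |a - a₀| < κ →
      ‖f₁ (x, z) a b - f₁ (x₀, z₀) a₀ b - g (x₀, z₀) a₀ b (x - x₀, a - a₀)‖ ≤
        η * ‖(x - x₀, a - a₀)‖ + L * ‖z - z₀‖ := by
  obtain ⟨L, hL, κ₁, hκ₁, hlip⟩ := h.exists_lipschitz hK hKO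
  obtain ⟨κ₀, hκ₀, hthick⟩ := hK.exists_thickening_subset_open h.isOpen hKO
  refine ⟨L, hL, fun η hη => ?_⟩
  obtain ⟨κ₂, hκ₂, hg⟩ := exists_norm_sub_lt_of_periodic h.T₁_pos h.T₂_pos h.continuousOn_deriv
    h.periodic_deriv₁ h.periodic_deriv₂ h.isOpen hK hKO hη
  refine ⟨min κ₀ (min κ₁ κ₂), lt_min hκ₀ (lt_min hκ₁ hκ₂), ?_⟩
  intro x₀ z₀ hθ x z a₀ a b hx hz ha
  simp only [lt_min_iff] at hx hz ha
  have hd : ∀ y : V, dist (y, z₀) (x₀, z₀) = ‖y - x₀‖ := fun y => by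
    rw [Prod.dist_eq, dist_self, dist_eq_norm, max_eq_left (norm_nonneg _)]
  have h1 : ‖f₁ (x, z) a b - f₁ (x, z₀) a b‖ ≤ L * ‖z - z₀‖ := by
    refine hlip _ hθ x z z₀ a b ?_ ?_
    · rw [Prod.dist_eq, dist_eq_norm, dist_eq_norm]
      exact max_lt hx.2.1 hz.2.1
    · rw [hd]
      exact hx.2.1
  -- With `z₀` frozen, this is the mean value inequality for `f₁` minus its linear part: on a small
  -- ball the differential stays within `η` of its value at the centre, uniformly in `b`. No second
  -- derivative is used.
  have h2 : ‖f₁ (x, z₀) a b - f₁ (x₀, z₀) a₀ b - g (x₀, z₀) a₀ b (x - x₀, a - a₀)‖ ≤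
      η * ‖(x - x₀, a - a₀)‖ := by
    have hmem : ∀ q ∈ Metric.ball (x₀, a₀) (min κ₀ (min κ₁ κ₂)),
        (q.1, z₀) ∈ O ∧ dist (q.1, z₀) (x₀, z₀) < κ₂ ∧ |q.2 - a₀| < κ₂ := by
      intro q hq
      rw [Metric.mem_ball, Prod.dist_eq, max_lt_iff, dist_eq_norm, Real.dist_eq] at hq
      simp only [lt_min_iff] at hq
      refine ⟨hthick (Metric.mem_thickening_iff.mpr ⟨_, hθ, ?_⟩), ?_, hq.2.2.2⟩
      · rw [hd]; exact hq.1.1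
      · rw [hd]; exact hq.1.2.2
    have := Convex.norm_image_sub_le_of_norm_hasFDerivWithin_le' (𝕜 := ℝ)
      (f := fun q : V × ℝ => f₁ (q.1, z₀) q.2 b) (f' := fun q => g (q.1, z₀) q.2 b)
      (φ := g (x₀, z₀) a₀ b) (C := η) (s := Metric.ball (x₀, a₀) (min κ₀ (min κ₁ κ₂)))
      (x := (x₀, a₀)) (y := (x, a))
      (fun q hq => (h.hasFDerivAt q.1 z₀ q.2 b (hmem q hq).1).hasFDerivWithinAt)
      (fun q hq => (hg _ hθ _ (hmem q hq).1 _ _ b (hmem q hq).2.1 (hmem q hq).2.2).le)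
      (convex_ball _ _) (Metric.mem_ball_self (lt_min hκ₀ (lt_min hκ₁ hκ₂))) (by
        rw [Metric.mem_ball, Prod.dist_eq, dist_eq_norm, Real.dist_eq]
        exact max_lt (lt_min hx.1 (lt_min hx.2.1 hx.2.2)) (lt_min ha.1 (lt_min ha.2.1 ha.2.2)))
    simpa using this
  calc _ = ‖(f₁ (x, z) a b - f₁ (x, z₀) a b) +
        (f₁ (x, z₀) a b - f₁ (x₀, z₀) a₀ b - g (x₀, z₀) a₀ b (x - x₀, a - a₀))‖ := by
          congr 1; abel
    _ ≤ _ := (norm_add_le _ _).trans (by linarith)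

end IsPeriodicField

/-! ### Primitives in rescaled time and summation over windows. -/

theorem contDiff_one_primitive {V : Type*} [NormedAddCommGroup V] [NormedSpace ℝ V]
    [CompleteSpace V] {k : ℝ → V} (hk : Continuous k) :
    ContDiff ℝ 1 fun σ => ∫ s in (0 : ℝ)..σ, k s := by
  rw [contDiff_one_iff_deriv]
  have hd : ∀ σ, HasDerivAt (fun σ => ∫ s in (0 : ℝ)..σ, k s) (k σ) σ := fun σ =>
    intervalIntegral.integral_hasDerivAt_right (hk.intervalIntegrable _ _)
      (hk.stronglyMeasurableAtFilter _ _) hk.continuousAt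
  refine ⟨fun σ => (hd σ).differentiableAt, ?_⟩
  rwa [show deriv (fun σ => ∫ s in (0 : ℝ)..σ, k s) = k from funext fun σ => (hd σ).deriv]

/-- The primitive of `k`, run at speed `c` from time `s`. -/
theorem hasDerivAt_smul_primitive_comp {V : Type*} [NormedAddCommGroup V] [NormedSpace ℝ V]
    [CompleteSpace V] {k : ℝ → V} (hk : Continuous k) (e c s r : ℝ) :
    HasDerivAt (fun r => e • ∫ y in (0 : ℝ)..(r - s) / c, k y) ((e / c) • k ((r - s) / c)) r := by
  have h1 : HasDerivAt (fun r : ℝ => (r - s) / c) (1 / c) r :=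
    ((hasDerivAt_id r).sub_const s).div_const c
  have h2 : HasDerivAt (fun σ => ∫ s in (0 : ℝ)..σ, k s) (k ((r - s) / c)) ((r - s) / c) :=
    intervalIntegral.integral_hasDerivAt_right (hk.intervalIntegrable _ _)
      (hk.stronglyMeasurableAtFilter _ _) hk.continuousAt
  have h3 := (h2.scomp r h1).fun_const_smul e
  simpa [Function.comp_def, smul_smul, div_eq_mul_inv] using h3

theorem absolutelyContinuousOnInterval_smul_primitive_comp {V : Type*} [NormedAddCommGroup V]
    [NormedSpace ℝ V] [CompleteSpace V] {k : ℝ → V} (hk : Continuous k) (e c s a b : ℝ) :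
    AbsolutelyContinuousOnInterval (fun r => e • ∫ y in (0 : ℝ)..(r - s) / c, k y) a b := by
  have h1 : ContDiff ℝ 1 fun r : ℝ => (r - s) / c := by fun_prop
  exact (((contDiff_one_primitive hk).comp h1).const_smul e).contDiffOn.absolutelyContinuousOnInterval

/-- If `G` changes little over each window `[s' + k p, s' + (k + 1) p]` and oscillates little within
time `p`, then it changes little over `[s, t]`. -/
theorem norm_sub_le_of_windows {V : Type*} [NormedAddCommGroup V] {G : ℝ → V} {p c d s s' t : ℝ}
    (hp : 0 < p) (hc : 0 ≤ c) (hss' : s ≤ s') (hs'p : s' ≤ s + p) (hst : s ≤ t)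
    (hwin : ∀ k : ℕ, s' + (k + 1) * p ≤ t → ‖G (s' + (k + 1) * p) - G (s' + k * p)‖ ≤ p * c)
    (hosc : ∀ r r', s ≤ r → r ≤ r' → r' ≤ t → r' ≤ r + p → ‖G r' - G r‖ ≤ d) :
    ‖G t - G s‖ ≤ (t - s) * c + 2 * d := by
  have hd : 0 ≤ d := (norm_nonneg _).trans (hosc s s le_rfl le_rfl hst (by linarith))
  -- Either no window start fits into the interval, and one oscillation bound is enough, or whole
  -- windows fill it up to a remainder at each end. The two remainders account for `2 * d`.
  rcases lt_or_ge t s' with hlt | hge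
  · have h1 := hosc s t le_rfl hst le_rfl (by linarith)
    have h2 : 0 ≤ (t - s) * c := mul_nonneg (by linarith) hc
    linarith
  · have key : ∀ N : ℕ, s' + N * p ≤ t → ‖G (s' + N * p) - G s'‖ ≤ N * p * c := by
      intro N
      induction N with
      | zero => simp
      | succ N ih =>
        intro hN
        push_cast at hN ⊢
        have h1 := ih (by linarith)
        have h2 := hwin N hN
        have h3 := norm_add_le (G (s' + (N + 1) * p) - G (s' + N * p)) (G (s' + N * p) - G s')
        rw [sub_add_sub_cancel] at h3
        linarith
    set N := ⌊(t - s') / p⌋₊ with hN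
    have hN1 : N * p ≤ t - s' := by
      have := Nat.floor_le (div_nonneg (sub_nonneg.mpr hge) hp.le)
      rwa [← hN, le_div_iff₀ hp] at this
    have hN2 : t - s' < (N + 1) * p := by
      have := Nat.lt_floor_add_one ((t - s') / p)
      rwa [← hN, div_lt_iff₀ hp] at this
    have hNp : 0 ≤ N * p := mul_nonneg N.cast_nonneg hp.le
    have h1 := key N (by linarith)
    have h2 := hosc s s' le_rfl hss' hge hs'p
    have h3 := hosc (s' + N * p) t (by linarith) (by linarith) le_rfl (by linarith)
    have h4 := norm_add_le (G t - G (s' + N * p)) (G (s' + N * p) - G s)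
    have h5 := norm_add_le (G (s' + N * p) - G s') (G s' - G s)
    rw [sub_add_sub_cancel] at h4 h5
    have h6 : N * p * c ≤ (t - s) * c := mul_le_mul_of_nonneg_right (by linarith) hc
    linarith

/-- `x` is driven by the field `ε⁻¹ f₁ + f₂` on `[s, t]` with phases `α + r / ε` and `β + r / ε²`,
and `z` moves at speed at most `M`. -/
structure IsFastTrajectory {V W : Type*} [NormedAddCommGroup V] [NormedSpace ℝ V]
    [NormedAddCommGroup W] (K : Set (V × W)) (M : ℝ) (f₁ f₂ : V × W → ℝ → ℝ → V) (ε α β : ℝ)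
    (x : ℝ → V) (z : ℝ → W) (s t : ℝ) : Prop where
  ac : AbsolutelyContinuousOnInterval x s t
  mem : ∀ r ∈ Icc s t, (x r, z r) ∈ K
  speed : ∀ r ∈ Icc s t, ∀ r' ∈ Icc s t, r ≤ r' → ‖z r' - z r‖ ≤ M * (r' - r)
  deriv : ∀ᵐ r : ℝ, r ∈ Icc s t → HasDerivWithinAt x
    (ε⁻¹ • f₁ (x r, z r) (α + r / ε) (β + r / ε ^ 2) + f₂ (x r, z r) (α + r / ε) (β + r / ε ^ 2))
    (Icc s t) r

namespace IsFastTrajectory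

variable {V W : Type*} [NormedAddCommGroup V] [NormedSpace ℝ V] [NormedAddCommGroup W]
  {K : Set (V × W)} {M : ℝ} {f₁ f₂ : V × W → ℝ → ℝ → V} {ε α β : ℝ} {x : ℝ → V} {z : ℝ → W}
  {s t : ℝ}

theorem mono (h : IsFastTrajectory K M f₁ f₂ ε α β x z s t) {s' t' : ℝ} (hs : s ≤ s')
    (hst : s' ≤ t') (ht : t' ≤ t) : IsFastTrajectory K M f₁ f₂ ε α β x z s' t' where
  ac := h.ac.mono (by
    rw [uIcc_of_le hst, uIcc_of_le (by linarith)]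
    exact Icc_subset_Icc hs ht)
  mem r hr := h.mem r (Icc_subset_Icc hs ht hr)
  speed r hr r' hr' := h.speed r (Icc_subset_Icc hs ht hr) r' (Icc_subset_Icc hs ht hr')
  deriv := by
    filter_upwards [h.deriv] with r hr hr'
    exact (hr (Icc_subset_Icc hs ht hr')).mono (Icc_subset_Icc hs ht)

theorem norm_sub_le (h : IsFastTrajectory K M f₁ f₂ ε α β x z s t) {b₁ b₂ : ℝ} (hε : 0 < ε)
    (hε1 : ε ≤ 1) (hb₁ : ∀ θ ∈ K, ∀ a b, ‖f₁ θ a b‖ ≤ b₁) (hb₂ : ∀ θ ∈ K, ∀ a b, ‖f₂ θ a b‖ ≤ b₂)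
    (hst : s ≤ t) : ‖x t - x s‖ ≤ ε⁻¹ * (b₁ + b₂) * (t - s) := by
  refine h.ac.norm_sub_le hst ?_
  filter_upwards [h.deriv] with r hr hr'
  refine ⟨_, ?_, hr hr'⟩
  have h1 := hb₁ _ (h.mem r hr') (α + r / ε) (β + r / ε ^ 2)
  have h2 := hb₂ _ (h.mem r hr') (α + r / ε) (β + r / ε ^ 2)
  have hinv : 1 ≤ ε⁻¹ := (one_le_inv₀ hε).mpr hε1
  calc _ ≤ ε⁻¹ * ‖f₁ (x r, z r) (α + r / ε) (β + r / ε ^ 2)‖ +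
        ‖f₂ (x r, z r) (α + r / ε) (β + r / ε ^ 2)‖ := by
        refine (norm_add_le _ _).trans (le_of_eq ?_)
        rw [norm_smul, Real.norm_of_nonneg (inv_nonneg.mpr hε.le)]
    _ ≤ ε⁻¹ * b₁ + ε⁻¹ * b₂ := by
        gcongr
        exact h2.trans (le_mul_of_one_le_left ((norm_nonneg _).trans h2) hinv)
    _ = _ := by ring

end IsFastTrajectory

/-! ### One period of the fast phase. -/

namespace IsPeriodicField

variable {V W : Type*} [NormedAddCommGroup V] [NormedSpace ℝ V] [CompleteSpace V]
  [NormedAddCommGroup W] {O K : Set (V × W)} {T₁ T₂ M : ℝ} {f₁ f₂ : V × W → ℝ → ℝ → V}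
  {g : V × W → ℝ → ℝ → (V × ℝ →L[ℝ] V)}

set_option maxHeartbeats 1000000 in
/-- Over one period of the fast phase, `x` moves with the velocity `fastAverage`. -/
theorem exists_window (h : IsPeriodicField O T₁ T₂ f₁ f₂ g) (hK : IsCompact K) (hKO : K ⊆ O)
    (hM : 0 ≤ M) {η : ℝ} (hη : 0 < η) :
    ∃ ε₀ > 0, ∀ ε, 0 < ε → ε ≤ ε₀ → ∀ α β x z s,
      IsFastTrajectory K M f₁ f₂ ε α β x z s (s + ε ^ 2 * T₂) →
      (∃ n : ℤ, β + s / ε ^ 2 = n • T₂) →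
      ‖x (s + ε ^ 2 * T₂) - x s -
        (ε ^ 2 * T₂) • fastAverage T₂ f₁ f₂ g (x s, z s) (α + s / ε)‖ ≤ ε ^ 2 * T₂ * η := by
  have hT₂ := h.T₂_pos
  obtain ⟨b₁, hb₁0, hb₁⟩ := exists_norm_le_of_periodic h.T₁_pos h.T₂_pos h.continuousOn₁
    h.periodic₁₁ h.periodic₁₂ hK hKO
  obtain ⟨b₂, hb₂0, hb₂⟩ := exists_norm_le_of_periodic h.T₁_pos h.T₂_pos h.continuousOn₂
    h.periodic₂₁ h.periodic₂₂ hK hKO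
  obtain ⟨b₃, hb₃0, hb₃⟩ := exists_norm_le_of_periodic h.T₁_pos h.T₂_pos h.continuousOn_deriv
    h.periodic_deriv₁ h.periodic_deriv₂ hK hKO
  obtain ⟨L, hL, htaylor⟩ := h.exists_taylor hK hKO
  -- On one window, `D * ε` bounds the displacement of (x, slow phase), and `D₁ * T₂ * ε ^ 2` bounds
  -- what remains of the displacement of x after the first-order term. `D₂ * ε` collects the parts
  -- of the final velocity error that come from the motion of z and from this remainder.
  set D := (b₁ + b₂) * T₂ + T₂ with hD
  have hD0 : 0 < D := by positivity
  set D₁ := D + L * M * T₂ + b₃ * D + b₂ with hD₁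
  have hD₁0 : 0 ≤ D₁ := by positivity
  set D₂ := L * M * T₂ + b₃ * D₁ * T₂ with hD₂
  have hD₂0 : 0 ≤ D₂ := by positivity
  set η₁ := min 1 (η / (2 * (D + 1))) with hη₁
  have hη₁0 : 0 < η₁ := lt_min one_pos (by positivity)
  have hη₁1 : η₁ ≤ 1 := min_le_left _ _
  have hη₁η : η₁ * (D + 1) ≤ η / 2 := by
    have : η₁ ≤ η / (2 * (D + 1)) := min_le_right _ _
    rw [le_div_iff₀ (by positivity)] at this
    linarith
  obtain ⟨κ₁, hκ₁, htay⟩ := htaylor η₁ hη₁0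
  obtain ⟨κ₂, hκ₂, hf₂⟩ := exists_norm_sub_lt_of_periodic h.T₁_pos h.T₂_pos h.continuousOn₂
    h.periodic₂₁ h.periodic₂₂ h.isOpen hK hKO hη₁0
  set κ := min κ₁ κ₂ with hκ
  have hκ0 : 0 < κ := lt_min hκ₁ hκ₂
  refine ⟨min 1 (min (κ / (D + M * T₂ + 1)) (η / (2 * (D₂ + 1)))),
    lt_min one_pos (lt_min (by positivity) (by positivity)), ?_⟩
  rintro ε hε hεle α β x z s hx ⟨n, hn⟩
  have hε1 : ε ≤ 1 := hεle.trans (min_le_left _ _)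
  have hεκ : ε * (D + M * T₂ + 1) ≤ κ := by
    have := hεle.trans ((min_le_right _ _).trans (min_le_left _ _))
    rwa [le_div_iff₀ (by positivity)] at this
  have hεη : D₂ * ε ≤ η / 2 := by
    have := hεle.trans ((min_le_right _ _).trans (min_le_right _ _))
    rw [le_div_iff₀ (by positivity)] at this
    nlinarith
  have hε2 : 0 < ε ^ 2 := by positivity
  have hp : 0 < ε ^ 2 * T₂ := by positivity
  set a := α + s / ε with ha
  set t := s + ε ^ 2 * T₂ with ht
  have hst : s ≤ t := by linarith
  have hθ₀ : (x s, z s) ∈ K := hx.mem s ⟨le_rfl, hst⟩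
  have hθ₀O := hKO hθ₀
  set θ₀ := (x s, z s)
  -- The window starts at a multiple of `T₂` in the fast phase, so by periodicity the fast phase may
  -- be counted from zero.
  have hphase : ∀ r, β + r / ε ^ 2 = (r - s) / ε ^ 2 + n • T₂ := fun r => by
    rw [← hn]; field_simp; ring
  have hderiv : ∀ᵐ r : ℝ, r ∈ Icc s t → HasDerivWithinAt x
      (ε⁻¹ • f₁ (x r, z r) (a + ε * ((r - s) / ε ^ 2)) ((r - s) / ε ^ 2) +
        f₂ (x r, z r) (a + ε * ((r - s) / ε ^ 2)) ((r - s) / ε ^ 2)) (Icc s t) r := by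
    filter_upwards [hx.deriv] with r hr hrI
    have hO := hKO (hx.mem r hrI)
    have e₁ : ∀ a, f₁ (x r, z r) a (β + r / ε ^ 2) = f₁ (x r, z r) a ((r - s) / ε ^ 2) :=
      fun a => by
        rw [hphase r]
        exact (show Function.Periodic (fun b => f₁ (x r, z r) a b) T₂ from
          fun b => h.periodic₁₂ _ hO a b).zsmul n _
    have e₂ : ∀ a, f₂ (x r, z r) a (β + r / ε ^ 2) = f₂ (x r, z r) a ((r - s) / ε ^ 2) :=
      fun a => by
        rw [hphase r]
        exact (show Function.Periodic (fun b => f₂ (x r, z r) a b) T₂ from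
          fun b => h.periodic₂₂ _ hO a b).zsmul n _
    have e₃ : α + r / ε = a + ε * ((r - s) / ε ^ 2) := by
      rw [ha]; field_simp; ring
    have := hr hrI
    rwa [e₁, e₂, e₃] at this
  have hσ : ∀ r ∈ Icc s t, 0 ≤ (r - s) / ε ^ 2 ∧ (r - s) / ε ^ 2 ≤ T₂ ∧
      r - s = ε ^ 2 * ((r - s) / ε ^ 2) := by
    intro r hr
    refine ⟨div_nonneg (by linarith [hr.1]) hε2.le, ?_, by field_simp⟩
    rw [div_le_iff₀ hε2]
    linarith [hr.2]
  have hpair : ∀ r ∈ Icc s t, ‖(x r - x s, ε * ((r - s) / ε ^ 2))‖ ≤ D * ε := by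
    intro r hr
    obtain ⟨h0, h1, h2⟩ := hσ r hr
    have h3 := (hx.mono le_rfl hr.1 hr.2).norm_sub_le hε hε1 hb₁ hb₂ hr.1
    have h4 : ε⁻¹ * (b₁ + b₂) * (r - s) ≤ (b₁ + b₂) * T₂ * ε := by
      rw [h2]
      have : ε⁻¹ * (b₁ + b₂) * (ε ^ 2 * ((r - s) / ε ^ 2)) =
          (b₁ + b₂) * ((r - s) / ε ^ 2) * ε := by field_simp
      rw [this]
      gcongr
    rw [Prod.norm_mk, Real.norm_of_nonneg (by positivity)]
    refine max_le ?_ ?_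
    · have : 0 ≤ T₂ * ε := by positivity
      rw [hD]; linarith
    · have h5 : ε * ((r - s) / ε ^ 2) ≤ ε * T₂ := by gcongr
      have : 0 ≤ (b₁ + b₂) * T₂ * ε := by positivity
      rw [hD]; linarith
  have hzr : ∀ r ∈ Icc s t, ‖z r - z s‖ ≤ M * T₂ * ε ^ 2 := by
    intro r hr
    refine (hx.speed s ⟨le_rfl, hst⟩ r hr hr.1).trans ?_
    have : r - s ≤ ε ^ 2 * T₂ := by linarith [hr.2]
    calc M * (r - s) ≤ M * (ε ^ 2 * T₂) := by gcongr
      _ = _ := by ring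
  have hsmall : ∀ r ∈ Icc s t, ‖x r - x s‖ < κ ∧ ‖z r - z s‖ < κ ∧
      |a + ε * ((r - s) / ε ^ 2) - a| < κ := by
    intro r hr
    have h1 := hpair r hr
    rw [Prod.norm_mk] at h1
    have h2 : D * ε < κ := by nlinarith [mul_nonneg hM hT₂.le]
    refine ⟨((le_max_left _ _).trans h1).trans_lt h2, (hzr r hr).trans_lt ?_, ?_⟩
    · have h3 : M * T₂ * ε ^ 2 ≤ M * T₂ * ε := by
        have : ε ^ 2 ≤ ε := by nlinarith
        gcongr
      nlinarith
    · rw [add_sub_cancel_left]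
      exact ((le_max_right _ _).trans h1).trans_lt h2
  -- This is the expansion of `f₁` about the state at the start of the window. Its error is small
  -- compared with ε, so it remains small after the factor ε⁻¹ in the equation.
  have hA : ∀ r ∈ Icc s t, ‖f₁ (x r, z r) (a + ε * ((r - s) / ε ^ 2)) ((r - s) / ε ^ 2) -
      f₁ θ₀ a ((r - s) / ε ^ 2) - g θ₀ a ((r - s) / ε ^ 2) (x r - x s, ε * ((r - s) / ε ^ 2))‖ ≤
      η₁ * D * ε + L * M * T₂ * ε ^ 2 := by
    intro r hr
    obtain ⟨h1, h2, h3⟩ := hsmall r hr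
    have h4 := htay (x s) (z s) hθ₀ (x r) (z r) a (a + ε * ((r - s) / ε ^ 2)) ((r - s) / ε ^ 2)
      (h1.trans_le (min_le_left _ _)) (h2.trans_le (min_le_left _ _))
      (h3.trans_le (min_le_left _ _))
    rw [add_sub_cancel_left] at h4
    refine h4.trans ?_
    have h5 := mul_le_mul_of_nonneg_left (hpair r hr) hη₁0.le
    have h6 := mul_le_mul_of_nonneg_left (hzr r hr) hL
    linarith
  have hk₁ : Continuous fun b => f₁ θ₀ a b :=
    (continuous_phases_of_continuousOn h.continuousOn₁ hθ₀O).comp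
      (f := fun b : ℝ => (a, b)) (by fun_prop)
  have hk₂ : Continuous fun b => g θ₀ a b (∫ r in (0 : ℝ)..b, f₁ θ₀ a r, b) + f₂ θ₀ a b :=
    h.continuous_integrand.comp (f := fun b : ℝ => (((⟨θ₀, hθ₀O⟩ : O), a), b)) (by fun_prop)
  set u : ℝ → V := fun σ => ∫ y in (0 : ℝ)..σ, f₁ θ₀ a y with hu
  set k₂ : ℝ → V := fun b => g θ₀ a b (u b, b) + f₂ θ₀ a b with hk₂def
  -- First-order approximation: the derivative of x(r) - ε u((r - s)/ε²) is bounded independently of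
  -- ε, because the terms ε⁻¹ f₁ cancel up to O(1).
  have hfirst : ∀ r ∈ Icc s t, ‖x r - x s - ε • u ((r - s) / ε ^ 2)‖ ≤ D₁ * T₂ * ε ^ 2 := by
    intro r hr
    have hxr := hx.mono le_rfl hr.1 hr.2
    have hac := hxr.ac.sub (absolutelyContinuousOnInterval_smul_primitive_comp hk₁ ε (ε ^ 2) s s r)
    have hbd := hac.norm_sub_le (c := D₁) hr.1 (by
      filter_upwards [hderiv] with q hq hqI
      have hqt : q ∈ Icc s t := ⟨hqI.1, hqI.2.trans hr.2⟩
      refine ⟨_, ?_, ((hq hqt).mono (Icc_subset_Icc le_rfl hr.2)).sub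
        (hasDerivAt_smul_primitive_comp hk₁ ε (ε ^ 2) s q).hasDerivWithinAt⟩
      have h1 := hA q hqt
      have h2 := hb₂ _ (hx.mem q hqt) (a + ε * ((q - s) / ε ^ 2)) ((q - s) / ε ^ 2)
      have h3 := ((g θ₀ a ((q - s) / ε ^ 2)).le_opNorm (x q - x s, ε * ((q - s) / ε ^ 2))).trans
        (mul_le_mul (hb₃ _ hθ₀ a ((q - s) / ε ^ 2)) (hpair q hqt) (norm_nonneg _) hb₃0)
      set F := f₁ (x q, z q) (a + ε * ((q - s) / ε ^ 2)) ((q - s) / ε ^ 2)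
      set F₀ := f₁ θ₀ a ((q - s) / ε ^ 2)
      set Y := g θ₀ a ((q - s) / ε ^ 2) (x q - x s, ε * ((q - s) / ε ^ 2))
      set F₂ := f₂ (x q, z q) (a + ε * ((q - s) / ε ^ 2)) ((q - s) / ε ^ 2)
      have he : ε / ε ^ 2 = ε⁻¹ := by field_simp
      calc _ = ‖ε⁻¹ • (F - F₀ - Y) + ε⁻¹ • Y + F₂‖ := by
            rw [he]; congr 1; module
        _ ≤ ε⁻¹ * (η₁ * D * ε + L * M * T₂ * ε ^ 2) + ε⁻¹ * (b₃ * (D * ε)) + b₂ := by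
            refine (norm_add₃_le).trans ?_
            rw [norm_smul, norm_smul, Real.norm_of_nonneg (inv_nonneg.mpr hε.le)]
            gcongr
        _ = η₁ * D + L * M * T₂ * ε + b₃ * D + b₂ := by field_simp
        _ ≤ D₁ := by
            rw [hD₁]
            have h4 : η₁ * D ≤ D := mul_le_of_le_one_left hD0.le hη₁1
            have h5 : L * M * T₂ * ε ≤ L * M * T₂ := mul_le_of_le_one_right (by positivity) hε1
            linarith)
    simp only [Pi.sub_apply, sub_self, zero_div, intervalIntegral.integral_same, smul_zero,
      sub_zero] at hbd
    rw [show x r - x s - ε • u ((r - s) / ε ^ 2) = x r - ε • u ((r - s) / ε ^ 2) - x s by abel]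
    refine hbd.trans ?_
    have : r - s ≤ ε ^ 2 * T₂ := by linarith [hr.2]
    calc D₁ * (r - s) ≤ D₁ * (ε ^ 2 * T₂) := by gcongr
      _ = _ := by ring
  -- Second order: subtracting ε² ∫ k₂ as well leaves a function with derivative at most `η`. Here
  -- `k₂` contains the linear part of `f₁` evaluated on the first-order motion.
  have hac := (hx.ac.sub (absolutelyContinuousOnInterval_smul_primitive_comp hk₁ ε (ε ^ 2) s s
    t)).sub (absolutelyContinuousOnInterval_smul_primitive_comp hk₂ (ε ^ 2) (ε ^ 2) s s t)
  have hbd := hac.norm_sub_le (c := η) hst (by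
    filter_upwards [hderiv] with q hq hqt
    refine ⟨_, ?_, ((hq hqt).sub
      (hasDerivAt_smul_primitive_comp hk₁ ε (ε ^ 2) s q).hasDerivWithinAt).sub
      (hasDerivAt_smul_primitive_comp hk₂ (ε ^ 2) (ε ^ 2) s q).hasDerivWithinAt⟩
    obtain ⟨hs1, hs2, hs3⟩ := hsmall q hqt
    have h1 := hA q hqt
    have h2 := (hf₂ _ hθ₀ (x q, z q) (hKO (hx.mem q hqt)) a (a + ε * ((q - s) / ε ^ 2))
      ((q - s) / ε ^ 2) (by
        rw [Prod.dist_eq, dist_eq_norm, dist_eq_norm]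
        exact max_lt (hs1.trans_le (min_le_right _ _)) (hs2.trans_le (min_le_right _ _)))
      (hs3.trans_le (min_le_right _ _))).le
    have h3 : ‖g θ₀ a ((q - s) / ε ^ 2) (x q - x s - ε • u ((q - s) / ε ^ 2), 0)‖ ≤
        b₃ * (D₁ * T₂ * ε ^ 2) := by
      refine ((g θ₀ a ((q - s) / ε ^ 2)).le_opNorm _).trans
        (mul_le_mul (hb₃ _ hθ₀ a ((q - s) / ε ^ 2)) ?_ (norm_nonneg _) hb₃0)
      rw [Prod.norm_mk, norm_zero, max_eq_left (norm_nonneg _)]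
      exact hfirst q hqt
    -- The displacement is ε (u, σ) plus an O(ε²) error in x by `hfirst`. The first part produces
    -- `k₂`; the second costs O(ε) after the factor ε⁻¹.
    have hsplit : g θ₀ a ((q - s) / ε ^ 2) (x q - x s, ε * ((q - s) / ε ^ 2)) =
        g θ₀ a ((q - s) / ε ^ 2) (x q - x s - ε • u ((q - s) / ε ^ 2), 0) +
        ε • g θ₀ a ((q - s) / ε ^ 2) (u ((q - s) / ε ^ 2), (q - s) / ε ^ 2) := by
      rw [← map_smul, ← map_add]
      congr 1
      ext <;> simp
    rw [hsplit] at h1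
    simp only [hk₂def]
    set F := f₁ (x q, z q) (a + ε * ((q - s) / ε ^ 2)) ((q - s) / ε ^ 2)
    set F₀ := f₁ θ₀ a ((q - s) / ε ^ 2)
    set Y := g θ₀ a ((q - s) / ε ^ 2) (x q - x s - ε • u ((q - s) / ε ^ 2), 0)
    set Y' := g θ₀ a ((q - s) / ε ^ 2) (u ((q - s) / ε ^ 2), (q - s) / ε ^ 2)
    set F₂ := f₂ (x q, z q) (a + ε * ((q - s) / ε ^ 2)) ((q - s) / ε ^ 2)
    set F₂' := f₂ θ₀ a ((q - s) / ε ^ 2)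
    have he : ε / ε ^ 2 = ε⁻¹ := by field_simp
    have he' : ε ^ 2 / ε ^ 2 = 1 := div_self hε2.ne'
    have hY' : Y' = ε⁻¹ • ε • Y' := by rw [smul_smul, inv_mul_cancel₀ hε.ne', one_smul]
    calc _ = ‖ε⁻¹ • (F - F₀ - (Y + ε • Y')) + ε⁻¹ • Y + (F₂ - F₂')‖ := by
          rw [he, he', one_smul]
          congr 1
          nth_rw 1 [hY']
          module
      _ ≤ ε⁻¹ * (η₁ * D * ε + L * M * T₂ * ε ^ 2) + ε⁻¹ * (b₃ * (D₁ * T₂ * ε ^ 2)) + η₁ := by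
          refine (norm_add₃_le).trans ?_
          rw [norm_smul, norm_smul, Real.norm_of_nonneg (inv_nonneg.mpr hε.le)]
          gcongr
      _ = η₁ * (D + 1) + D₂ * ε := by rw [hD₂]; field_simp; ring
      _ ≤ η := by linarith)
  -- At the end of the window the first-order term is the integral of `f₁` over a full period, which
  -- vanishes. Only the second-order term survives.
  have hend : (t - s) / ε ^ 2 = T₂ := by rw [ht]; field_simp; ring
  have havg : ∫ y in (0 : ℝ)..T₂, k₂ y = T₂ • fastAverage T₂ f₁ f₂ g θ₀ a := by
    rw [fastAverage, smul_smul, mul_inv_cancel₀ hT₂.ne', one_smul]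
  simp only [Pi.sub_apply, sub_self, zero_div, intervalIntegral.integral_same, smul_zero,
    sub_zero, hend, h.integral_eq_zero θ₀ hθ₀O a] at hbd
  rw [mul_smul, ← havg, sub_right_comm]
  refine hbd.trans (le_of_eq ?_)
  rw [ht]; ring

end IsPeriodicField

/-- Whole periods contribute exactly their mean. The error comes only from incomplete periods, so it
does not grow with the length of the interval. -/
theorem norm_integral_sub_smul_average_le {V : Type*} [NormedAddCommGroup V] [NormedSpace ℝ V]
    {k : ℝ → V} (hk : Continuous k) {T b : ℝ} (hT : 0 < T) (hper : Function.Periodic k T)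
    (hb : ∀ a, ‖k a‖ ≤ b) {s t : ℝ} (hst : s ≤ t) :
    ‖(∫ a in s..t, k a) - (t - s) • (T⁻¹ • ∫ a in (0 : ℝ)..T, k a)‖ ≤ 4 * b * T := by
  set m := T⁻¹ • ∫ a in (0 : ℝ)..T, k a with hm
  have hbd : ∀ r r', r ≤ r' → ‖∫ a in r..r', k a‖ ≤ b * (r' - r) := fun r r' h => by
    have := intervalIntegral.norm_integral_le_of_norm_le_const (f := k) (a := r) (b := r')
      (C := b) fun a _ => hb a
    rwa [abs_of_nonneg (by linarith)] at this
  have hmb : ‖m‖ ≤ b := by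
    have h1 := hbd 0 T hT.le
    rw [hm, norm_smul, norm_inv, Real.norm_of_nonneg hT.le, inv_mul_le_iff₀ hT]
    linarith
  have hsub : ∀ r r', (∫ a in (0 : ℝ)..r', k a) - (∫ a in (0 : ℝ)..r, k a) = ∫ a in r..r', k a :=
    fun r r' => intervalIntegral.integral_interval_sub_left (hk.intervalIntegrable _ _)
      (hk.intervalIntegrable _ _)
  have hG : ∀ r r', ((∫ a in (0 : ℝ)..r', k a) - r' • m) - ((∫ a in (0 : ℝ)..r, k a) - r • m) =
      (∫ a in r..r', k a) - (r' - r) • m := fun r r' => by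
    rw [← hsub r r', sub_smul]; abel
  have := norm_sub_le_of_windows (G := fun r => (∫ a in (0 : ℝ)..r, k a) - r • m) (p := T)
    (c := 0) (d := 2 * b * T) (s := s) (s' := s) (t := t) hT le_rfl le_rfl (by linarith) hst
    (fun n _ => by
      rw [hG, show s + (n + 1) * T = s + n * T + T by ring, hper.intervalIntegral_add_eq _ 0,
        zero_add, add_sub_cancel_left, hm, smul_smul, mul_inv_cancel₀ hT.ne', one_smul]
      simp)
    (fun r r' _ hrr _ hp => by
      rw [hG]
      have h1 := hbd r r' hrr
      have hb0 : 0 ≤ b := (norm_nonneg _).trans hmb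
      have h2 : ‖(r' - r) • m‖ ≤ (r' - r) * b := by
        rw [norm_smul, Real.norm_of_nonneg (by linarith)]
        exact mul_le_mul_of_nonneg_left hmb (by linarith)
      have h3 : b * (r' - r) ≤ b * T := mul_le_mul_of_nonneg_left (by linarith) hb0
      exact (norm_sub_le _ _).trans (by linarith))
  rw [hG] at this
  linarith

/-- The second-order average over both phases. -/
noncomputable def fullAverage {V W : Type*} [NormedAddCommGroup V] [NormedSpace ℝ V]
    (T₁ T₂ : ℝ) (f₁ f₂ : V × W → ℝ → ℝ → V) (g : V × W → ℝ → ℝ → (V × ℝ →L[ℝ] V))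
    (θ : V × W) : V :=
  T₁⁻¹ • ∫ a in (0 : ℝ)..T₁, fastAverage T₂ f₁ f₂ g θ a

/-! ### Averaging over both phases on intervals of arbitrary length. -/

namespace IsPeriodicField

variable {V W : Type*} [NormedAddCommGroup V] [NormedSpace ℝ V] [CompleteSpace V]
  [NormedAddCommGroup W] {O K : Set (V × W)} {T₁ T₂ M : ℝ} {f₁ f₂ : V × W → ℝ → ℝ → V}
  {g : V × W → ℝ → ℝ → (V × ℝ →L[ℝ] V)}

/-- Every interval is covered, up to its ends, by windows to which `exists_window` applies. -/
theorem exists_windows (h : IsPeriodicField O T₁ T₂ f₁ f₂ g) (hK : IsCompact K) (hKO : K ⊆ O)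
    (hM : 0 ≤ M) {η : ℝ} (hη : 0 < η) :
    ∃ ε₀ > 0, ∀ ε, 0 < ε → ε ≤ ε₀ → ∀ α β x z s t,
      IsFastTrajectory K M f₁ f₂ ε α β x z s t →
      ∃ s', s ≤ s' ∧ s' ≤ s + ε ^ 2 * T₂ ∧ ∀ k : ℕ, s' + (k + 1) * (ε ^ 2 * T₂) ≤ t →
        ‖x (s' + (k + 1) * (ε ^ 2 * T₂)) - x (s' + k * (ε ^ 2 * T₂)) - (ε ^ 2 * T₂) •
          fastAverage T₂ f₁ f₂ g (x (s' + k * (ε ^ 2 * T₂)), z (s' + k * (ε ^ 2 * T₂)))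
            (α + (s' + k * (ε ^ 2 * T₂)) / ε)‖ ≤ ε ^ 2 * T₂ * η := by
  obtain ⟨ε₀, hε₀, hwin⟩ := h.exists_window hK hKO hM hη
  have hT₂ := h.T₂_pos
  refine ⟨ε₀, hε₀, fun ε hε hεε α β x z s t hx => ?_⟩
  have hε2 : 0 < ε ^ 2 := by positivity
  -- The aligned windows start at the first time after `s` at which the fast phase is a multiple of
  -- `T₂`.
  set n := ⌈(β + s / ε ^ 2) / T₂⌉ with hn
  have h1 : β + s / ε ^ 2 ≤ n * T₂ := by
    have := Int.le_ceil ((β + s / ε ^ 2) / T₂)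
    rwa [← hn, div_le_iff₀ hT₂] at this
  have h2 : n * T₂ < β + s / ε ^ 2 + T₂ := by
    have := Int.ceil_lt_add_one ((β + s / ε ^ 2) / T₂)
    rw [← hn, ← sub_lt_iff_lt_add, lt_div_iff₀ hT₂] at this
    linarith
  have hs : s = ε ^ 2 * (s / ε ^ 2) := by field_simp
  have hss : s ≤ ε ^ 2 * (n * T₂ - β) := by
    calc s = ε ^ 2 * (s / ε ^ 2) := hs
      _ ≤ _ := by gcongr; linarith
  refine ⟨ε ^ 2 * (n * T₂ - β), hss, ?_, fun k hk => ?_⟩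
  · calc ε ^ 2 * (n * T₂ - β) ≤ ε ^ 2 * (s / ε ^ 2 + T₂) := by gcongr; linarith
      _ = ε ^ 2 * (s / ε ^ 2) + ε ^ 2 * T₂ := by ring
      _ = _ := by rw [← hs]
  · have hp : 0 < ε ^ 2 * T₂ := by positivity
    have hkp : 0 ≤ k * (ε ^ 2 * T₂) := by positivity
    have e : ε ^ 2 * (n * T₂ - β) + (k + 1) * (ε ^ 2 * T₂) =
      ε ^ 2 * (n * T₂ - β) + k * (ε ^ 2 * T₂) + ε ^ 2 * T₂ := by ring
    rw [e] at hk ⊢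
    refine hwin ε hε hεε α β x z _ (hx.mono (by linarith) (by linarith) hk) ⟨n + k, ?_⟩
    rw [zsmul_eq_mul]
    push_cast
    field_simp
    ring

/-- Second-order averaging: as `ε → 0`, the curve `x` moves with the velocity `fullAverage`. -/
theorem exists_averaging (h : IsPeriodicField O T₁ T₂ f₁ f₂ g) (hK : IsCompact K) (hKO : K ⊆ O)
    (hM : 0 ≤ M) :
    ∃ c Q, 0 ≤ c ∧ ∀ η > 0, ∃ κ > 0, ∃ ε₀ > 0, ∀ ε, 0 < ε → ε ≤ ε₀ → ∀ α β x z s t, s ≤ t →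
      IsFastTrajectory K M f₁ f₂ ε α β x z s t →
      ‖x t - x s‖ ≤ c * (t - s) + Q * ε ∧
      ∀ θ ∈ K, (∀ r ∈ Icc s t, dist (x r, z r) θ < κ) →
        ‖x t - x s - (t - s) • fullAverage T₁ T₂ f₁ f₂ g θ‖ ≤ η * (t - s) + Q * ε := by
  have hT₂ := h.T₂_pos
  have hT₁ := h.T₁_pos
  obtain ⟨b₁, hb₁0, hb₁⟩ := exists_norm_le_of_periodic h.T₁_pos h.T₂_pos h.continuousOn₁
    h.periodic₁₁ h.periodic₁₂ hK hKO
  obtain ⟨b₂, hb₂0, hb₂⟩ := exists_norm_le_of_periodic h.T₁_pos h.T₂_pos h.continuousOn₂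
    h.periodic₂₁ h.periodic₂₂ hK hKO
  have hFc := h.continuousOn_fastAverage
  obtain ⟨b, hb0, hb⟩ := exists_norm_le_of_periodic
    (F := fun θ a (_ : ℝ) => fastAverage T₂ f₁ f₂ g θ a) h.T₁_pos h.T₂_pos hFc
    (fun θ hθ a _ => h.fastAverage_periodic θ hθ a) (fun _ _ _ _ => rfl) hK hKO
  replace hb : ∀ θ ∈ K, ∀ a, ‖fastAverage T₂ f₁ f₂ g θ a‖ ≤ b := fun θ hθ a => hb θ hθ a 0
  -- The first summand pays for incomplete fast periods at the two ends, the second for incomplete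
  -- slow periods. Neither depends on `η`.
  set Q := 2 * ((b₁ + b₂) * T₂ + b * T₂) + 4 * b * T₁ with hQ
  refine ⟨b + 1, Q, by positivity, fun η hη => ?_⟩
  obtain ⟨ε₁, hε₁, hwin₁⟩ := h.exists_windows hK hKO hM one_pos
  -- The three parts are for the error of a window, for replacing the state by `θ`, and for the
  -- drift of the slow phase within a window.
  have hη3 : 0 < η / 3 := by positivity
  obtain ⟨ε₂, hε₂, hwin₂⟩ := h.exists_windows hK hKO hM hη3
  obtain ⟨κ, hκ, hunif⟩ := exists_norm_sub_lt_of_periodic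
    (F := fun θ a (_ : ℝ) => fastAverage T₂ f₁ f₂ g θ a) h.T₁_pos h.T₂_pos hFc
    (fun θ hθ a _ => h.fastAverage_periodic θ hθ a) (fun _ _ _ _ => rfl) h.isOpen hK hKO hη3
  replace hunif : ∀ θ ∈ K, ∀ θ' ∈ O, ∀ a a', dist θ' θ < κ → |a' - a| < κ →
      ‖fastAverage T₂ f₁ f₂ g θ' a' - fastAverage T₂ f₁ f₂ g θ a‖ ≤ η / 3 :=
    fun θ hθ θ' hθ' a a' h1 h2 => (hunif θ hθ θ' hθ' a a' 0 h1 h2).le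
  refine ⟨κ, hκ, min 1 (min ε₁ (min ε₂ (κ / (T₂ + 1)))), ?_, ?_⟩
  · exact lt_min one_pos (lt_min hε₁ (lt_min hε₂ (by positivity)))
  intro ε hε hεle α β x z s t hst hx
  simp only [le_min_iff] at hεle
  obtain ⟨hε1, hεε₁, hεε₂, hεκ⟩ := hεle
  have hε2 : 0 < ε ^ 2 := by positivity
  have hp : 0 < ε ^ 2 * T₂ := by positivity
  have hεκ' : ε * T₂ < κ := by
    rw [le_div_iff₀ (by positivity)] at hεκ
    linarith
  have hoscx : ∀ r r', s ≤ r → r ≤ r' → r' ≤ t → r' ≤ r + ε ^ 2 * T₂ →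
      ‖x r' - x r‖ ≤ (b₁ + b₂) * T₂ * ε := by
    intro r r' h1 h2 h3 h4
    refine ((hx.mono h1 h2 h3).norm_sub_le hε hε1 hb₁ hb₂ h2).trans ?_
    calc ε⁻¹ * (b₁ + b₂) * (r' - r) ≤ ε⁻¹ * (b₁ + b₂) * (ε ^ 2 * T₂) := by
          gcongr; linarith
      _ = _ := by field_simp
  have hQε : 0 ≤ b * T₂ * ε ∧ 0 ≤ 4 * b * T₁ * ε ∧ 0 ≤ (b₁ + b₂) * T₂ * ε :=
    ⟨by positivity, by positivity, by positivity⟩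
  constructor
  · obtain ⟨s', hs1, hs2, hw⟩ := hwin₁ ε hε hεε₁ α β x z s t hx
    have := norm_sub_le_of_windows (G := x) (c := b + 1) hp (by positivity) hs1 hs2 hst
      (fun k hk => by
        have h1 := hw k hk
        have hkp : 0 ≤ k * (ε ^ 2 * T₂) := by positivity
        have h2 := hb _ (hx.mem (s' + k * (ε ^ 2 * T₂)) ⟨by linarith, by linarith⟩)
          (α + (s' + k * (ε ^ 2 * T₂)) / ε)
        have h3 := norm_le_norm_sub_add (x (s' + (k + 1) * (ε ^ 2 * T₂)) -
          x (s' + k * (ε ^ 2 * T₂))) ((ε ^ 2 * T₂) • fastAverage T₂ f₁ f₂ g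
            (x (s' + k * (ε ^ 2 * T₂)), z (s' + k * (ε ^ 2 * T₂)))
            (α + (s' + k * (ε ^ 2 * T₂)) / ε))
        rw [norm_smul, Real.norm_of_nonneg hp.le] at h3
        have h4 := mul_le_mul_of_nonneg_left h2 hp.le
        linarith) hoscx
    rw [hQ]
    linarith
  · intro θ hθ hclose
    obtain ⟨s', hs1, hs2, hw⟩ := hwin₂ ε hε hεε₂ α β x z s t hx
    have hk : Continuous fun a => fastAverage T₂ f₁ f₂ g θ a :=
      (continuous_phases_of_continuousOn (F := fun θ a (_ : ℝ) => fastAverage T₂ f₁ f₂ g θ a) hFc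
        (hKO hθ)).comp (f := fun a : ℝ => (a, (0 : ℝ))) (by fun_prop)
    have hI : ∀ r r', (∫ a in (0 : ℝ)..α + r' / ε, fastAverage T₂ f₁ f₂ g θ a) -
        (∫ a in (0 : ℝ)..α + r / ε, fastAverage T₂ f₁ f₂ g θ a) =
        ∫ a in α + r / ε..α + r' / ε, fastAverage T₂ f₁ f₂ g θ a :=
      fun r r' => intervalIntegral.integral_interval_sub_left (hk.intervalIntegrable _ _)
        (hk.intervalIntegrable _ _)
    -- The integral is the predicted motion with the state frozen at `θ`, while the slow phase still
    -- runs. The factor ε comes from the substitution a = α + r/ε.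
    set G : ℝ → V := fun r => x r - ε • ∫ a in (0 : ℝ)..α + r / ε, fastAverage T₂ f₁ f₂ g θ a
      with hG
    have hGsub : ∀ r r', G r' - G r = x r' - x r -
        ε • ∫ a in α + r / ε..α + r' / ε, fastAverage T₂ f₁ f₂ g θ a := fun r r' => by
      rw [← hI, smul_sub]
      simp only [hG]
      abel
    have hmain := norm_sub_le_of_windows (G := G) (c := η) (d := (b₁ + b₂) * T₂ * ε + b * T₂ * ε)
      hp hη.le hs1 hs2 hst
      (fun k hk' => by
        have hkp : 0 ≤ k * (ε ^ 2 * T₂) := by positivity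
        have h1 := hw k hk'
        set r := s' + k * (ε ^ 2 * T₂) with hr
        have hr' : s' + (k + 1) * (ε ^ 2 * T₂) = r + ε ^ 2 * T₂ := by rw [hr]; ring
        rw [hr'] at h1 hk' ⊢
        have hrI : r ∈ Icc s t := ⟨by linarith, by linarith⟩
        have h2 := hunif θ hθ (x r, z r) (hKO (hx.mem r hrI)) (α + r / ε) (α + r / ε)
          (hclose r hrI) (by simpa using hκ)
        have hph : α + (r + ε ^ 2 * T₂) / ε = α + r / ε + ε * T₂ := by field_simp; ring
        have h3 : ‖(∫ a in α + r / ε..α + r / ε + ε * T₂, fastAverage T₂ f₁ f₂ g θ a) -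
            (ε * T₂) • fastAverage T₂ f₁ f₂ g θ (α + r / ε)‖ ≤ η / 3 * (ε * T₂) := by
          have e : (ε * T₂) • fastAverage T₂ f₁ f₂ g θ (α + r / ε) =
              ∫ _a in α + r / ε..α + r / ε + ε * T₂, fastAverage T₂ f₁ f₂ g θ (α + r / ε) := by
            rw [intervalIntegral.integral_const, add_sub_cancel_left]
          rw [e, ← intervalIntegral.integral_sub (hk.intervalIntegrable _ _) (by simp)]
          have hεT : 0 ≤ ε * T₂ := by positivity
          refine (intervalIntegral.norm_integral_le_of_norm_le_const fun a ha => ?_).trans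
            (le_of_eq (by rw [add_sub_cancel_left, abs_of_nonneg hεT]))
          rw [uIoc_of_le (by linarith)] at ha
          refine hunif θ hθ θ (hKO hθ) _ _ (by simpa using hκ) ?_
          rw [abs_of_nonneg (by linarith [ha.1])]
          linarith [ha.2]
        rw [hGsub, hph]
        set X := x (r + ε ^ 2 * T₂) - x r
        set I := ∫ a in α + r / ε..α + r / ε + ε * T₂, fastAverage T₂ f₁ f₂ g θ a
        set A := fastAverage T₂ f₁ f₂ g (x r, z r) (α + r / ε)
        set A' := fastAverage T₂ f₁ f₂ g θ (α + r / ε)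
        calc ‖X - ε • I‖ = ‖(X - (ε ^ 2 * T₂) • A) + (ε ^ 2 * T₂) • (A - A') -
              ε • (I - (ε * T₂) • A')‖ := by congr 1; module
          _ ≤ ε ^ 2 * T₂ * (η / 3) + (ε ^ 2 * T₂) * (η / 3) + ε * (η / 3 * (ε * T₂)) := by
              refine (norm_sub_le _ _).trans (add_le_add ((norm_add_le _ _).trans
                (add_le_add h1 ?_)) ?_)
              · rw [norm_smul, Real.norm_of_nonneg hp.le]
                gcongr
              · rw [norm_smul, Real.norm_of_nonneg hε.le]
                gcongr
          _ = ε ^ 2 * T₂ * η := by ring)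
      (fun r r' h1 h2 h3 h4 => by
        rw [hGsub]
        have hle : r / ε ≤ r' / ε := by gcongr
        have h5 := intervalIntegral.norm_integral_le_of_norm_le_const
          (f := fastAverage T₂ f₁ f₂ g θ) (a := α + r / ε) (b := α + r' / ε) (C := b)
          fun a _ => hb θ hθ a
        rw [abs_of_nonneg (by linarith)] at h5
        have h6 : ε * (b * (α + r' / ε - (α + r / ε))) ≤ b * T₂ * ε := by
          have : ε * (b * (α + r' / ε - (α + r / ε))) = b * (r' - r) := by field_simp; ring
          rw [this]
          calc b * (r' - r) ≤ b * (ε ^ 2 * T₂) := by gcongr; linarith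
            _ ≤ b * (ε * T₂) := by gcongr; nlinarith
            _ = _ := by ring
        refine (norm_sub_le _ _).trans (add_le_add (hoscx r r' h1 h2 h3 h4) ?_)
        rw [norm_smul, Real.norm_of_nonneg hε.le]
        exact (mul_le_mul_of_nonneg_left h5 hε.le).trans h6)
    have hle : s / ε ≤ t / ε := by gcongr
    -- The slow phase covers a range of length (t - s)/ε. The error of averaging over it is bounded
    -- uniformly, and the factor ε in front makes it O(ε).
    have hav := norm_integral_sub_smul_average_le hk hT₁
      (fun a => h.fastAverage_periodic θ (hKO hθ) a) (fun a => hb θ hθ a)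
      (show α + s / ε ≤ α + t / ε by linarith)
    rw [hGsub] at hmain
    set I := ∫ a in α + s / ε..α + t / ε, fastAverage T₂ f₁ f₂ g θ a
    have he : (t - s) • fullAverage T₁ T₂ f₁ f₂ g θ =
        ε • (α + t / ε - (α + s / ε)) • fullAverage T₁ T₂ f₁ f₂ g θ := by
      rw [smul_smul]
      congr 1
      field_simp
      ring
    have hav' := mul_le_mul_of_nonneg_left hav hε.le
    calc _ = ‖(x t - x s - ε • I) + ε • (I - (α + t / ε - (α + s / ε)) •
          fullAverage T₁ T₂ f₁ f₂ g θ)‖ := by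
          rw [he, smul_sub]; congr 1; abel
      _ ≤ ((t - s) * η + 2 * ((b₁ + b₂) * T₂ * ε + b * T₂ * ε)) + ε * (4 * b * T₁) := by
          refine (norm_add_le _ _).trans (add_le_add hmain ?_)
          rw [norm_smul, Real.norm_of_nonneg hε.le]
          exact hav'
      _ ≤ _ := by
          rw [hQ]
          linarith

end IsPeriodicField

/-! ### The Lie bracket form of the average. -/

namespace IsPeriodicField

variable {V W : Type*} [NormedAddCommGroup V] [NormedSpace ℝ V]
  [NormedAddCommGroup W] {O : Set (V × W)} {T₁ T₂ : ℝ} {f₁ f₂ : V × W → ℝ → ℝ → V}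
  {g : V × W → ℝ → ℝ → (V × ℝ →L[ℝ] V)}

theorem hasFDerivAt_fst (h : IsPeriodicField O T₁ T₂ f₁ f₂ g) {x : V} {z : W} (hθ : (x, z) ∈ O)
    (a b : ℝ) : HasFDerivAt (fun y => f₁ (y, z) a b)
      ((g (x, z) a b).comp (ContinuousLinearMap.inl ℝ V ℝ)) x :=
  HasFDerivAt.comp (g := fun q : V × ℝ => f₁ (q.1, z) q.2 b) (f := fun y : V => (y, a)) x
    (h.hasFDerivAt x z a b hθ) (hasFDerivAt_prodMk_left x a)

theorem hasDerivAt_slow (h : IsPeriodicField O T₁ T₂ f₁ f₂ g) {θ : V × W} (hθ : θ ∈ O)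
    (a b : ℝ) : HasDerivAt (fun a => f₁ θ a b) (g θ a b (0, 1)) a := by
  have h1 : HasFDerivAt (fun a => f₁ θ a b)
      ((g θ a b).comp (ContinuousLinearMap.inr ℝ V ℝ)) a :=
    HasFDerivAt.comp (g := fun q : V × ℝ => f₁ (q.1, θ.2) q.2 b) (f := fun a : ℝ => (θ.1, a)) a
      (h.hasFDerivAt θ.1 θ.2 a b hθ) (hasFDerivAt_prodMk_right θ.1 a)
  simpa using h1.hasDerivAt

/-- Differentiation under the integral sign. -/
theorem hasFDerivAt_primitive [CompleteSpace V] (h : IsPeriodicField O T₁ T₂ f₁ f₂ g) {x : V} {z : W}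
    (hθ : (x, z) ∈ O) (a b : ℝ) :
    HasFDerivAt (fun y => ∫ r in (0 : ℝ)..b, f₁ (y, z) a r)
      (∫ r in (0 : ℝ)..b, (g (x, z) a r).comp (ContinuousLinearMap.inl ℝ V ℝ)) x := by
  have hK : IsCompact ({(x, z)} : Set (V × W)) := isCompact_singleton
  have hKO : ({(x, z)} : Set (V × W)) ⊆ O := singleton_subset_iff.mpr hθ
  obtain ⟨c, hc0, hc⟩ := exists_norm_le_of_periodic h.T₁_pos h.T₂_pos h.continuousOn_deriv
    h.periodic_deriv₁ h.periodic_deriv₂ hK hKO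
  obtain ⟨κ, hκ, hunif⟩ := exists_norm_sub_lt_of_periodic h.T₁_pos h.T₂_pos h.continuousOn_deriv
    h.periodic_deriv₁ h.periodic_deriv₂ h.isOpen hK hKO one_pos
  obtain ⟨κ₀, hκ₀, hball⟩ := Metric.isOpen_iff.mp h.isOpen _ hθ
  have hd : ∀ y : V, dist (y, z) (x, z) = dist y x := fun y => by
    rw [Prod.dist_eq, dist_self, max_eq_left dist_nonneg]
  have hmem : ∀ y ∈ Metric.ball x (min κ κ₀), (y, z) ∈ O ∧ dist (y, z) (x, z) < κ := by
    intro y hy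
    rw [Metric.mem_ball, lt_min_iff] at hy
    refine ⟨hball ?_, ?_⟩
    · rw [Metric.mem_ball, hd]; exact hy.2
    · rw [hd]; exact hy.1
  have hcont : ∀ y ∈ Metric.ball x (min κ κ₀), Continuous fun r => f₁ (y, z) a r := fun y hy =>
    (continuous_phases_of_continuousOn h.continuousOn₁ (hmem y hy).1).comp
      (f := fun r : ℝ => (a, r)) (by fun_prop)
  have hnhds : Metric.ball x (min κ κ₀) ∈ 𝓝 x := Metric.ball_mem_nhds _ (lt_min hκ hκ₀)
  have hcg : Continuous fun r => (g (x, z) a r).comp (ContinuousLinearMap.inl ℝ V ℝ) :=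
    ((continuous_phases_of_continuousOn h.continuousOn_deriv hθ).comp
      (f := fun r : ℝ => (a, r)) (by fun_prop)).clm_comp continuous_const
  refine intervalIntegral.hasFDerivAt_integral_of_dominated_of_fderiv_le
    (F := fun y r => f₁ (y, z) a r)
    (F' := fun y r => (g (y, z) a r).comp (ContinuousLinearMap.inl ℝ V ℝ))
    (bound := fun _ => c + 1) hnhds ?_ ?_ ?_ ?_ (by simp) ?_
  · filter_upwards [hnhds] with y hy
    exact (hcont y hy).aestronglyMeasurable
  · exact (hcont x (mem_of_mem_nhds hnhds)).intervalIntegrable _ _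
  · exact hcg.aestronglyMeasurable
  · refine .of_forall fun r _ y hy => ?_
    -- Near `x` the differential is within 1 of its value at `x`, uniformly in the phases; this
    -- yields the dominating constant `c + 1`.
    have h1 := hunif _ rfl _ (hmem y hy).1 a a r (hmem y hy).2 (by simpa using hκ)
    have h2 := norm_le_norm_sub_add (g (y, z) a r) (g (x, z) a r)
    have h3 := hc _ rfl a r
    refine ((g (y, z) a r).opNorm_comp_le _).trans ?_
    have h4 := ContinuousLinearMap.norm_inl_le_one ℝ V ℝ
    calc _ ≤ ‖g (y, z) a r‖ * 1 := by gcongr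
      _ ≤ _ := by linarith
  · exact .of_forall fun r _ y hy => h.hasFDerivAt_fst (hmem y hy).1 a r

/-- The average in Lie bracket form. -/
theorem fullAverage_eq [CompleteSpace V] (h : IsPeriodicField O T₁ T₂ f₁ f₂ g) {x : V}
    {z : W} (hθ : (x, z) ∈ O) :
    fullAverage T₁ T₂ f₁ f₂ g (x, z) = (T₁ * T₂)⁻¹ • ∫ a in (0 : ℝ)..T₁, ∫ b in (0 : ℝ)..T₂,
      (f₂ (x, z) a b + (1 / 2 : ℝ) •
        (fderiv ℝ (fun y => f₁ (y, z) a b) x (∫ r in (0 : ℝ)..b, f₁ (x, z) a r) -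
          fderiv ℝ (fun y => ∫ r in (0 : ℝ)..b, f₁ (y, z) a r) x (f₁ (x, z) a b))) := by
  set θ := (x, z)
  have hcf₁ := continuous_phases_of_continuousOn h.continuousOn₁ hθ
  have hcf₂ := continuous_phases_of_continuousOn h.continuousOn₂ hθ
  have hcg := continuous_phases_of_continuousOn h.continuousOn_deriv hθ
  have hcu : Continuous fun τ : ℝ × ℝ => ∫ r in (0 : ℝ)..τ.2, f₁ θ τ.1 r :=
    h.continuous_primitive.comp (f := fun τ : ℝ × ℝ => (((⟨θ, hθ⟩ : O), τ.1), τ.2)) (by fun_prop)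
  have hpair : ∀ a : ℝ, Continuous fun b : ℝ => (a, b) := fun a => by fun_prop
  have hcf₁' : ∀ a, Continuous fun b => f₁ θ a b := fun a => hcf₁.comp (hpair a)
  have hcf₂' : ∀ a, Continuous fun b => f₂ θ a b := fun a => hcf₂.comp (hpair a)
  have hcGu : Continuous fun τ : ℝ × ℝ =>
      g θ τ.1 τ.2 (∫ r in (0 : ℝ)..τ.2, f₁ θ τ.1 r, 0) :=
    hcg.clm_apply (hcu.prodMk continuous_const)
  have hcs : Continuous fun τ : ℝ × ℝ => τ.2 • g θ τ.1 τ.2 (0, 1) :=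
    continuous_snd.smul (hcg.clm_apply continuous_const)
  -- The drift of the slow phase drops out: after exchanging the integrals, ∂_{τ₁}f₁ is integrated
  -- over a full period of `f₁`.
  have hslow : ∫ a in (0 : ℝ)..T₁, ∫ b in (0 : ℝ)..T₂, b • g θ a b (0, 1) = 0 := by
    rw [intervalIntegral_intervalIntegral_swap]
    · have : ∀ b, ∫ a in (0 : ℝ)..T₁, b • g θ a b (0, 1) = 0 := by
        intro b
        rw [intervalIntegral.integral_smul, intervalIntegral.integral_eq_sub_of_hasDerivAt
          (f := fun a => f₁ θ a b) (fun a _ => h.hasDerivAt_slow hθ a b)]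
        · rw [← h.periodic₁₁ θ hθ 0 b, zero_add, sub_self, smul_zero]
        · have hc' : Continuous fun a => g θ a b (0, 1) :=
            (hcg.comp (f := fun a : ℝ => (a, b)) (by fun_prop)).clm_apply continuous_const
          exact hc'.intervalIntegrable _ _
      simp [this]
    · exact (hcs.continuousOn.integrableOn_compact
        (isCompact_uIcc.prod isCompact_uIcc)).mono_set
          (prod_mono uIoc_subset_uIcc uIoc_subset_uIcc)
  have hinner : ∀ a, ∫ b in (0 : ℝ)..T₂, (f₂ θ a b + (1 / 2 : ℝ) •
        (fderiv ℝ (fun y => f₁ (y, z) a b) x (∫ r in (0 : ℝ)..b, f₁ θ a r) -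
          fderiv ℝ (fun y => ∫ r in (0 : ℝ)..b, f₁ (y, z) a r) x (f₁ θ a b))) =
      ∫ b in (0 : ℝ)..T₂, (f₂ θ a b + g θ a b (∫ r in (0 : ℝ)..b, f₁ θ a r, 0)) := by
    intro a
    set G : ℝ → V →L[ℝ] V := fun b => (g θ a b).comp (ContinuousLinearMap.inl ℝ V ℝ) with hG
    have hGc : Continuous G := (hcg.comp (hpair a)).clm_comp continuous_const
    set u : ℝ → V := fun b => ∫ r in (0 : ℝ)..b, f₁ θ a r with hu
    set Q : ℝ → V →L[ℝ] V := fun b => ∫ r in (0 : ℝ)..b, G r with hQ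
    have hud : ∀ b, HasDerivAt u (f₁ θ a b) b := fun b =>
      intervalIntegral.integral_hasDerivAt_right ((hcf₁' a).intervalIntegrable _ _)
        ((hcf₁' a).stronglyMeasurableAtFilter _ _) (hcf₁' a).continuousAt
    have hQd : ∀ b, HasDerivAt Q (G b) b := fun b =>
      intervalIntegral.integral_hasDerivAt_right (hGc.intervalIntegrable _ _)
        (hGc.stronglyMeasurableAtFilter _ _) hGc.continuousAt
    have huc : Continuous u := hcu.comp (hpair a)
    have hQc : Continuous Q := continuous_iff_continuousAt.mpr fun b => (hQd b).continuousAt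
    have hd : ∀ b, HasDerivAt (fun b => Q b (u b)) (G b (u b) + Q b (f₁ θ a b)) b := fun b =>
      (hQd b).clm_apply (hud b)
    have hc1 : Continuous fun b => G b (u b) := hGc.clm_apply huc
    have hc2 : Continuous fun b => Q b (f₁ θ a b) := hQc.clm_apply (hcf₁' a)
    -- Here `Q` is the x-differential of `u`. Since `u` vanishes at both ends of the period, the
    -- integral of (Q u)' = G u + Q f₁ is zero, so G u and ½(G u - Q f₁) have the same integral.
    have hparts := intervalIntegral.integral_eq_sub_of_hasDerivAt (a := 0) (b := T₂)
      (fun b _ => hd b) ((hc1.add hc2).intervalIntegrable _ _)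
    have huT : u T₂ = 0 := h.integral_eq_zero θ hθ a
    have hu0 : u 0 = 0 := intervalIntegral.integral_same
    rw [huT, hu0, map_zero, map_zero, sub_zero, intervalIntegral.integral_add
      (hc1.intervalIntegrable _ _) (hc2.intervalIntegrable _ _)] at hparts
    have e₁ : ∀ b, fderiv ℝ (fun y => f₁ (y, z) a b) x = G b := fun b =>
      (h.hasFDerivAt_fst hθ a b).fderiv
    have e₂ : ∀ b, fderiv ℝ (fun y => ∫ r in (0 : ℝ)..b, f₁ (y, z) a r) x = Q b := fun b =>
      (h.hasFDerivAt_primitive hθ a b).fderiv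
    have hc3 : Continuous fun b => (1 / 2 : ℝ) • (G b (u b) - Q b (f₁ θ a b)) :=
      (hc1.sub hc2).const_smul _
    simp only [e₁, e₂]
    change ∫ b in (0 : ℝ)..T₂, (f₂ θ a b + (1 / 2 : ℝ) • (G b (u b) - Q b (f₁ θ a b))) =
      ∫ b in (0 : ℝ)..T₂, (f₂ θ a b + G b (u b))
    rw [intervalIntegral.integral_add ((hcf₂' a).intervalIntegrable _ _)
      (hc3.intervalIntegrable _ _), intervalIntegral.integral_add
      ((hcf₂' a).intervalIntegrable _ _) (hc1.intervalIntegrable _ _),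
      intervalIntegral.integral_smul, intervalIntegral.integral_sub
      (hc1.intervalIntegrable _ _) (hc2.intervalIntegrable _ _), eq_neg_of_add_eq_zero_right hparts]
    module
  have hfast : ∀ a, fastAverage T₂ f₁ f₂ g θ a = T₂⁻¹ •
      ((∫ b in (0 : ℝ)..T₂, (f₂ θ a b + g θ a b (∫ r in (0 : ℝ)..b, f₁ θ a r, 0))) +
        ∫ b in (0 : ℝ)..T₂, b • g θ a b (0, 1)) := by
    intro a
    have hc1 : Continuous fun b => f₂ θ a b + g θ a b (∫ r in (0 : ℝ)..b, f₁ θ a r, 0) :=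
      (hcf₂.add hcGu).comp (hpair a)
    have hc2 : Continuous fun b => b • g θ a b (0, 1) := hcs.comp (hpair a)
    rw [fastAverage, ← intervalIntegral.integral_add (hc1.intervalIntegrable _ _)
      (hc2.intervalIntegrable _ _)]
    congr 1
    refine intervalIntegral.integral_congr fun b _ => ?_
    have : g θ a b (∫ r in (0 : ℝ)..b, f₁ θ a r, b) =
        g θ a b (∫ r in (0 : ℝ)..b, f₁ θ a r, 0) + b • g θ a b (0, 1) := by
      rw [← map_smul, ← map_add]
      congr 1
      ext <;> simp
    simp only [this]
    abel
  simp only [hinner]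
  rw [fullAverage, mul_inv, mul_smul]
  congr 1
  simp only [hfast]
  rw [intervalIntegral.integral_smul, intervalIntegral.integral_add, hslow, add_zero]
  · exact (intervalIntegral.continuous_parametric_intervalIntegral_of_continuous'
      (f := fun a b => f₂ θ a b + g θ a b (∫ r in (0 : ℝ)..b, f₁ θ a r, 0))
      (hcf₂.add hcGu) _ _).intervalIntegrable _ _
  · exact (intervalIntegral.continuous_parametric_intervalIntegral_of_continuous'
      (f := fun a b => b • g θ a b (0, 1)) hcs _ _).intervalIntegrable _ _

end IsPeriodicField

/-! ### Periodic extension of the phases to the whole line -/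

/-- The representative of `a` modulo `T` in `[0, T)`. -/
noncomputable def wrap (T a : ℝ) : ℝ := T * Int.fract (a / T)

theorem wrap_nonneg {T : ℝ} (hT : 0 < T) (a : ℝ) : 0 ≤ wrap T a :=
  mul_nonneg hT.le (Int.fract_nonneg _)

theorem wrap_add {T : ℝ} (hT : 0 < T) (a : ℝ) : wrap T (a + T) = wrap T a := by
  rw [wrap, wrap, add_div, div_self hT.ne', Int.fract_add_one]

/-- Periodicity is only available on nonnegative arguments, so representatives are compared through
a nonnegative translate. `wrap T a` differs from it by a nonnegative multiple of `T`. -/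
theorem apply_wrap_eq {Y : Type*} {F : ℝ → Y} {T : ℝ} (hT : 0 < T)
    (h : ∀ a, 0 ≤ a → F (a + T) = F a) (m : ℕ) {a : ℝ} (ha : 0 ≤ a + m * T) :
    F (wrap T a) = F (a + m * T) := by
  have hk : (0 : ℤ) ≤ ⌊a / T⌋ + m := by
    rw [← Int.floor_add_natCast]
    refine Int.floor_nonneg.mpr ?_
    have : a / T + m = (a + m * T) / T := by field_simp
    rw [this]
    positivity
  obtain ⟨k, hk⟩ := Int.eq_ofNat_of_zero_le hk
  have e : a + m * T = wrap T a + k * T := by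
    have h1 : ((⌊a / T⌋ : ℤ) : ℝ) + m = k := by exact_mod_cast hk
    have h2 : a = T * (a / T) := by field_simp
    rw [wrap, Int.fract, ← h1]
    linear_combination h2
  rw [e]
  have hw := wrap_nonneg hT a
  clear e hk
  induction k with
  | zero => simp
  | succ k ih =>
    rw [ih, Nat.cast_succ, add_mul, one_mul, ← add_assoc, h _ (by positivity)]

theorem exists_nat_add_mul_pos {T : ℝ} (hT : 0 < T) (a : ℝ) : ∃ m : ℕ, 0 < a + m * T := by
  obtain ⟨m, hm⟩ := exists_nat_gt (-a / T)
  rw [div_lt_iff₀ hT] at hm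
  exact ⟨m, by linarith⟩

theorem tendsto_shift_phases {Θ : Type*} [TopologicalSpace Θ] (p : Θ × (ℝ × ℝ)) (s t : ℝ) :
    Tendsto (fun p : Θ × (ℝ × ℝ) => (p.1, (p.2.1 + s, p.2.2 + t))) (𝓝 p)
      (𝓝 (p.1, (p.2.1 + s, p.2.2 + t))) :=
  Continuous.tendsto (by fun_prop) p

theorem eventually_shift_pos {Θ : Type*} [TopologicalSpace Θ] {p : Θ × (ℝ × ℝ)} {s t : ℝ}
    (hs : 0 < p.2.1 + s) (ht : 0 < p.2.2 + t) :
    ∀ᶠ q in 𝓝 p, 0 < q.2.1 + s ∧ 0 < q.2.2 + t := by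
  have h1 : ContinuousAt (fun q : Θ × (ℝ × ℝ) => q.2.1 + s) p := by fun_prop
  have h2 : ContinuousAt (fun q : Θ × (ℝ × ℝ) => q.2.2 + t) p := by fun_prop
  exact (h1.eventually (lt_mem_nhds hs)).and (h2.eventually (lt_mem_nhds ht))

/-- Near any given point the extension equals φ at phases translated to be strictly positive. The
boundary of the quadrant of phases plays no role there. -/
theorem continuousOn_of_shift {Θ Y : Type*} [TopologicalSpace Θ] [TopologicalSpace Y]
    {O : Set Θ} {T₁ T₂ : ℝ} (hT₁ : 0 < T₁) (hT₂ : 0 < T₂) {F φ : Θ → ℝ → ℝ → Y}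
    (hφ : ContinuousOn (fun p : Θ × (ℝ × ℝ) => φ p.1 p.2.1 p.2.2) (withPhases O))
    (h : ∀ θ ∈ O, ∀ (m n : ℕ) (a b : ℝ), 0 < a + m * T₁ → 0 < b + n * T₂ →
      F θ a b = φ θ (a + m * T₁) (b + n * T₂)) :
    ContinuousOn (fun p : Θ × (ℝ × ℝ) => F p.1 p.2.1 p.2.2) (O ×ˢ univ) := by
  intro p hp
  obtain ⟨m, hm⟩ := exists_nat_add_mul_pos hT₁ p.2.1
  obtain ⟨n, hn⟩ := exists_nat_add_mul_pos hT₂ p.2.2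
  have hev := eventually_shift_pos hm hn
  have hlim : Tendsto (fun p : Θ × (ℝ × ℝ) => (p.1, (p.2.1 + m * T₁, p.2.2 + n * T₂)))
      (𝓝[O ×ˢ univ] p) (𝓝[withPhases O] (p.1, (p.2.1 + m * T₁, p.2.2 + n * T₂))) := by
    refine tendsto_nhdsWithin_iff.mpr
      ⟨(tendsto_shift_phases p _ _).mono_left nhdsWithin_le_nhds, ?_⟩
    filter_upwards [self_mem_nhdsWithin, nhdsWithin_le_nhds hev] with q hq hq'
    exact ⟨hq.1, hq'.1.le, hq'.2.le⟩
  have h1 := (hφ (p.1, (p.2.1 + m * T₁, p.2.2 + n * T₂)) ⟨hp.1, hm.le, hn.le⟩).tendsto.comp hlim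
  have e := h p.1 hp.1 m n _ _ hm hn
  rw [ContinuousWithinAt, e]
  refine h1.congr' ?_
  filter_upwards [self_mem_nhdsWithin, nhdsWithin_le_nhds hev] with q hq hq'
  exact (h q.1 hq.1 m n _ _ hq'.1 hq'.2).symm

/-- The extension of a function of nonnegative phases to a periodic one of real phases. -/
noncomputable def extendPhases {V W Y : Type*} (T₁ T₂ : ℝ) (φ : V → W → ℝ → ℝ → Y) (θ : V × W)
    (a b : ℝ) : Y :=
  φ θ.1 θ.2 (wrap T₁ a) (wrap T₂ b)

theorem extendPhases_eq {V W Y : Type*} {T₁ T₂ : ℝ} (hT₁ : 0 < T₁) (hT₂ : 0 < T₂)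
    {φ : V → W → ℝ → ℝ → Y} {Q : Set (V × W)}
    (hp₁ : ∀ x z τ₁ τ₂, (x, z) ∈ Q → 0 ≤ τ₁ → 0 ≤ τ₂ → φ x z (τ₁ + T₁) τ₂ = φ x z τ₁ τ₂)
    (hp₂ : ∀ x z τ₁ τ₂, (x, z) ∈ Q → 0 ≤ τ₁ → 0 ≤ τ₂ → φ x z τ₁ (τ₂ + T₂) = φ x z τ₁ τ₂)
    {θ : V × W} (hθ : θ ∈ Q) (m n : ℕ) {a b : ℝ} (ha : 0 ≤ a + m * T₁) (hb : 0 ≤ b + n * T₂) :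
    extendPhases T₁ T₂ φ θ a b = φ θ.1 θ.2 (a + m * T₁) (b + n * T₂) := by
  rw [extendPhases, apply_wrap_eq (F := fun a => φ θ.1 θ.2 a (wrap T₂ b)) hT₁
    (fun a ha => hp₁ _ _ _ _ hθ ha (wrap_nonneg hT₂ b)) m ha]
  exact apply_wrap_eq (F := fun b => φ θ.1 θ.2 (a + m * T₁) b) hT₂
    (fun b hb => hp₂ _ _ _ _ hθ ha hb) n hb

theorem subset_interior_euclideanInflation {n₁ n₂ : ℕ} (C : Set (OscState n₁ n₂)) {δ : ℝ}
    (hδ : 0 < δ) : C ⊆ interior (euclideanInflation C δ) := by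
  intro θ hθ
  rw [mem_interior_iff_mem_nhds]
  refine Filter.mem_of_superset (Metric.ball_mem_nhds θ (half_pos hδ)) fun q hq => ⟨θ, hθ, ?_⟩
  rw [Metric.mem_ball', Prod.dist_eq, max_lt_iff, dist_eq_norm, dist_eq_norm] at hq
  have h1 := pow_le_pow_left₀ (norm_nonneg _) hq.1.le 2
  have h2 := pow_le_pow_left₀ (norm_nonneg _) hq.2.le 2
  nlinarith [sq_nonneg δ]

/-! ### The oscillatory data as a periodic field over all real phases. -/

namespace OscillatoryData

variable {n₁ n₂ : ℕ} {S : OscillatoryData n₁ n₂} {δ T₁ T₂ : ℝ}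

/-- The differential of the extended `φ₁` with respect to `(x, τ₁)`. -/
noncomputable def extendedDeriv (S : OscillatoryData n₁ n₂) (T₁ T₂ : ℝ) (θ : OscState n₁ n₂)
    (a b : ℝ) : EuclideanSpace ℝ (Fin n₁) × ℝ →L[ℝ] EuclideanSpace ℝ (Fin n₁) :=
  fderiv ℝ (fun q : EuclideanSpace ℝ (Fin n₁) × ℝ => extendPhases T₁ T₂ S.φ₁ (q.1, θ.2) q.2 b)
    (θ.1, a)

namespace OscillationAssumption

theorem extend_φ₁_eq (h : S.OscillationAssumption δ T₁ T₂) {θ : OscState n₁ n₂}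
    (hθ : θ ∈ euclideanInflation S.C δ) (m n : ℕ) {a b : ℝ} (ha : 0 ≤ a + m * T₁)
    (hb : 0 ≤ b + n * T₂) :
    extendPhases T₁ T₂ S.φ₁ θ a b = S.φ₁ θ.1 θ.2 (a + m * T₁) (b + n * T₂) :=
  extendPhases_eq h.T₁_pos h.T₂_pos h.periodic₁_φ₁ h.periodic₂_φ₁ hθ m n ha hb

theorem extend_φ₂_eq (h : S.OscillationAssumption δ T₁ T₂) {θ : OscState n₁ n₂}
    (hθ : θ ∈ euclideanInflation S.C δ) (m n : ℕ) {a b : ℝ} (ha : 0 ≤ a + m * T₁)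
    (hb : 0 ≤ b + n * T₂) :
    extendPhases T₁ T₂ S.φ₂ θ a b = S.φ₂ θ.1 θ.2 (a + m * T₁) (b + n * T₂) :=
  extendPhases_eq h.T₁_pos h.T₂_pos h.periodic₁_φ₂ h.periodic₂_φ₂ hθ m n ha hb

/-- At strictly positive translated phases, and in the interior of the inflated set, the derivative
within the domain is a full derivative. -/
theorem hasFDerivAt_extend (h : S.OscillationAssumption δ T₁ T₂)
    {g' : EuclideanSpace ℝ (Fin n₁) → EuclideanSpace ℝ (Fin n₂) → ℝ → ℝ →
      (EuclideanSpace ℝ (Fin n₁) × ℝ →L[ℝ] EuclideanSpace ℝ (Fin n₁))}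
    (hg' : ∀ x z τ₁ τ₂, ((x, z), (τ₁, τ₂)) ∈ withPhases (euclideanInflation S.C δ) →
      HasFDerivWithinAt (fun q : EuclideanSpace ℝ (Fin n₁) × ℝ => S.φ₁ q.1 z q.2 τ₂)
        (g' x z τ₁ τ₂) {q | ((q.1, z), (q.2, τ₂)) ∈ withPhases (euclideanInflation S.C δ)}
        (x, τ₁)) {x : EuclideanSpace ℝ (Fin n₁)} {z : EuclideanSpace ℝ (Fin n₂)}
    (hθ : (x, z) ∈ interior (euclideanInflation S.C δ)) (m n : ℕ) {a b : ℝ}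
    (ha : 0 < a + m * T₁) (hb : 0 < b + n * T₂) :
    HasFDerivAt (fun q : EuclideanSpace ℝ (Fin n₁) × ℝ => extendPhases T₁ T₂ S.φ₁ (q.1, z) q.2 b)
      (g' x z (a + m * T₁) (b + n * T₂)) (x, a) := by
  have hO : ∀ c : ℝ, ∀ᶠ q : EuclideanSpace ℝ (Fin n₁) × ℝ in 𝓝 (x, c),
      (q.1, z) ∈ euclideanInflation S.C δ := fun c =>
    ((continuous_fst.prodMk continuous_const).tendsto (x, c)).eventually
      (mem_interior_iff_mem_nhds.mp hθ)
  have h1 : HasFDerivAt (fun q : EuclideanSpace ℝ (Fin n₁) × ℝ => S.φ₁ q.1 z q.2 (b + n * T₂))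
      (g' x z (a + m * T₁) (b + n * T₂)) (x, a + m * T₁) := by
    refine (hg' x z _ _ ⟨interior_subset hθ, ha.le, hb.le⟩).hasFDerivAt ?_
    filter_upwards [hO (a + m * T₁), continuousAt_snd.eventually (lt_mem_nhds ha)] with q hq hq'
    exact ⟨hq, le_of_lt hq', hb.le⟩
  have hsh : HasFDerivAt (fun q : EuclideanSpace ℝ (Fin n₁) × ℝ => (q.1, q.2 + m * T₁))
      (.id ℝ (EuclideanSpace ℝ (Fin n₁) × ℝ)) (x, a) := by
    have : (fun q : EuclideanSpace ℝ (Fin n₁) × ℝ => (q.1, q.2 + m * T₁)) =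
        fun q => q + (0, m * T₁) := by
      ext q <;> simp
    rw [this]
    exact (hasFDerivAt_id _).add_const _
  have h2 := HasFDerivAt.comp (x, a)
    (f := fun q : EuclideanSpace ℝ (Fin n₁) × ℝ => (q.1, q.2 + m * T₁)) h1 hsh
  rw [ContinuousLinearMap.comp_id] at h2
  refine h2.congr_of_eventuallyEq ?_
  have hpos : ∀ᶠ q : EuclideanSpace ℝ (Fin n₁) × ℝ in 𝓝 (x, a), 0 < q.2 + m * T₁ :=
    (show ContinuousAt (fun q : EuclideanSpace ℝ (Fin n₁) × ℝ => q.2 + m * T₁) (x, a) by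
      fun_prop).eventually (lt_mem_nhds ha)
  filter_upwards [hO a, hpos] with q hq hq'
  exact h.extend_φ₁_eq hq m n hq'.le hb.le

theorem isPeriodicField (h : S.OscillationAssumption δ T₁ T₂) :
    IsPeriodicField (interior (euclideanInflation S.C δ)) T₁ T₂ (extendPhases T₁ T₂ S.φ₁)
      (extendPhases T₁ T₂ S.φ₂) (S.extendedDeriv T₁ T₂) := by
  have hT₁ := h.T₁_pos
  have hT₂ := h.T₂_pos
  obtain ⟨g', hg', hg'c, -⟩ := h.c1_φ₁
  have hsub : withPhases (interior (euclideanInflation S.C δ)) ⊆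
      withPhases (euclideanInflation S.C δ) := prod_mono interior_subset Subset.rfl
  refine ⟨isOpen_interior, hT₁, hT₂, ?_, ?_, ?_, ?_, ?_, ?_, ?_, ?_, ?_, ?_⟩
  · exact continuousOn_of_shift hT₁ hT₂ (φ := fun θ a b => S.φ₁ θ.1 θ.2 a b)
      (h.continuous_φ₁.mono hsub)
      fun θ hθ m n a b ha hb => h.extend_φ₁_eq (interior_subset hθ) m n ha.le hb.le
  · exact continuousOn_of_shift hT₁ hT₂ (φ := fun θ a b => S.φ₂ θ.1 θ.2 a b)
      (h.continuous_φ₂.mono hsub)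
      fun θ hθ m n a b ha hb => h.extend_φ₂_eq (interior_subset hθ) m n ha.le hb.le
  · exact continuousOn_of_shift hT₁ hT₂ (φ := fun θ a b => g' θ.1 θ.2 a b) (hg'c.mono hsub)
      fun θ hθ m n a b ha hb => (h.hasFDerivAt_extend hg' hθ m n ha hb).fderiv
  · intro x z a b hθ
    obtain ⟨m, hm⟩ := exists_nat_add_mul_pos hT₁ a
    obtain ⟨n, hn⟩ := exists_nat_add_mul_pos hT₂ b
    exact (h.hasFDerivAt_extend hg' hθ m n hm hn).differentiableAt.hasFDerivAt
  · intro θ hθ a b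
    obtain ⟨m, hm⟩ := exists_nat_add_mul_pos hT₁ a
    obtain ⟨n, hn⟩ := exists_nat_add_mul_pos hT₂ b
    obtain ⟨N, hN, L, hL⟩ := h.c0_z_φ₁ (θ, (a + m * T₁, b + n * T₂))
      ⟨interior_subset hθ, hm.le, hn.le⟩
    have hθ' : ∀ᶠ p : OscState n₁ n₂ × (ℝ × ℝ) in 𝓝 (θ, (a, b)),
        p.1 ∈ euclideanInflation S.C δ :=
      continuousAt_fst.eventually (mem_interior_iff_mem_nhds.mp hθ)
    refine ⟨_, ((tendsto_shift_phases (θ, (a, b)) (m * T₁) (n * T₂)).eventually hN).and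
      (hθ'.and (eventually_shift_pos (p := (θ, (a, b))) hm hn)), L, ?_⟩
    rintro x z z' a b ⟨h1, h2, h3, h4⟩ ⟨h1', h2', -, -⟩
    rw [h.extend_φ₁_eq h2 m n h3.le h4.le, h.extend_φ₁_eq h2' m n h3.le h4.le]
    exact hL x z z' _ _ ⟨h1, h2, h3.le, h4.le⟩ ⟨h1', h2', h3.le, h4.le⟩
  · intro θ _ a b; rw [extendPhases, extendPhases, wrap_add hT₁]
  · intro θ _ a b; rw [extendPhases, extendPhases, wrap_add hT₂]
  · intro θ _ a b; rw [extendPhases, extendPhases, wrap_add hT₁]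
  · intro θ _ a b; rw [extendPhases, extendPhases, wrap_add hT₂]
  · intro θ hθ a
    rw [← h.zeroAverage θ.1 θ.2 (wrap T₁ a) (interior_subset hθ) (wrap_nonneg hT₁ a)]
    refine intervalIntegral.integral_congr fun s hs => ?_
    rw [uIcc_of_le hT₂.le] at hs
    have := apply_wrap_eq (F := fun b => S.φ₁ θ.1 θ.2 (wrap T₁ a) b) hT₂
      (fun b hb => h.periodic₂_φ₁ _ _ _ _ (interior_subset hθ) (wrap_nonneg hT₁ a) hb) 0
      (a := s) (by simpa using hs.1)
    simpa [extendPhases] using this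

/-- All phases in the integrals are nonnegative, where the extension agrees with the original data.
The x-derivatives agree as well, since this holds for all nearby states. -/
theorem fullAverage_extend (h : S.OscillationAssumption δ T₁ T₂) {θ : OscState n₁ n₂}
    (hθ : θ ∈ interior (euclideanInflation S.C δ)) :
    fullAverage T₁ T₂ (extendPhases T₁ T₂ S.φ₁) (extendPhases T₁ T₂ S.φ₂)
      (S.extendedDeriv T₁ T₂) θ = S.averageMap T₁ T₂ θ := by
  obtain ⟨x, z⟩ := θ
  have e₁ : ∀ y, (y, z) ∈ interior (euclideanInflation S.C δ) → ∀ a b, 0 ≤ a → 0 ≤ b →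
      extendPhases T₁ T₂ S.φ₁ (y, z) a b = S.φ₁ y z a b := fun y hy a b ha hb => by
    simpa using h.extend_φ₁_eq (interior_subset hy) 0 0 (a := a) (b := b)
      (by simpa using ha) (by simpa using hb)
  have e₂ : ∀ a b, 0 ≤ a → 0 ≤ b →
      extendPhases T₁ T₂ S.φ₂ (x, z) a b = S.φ₂ x z a b := fun a b ha hb => by
    simpa using h.extend_φ₂_eq (interior_subset hθ) 0 0 (a := a) (b := b)
      (by simpa using ha) (by simpa using hb)
  have eu : ∀ y, (y, z) ∈ interior (euclideanInflation S.C δ) → ∀ a b, 0 ≤ a → 0 ≤ b →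
      ∫ r in (0 : ℝ)..b, extendPhases T₁ T₂ S.φ₁ (y, z) a r = S.u₁ y z a b :=
    fun y hy a b ha hb => intervalIntegral.integral_congr fun r hr => by
      rw [uIcc_of_le hb] at hr
      exact e₁ y hy a r ha hr.1
  have hev : ∀ᶠ y in 𝓝 x, (y, z) ∈ interior (euclideanInflation S.C δ) :=
    ((continuous_id.prodMk continuous_const).tendsto x).eventually
      (isOpen_interior.mem_nhds hθ)
  rw [h.isPeriodicField.fullAverage_eq hθ, averageMap]
  congr 1
  refine intervalIntegral.integral_congr fun a ha => intervalIntegral.integral_congr fun b hb => ?_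
  rw [uIcc_of_le h.T₁_pos.le] at ha
  rw [uIcc_of_le h.T₂_pos.le] at hb
  have d₁ : fderiv ℝ (fun y => extendPhases T₁ T₂ S.φ₁ (y, z) a b) x =
      fderiv ℝ (fun y => S.φ₁ y z a b) x := by
    refine Filter.EventuallyEq.fderiv_eq ?_
    filter_upwards [hev] with y hy
    exact e₁ y hy a b ha.1 hb.1
  have d₂ : fderiv ℝ (fun y => ∫ r in (0 : ℝ)..b, extendPhases T₁ T₂ S.φ₁ (y, z) a r) x =
      fderiv ℝ (fun y => S.u₁ y z a b) x := by
    refine Filter.EventuallyEq.fderiv_eq ?_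
    filter_upwards [hev] with y hy
    exact eu y hy a b ha.1 hb.1
  simp only [lieBracket]
  rw [d₁, d₂, e₁ x hθ a b ha.1 hb.1, e₂ a b ha.1 hb.1, eu x hθ a b ha.1 hb.1]

end OscillationAssumption

end OscillatoryData

/-! ### Limits of asymptotically Lipschitz curves -/

/-- `Θ` on `[a₀, b₀]` is the limit along `U` of the curves `θ i` on `[a i, b i]`, which are
`c`-Lipschitz up to errors `e i` that vanish along `U`. -/
structure IsLimitCurve {ι E : Type*} [NormedAddCommGroup E] (U : Ultrafilter ι) (θ : ι → ℝ → E)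
    (a b : ι → ℝ) (c : ℝ) (e : ι → ℝ) (Θ : ℝ → E) (a₀ b₀ : ℝ) : Prop where
  c_nonneg : 0 ≤ c
  tendsto_left : Tendsto a U (𝓝 a₀)
  tendsto_right : Tendsto b U (𝓝 b₀)
  tendsto_error : Tendsto e U (𝓝 0)
  le : ∀ᶠ i in (U : Filter ι), a i ≤ b i
  osc : ∀ᶠ i in (U : Filter ι), ∀ s ∈ Icc (a i) (b i), ∀ t ∈ Icc (a i) (b i), s ≤ t →
    ‖θ i t - θ i s‖ ≤ c * (t - s) + e i
  tendsto : ∀ (r : ι → ℝ) (r₀ : ℝ), (∀ᶠ i in (U : Filter ι), r i ∈ Icc (a i) (b i)) →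
    Tendsto r U (𝓝 r₀) → Tendsto (fun i => θ i (r i)) U (𝓝 (Θ r₀))

theorem norm_sub_le_abs {E : Type*} [NormedAddCommGroup E] {θ : ℝ → E} {a b c e : ℝ}
    (h : ∀ s ∈ Icc a b, ∀ t ∈ Icc a b, s ≤ t → ‖θ t - θ s‖ ≤ c * (t - s) + e) {s t : ℝ}
    (hs : s ∈ Icc a b) (ht : t ∈ Icc a b) : ‖θ t - θ s‖ ≤ c * |t - s| + e := by
  rcases le_total s t with hst | hst
  · rw [abs_of_nonneg (by linarith)]
    exact h s hs t ht hst
  · rw [norm_sub_rev, abs_sub_comm, abs_of_nonneg (by linarith)]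
    exact h t ht s hs hst

theorem max_min_mem_Icc {a b : ℝ} (hab : a ≤ b) (s : ℝ) : max a (min b s) ∈ Icc a b :=
  ⟨le_max_left _ _, max_le hab (min_le_left _ _)⟩

theorem abs_sub_max_min_le {a b r : ℝ} (hr : r ∈ Icc a b) (s : ℝ) :
    |r - max a (min b s)| ≤ |r - s| := by
  have e : r = max a (min b r) := by rw [min_eq_right hr.2, max_eq_right hr.1]
  calc |r - max a (min b s)| = |max a (min b r) - max a (min b s)| := by rw [← e]
    _ ≤ |min b r - min b s| := by
      rw [max_comm a, max_comm a]; exact abs_max_sub_max_le_abs _ _ _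
    _ ≤ |r - s| := by
      rw [min_comm b, min_comm b]
      simpa using abs_min_sub_min_le_max r b s b

theorem tendsto_max_min {ι : Type*} {l : Filter ι} {a b : ι → ℝ} {a₀ b₀ s : ℝ}
    (ha : Tendsto a l (𝓝 a₀)) (hb : Tendsto b l (𝓝 b₀)) (hs : s ∈ Icc a₀ b₀) :
    Tendsto (fun i => max (a i) (min (b i) s)) l (𝓝 s) := by
  have := ha.max (hb.min (tendsto_const_nhds (x := s)))
  rwa [min_eq_right hs.2, max_eq_right hs.1] at this

/-- The limit is defined pointwise along the ultrafilter, with each time clamped to the varying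
interval `[a i, b i]`. The asymptotic Lipschitz bound shows that other approximating times yield the
same limit. -/
theorem IsLimitCurve.exists {ι E : Type*} [NormedAddCommGroup E] [ProperSpace E]
    {U : Ultrafilter ι} {θ : ι → ℝ → E} {a b e : ι → ℝ} {a₀ b₀ c ρ : ℝ} (hc : 0 ≤ c)
    (ha : Tendsto a U (𝓝 a₀)) (hb : Tendsto b U (𝓝 b₀)) (he : Tendsto e U (𝓝 0))
    (hab : ∀ᶠ i in (U : Filter ι), a i ≤ b i)
    (hρ : ∀ᶠ i in (U : Filter ι), ∀ s ∈ Icc (a i) (b i), ‖θ i s‖ ≤ ρ)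
    (hosc : ∀ᶠ i in (U : Filter ι), ∀ s ∈ Icc (a i) (b i), ∀ t ∈ Icc (a i) (b i), s ≤ t →
      ‖θ i t - θ i s‖ ≤ c * (t - s) + e i) :
    ∃ Θ, IsLimitCurve U θ a b c e Θ a₀ b₀ := by
  have hex : ∀ s : ℝ, ∃ p, Tendsto (fun i => θ i (max (a i) (min (b i) s))) U (𝓝 p) := fun s =>
    U.exists_tendsto_of_norm_le (c := ρ) (by
      filter_upwards [hab, hρ] with i h1 h2
      exact h2 _ (max_min_mem_Icc h1 s))
  choose Θ hΘ using hex
  refine ⟨Θ, hc, ha, hb, he, hab, hosc, fun r r₀ hr hrt => ?_⟩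
  have h0 : Tendsto (fun i => c * |r i - r₀| + e i) U (𝓝 0) := by
    have h1 : Tendsto (fun i => |r i - r₀|) U (𝓝 0) := by
      simpa using (hrt.sub_const r₀).abs
    simpa using (h1.const_mul c).add he
  have h2 : Tendsto (fun i => θ i (r i) - θ i (max (a i) (min (b i) r₀))) U (𝓝 0) := by
    refine squeeze_zero_norm' ?_ h0
    filter_upwards [hab, hr, hosc] with i h1 h2 h3
    have h4 := mul_le_mul_of_nonneg_left (abs_sub_max_min_le h2 r₀) hc
    linarith [norm_sub_le_abs h3 (max_min_mem_Icc h1 r₀) h2]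
  simpa using h2.add (hΘ r₀)

namespace IsLimitCurve

variable {ι E : Type*} [NormedAddCommGroup E] {U : Ultrafilter ι} {θ : ι → ℝ → E} {a b e : ι → ℝ}
  {a₀ b₀ c : ℝ} {Θ : ℝ → E}

theorem eventually_mem (h : IsLimitCurve U θ a b c e Θ a₀ b₀) (s : ℝ) :
    ∀ᶠ i in (U : Filter ι), max (a i) (min (b i) s) ∈ Icc (a i) (b i) := by
  filter_upwards [h.le] with i hi
  exact max_min_mem_Icc hi s

theorem tendsto_apply (h : IsLimitCurve U θ a b c e Θ a₀ b₀) {s : ℝ} (hs : s ∈ Icc a₀ b₀) :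
    Tendsto (fun i => θ i (max (a i) (min (b i) s))) U (𝓝 (Θ s)) :=
  h.tendsto _ _ (h.eventually_mem s) (tendsto_max_min h.tendsto_left h.tendsto_right hs)

theorem norm_sub_le (h : IsLimitCurve U θ a b c e Θ a₀ b₀) {s t : ℝ} (hs : s ∈ Icc a₀ b₀)
    (ht : t ∈ Icc a₀ b₀) : ‖Θ t - Θ s‖ ≤ c * |t - s| := by
  have h1 := tendsto_max_min h.tendsto_left h.tendsto_right hs
  have h2 := tendsto_max_min h.tendsto_left h.tendsto_right ht
  have h3 := ((h.tendsto_apply ht).sub (h.tendsto_apply hs)).norm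
  have h4 := (((h2.sub h1).abs).const_mul c).add h.tendsto_error
  rw [add_zero] at h4
  refine le_of_tendsto_of_tendsto h3 h4 ?_
  filter_upwards [h.eventually_mem s, h.eventually_mem t, h.osc] with i h5 h6 h7
  exact norm_sub_le_abs h7 h5 h6

theorem lipschitzOnWith (h : IsLimitCurve U θ a b c e Θ a₀ b₀) :
    LipschitzOnWith c.toNNReal Θ (Icc a₀ b₀) :=
  LipschitzOnWith.of_dist_le_mul fun s hs t ht => by
    rw [dist_eq_norm, Real.dist_eq, Real.coe_toNNReal _ h.c_nonneg]
    exact h.norm_sub_le ht hs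

theorem mem_of_isClosed (h : IsLimitCurve U θ a b c e Θ a₀ b₀) {Q : Set E} (hQ : IsClosed Q)
    (hmem : ∀ᶠ i in (U : Filter ι), ∀ s ∈ Icc (a i) (b i), θ i s ∈ Q) {s : ℝ}
    (hs : s ∈ Icc a₀ b₀) : Θ s ∈ Q := by
  refine hQ.mem_of_tendsto (h.tendsto_apply hs) ?_
  filter_upwards [h.eventually_mem s, hmem] with i h1 h2
  exact h2 _ h1

theorem exists_eventually_dist_lt (h : IsLimitCurve U θ a b c e Θ a₀ b₀) {t₀ : ℝ}
    (ht₀ : t₀ ∈ Icc a₀ b₀) {κ : ℝ} (hκ : 0 < κ) :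
    ∃ σ > 0, ∀ᶠ i in (U : Filter ι), ∀ r ∈ Icc (a i) (b i), |r - t₀| < σ →
      dist (θ i r) (Θ t₀) < κ := by
  have hc := h.c_nonneg
  -- Half of κ is for the Lipschitz part, and the other half for the terms that vanish along `U`.
  -- The 1 in c + 1 keeps the denominator positive.
  refine ⟨κ / (2 * (c + 1)), by positivity, ?_⟩
  have hp := tendsto_max_min h.tendsto_left h.tendsto_right ht₀
  have h1 : Tendsto (fun i => c * |max (a i) (min (b i) t₀) - t₀| + e i +
      dist (θ i (max (a i) (min (b i) t₀))) (Θ t₀)) U (𝓝 0) := by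
    have h1 : Tendsto (fun i => |max (a i) (min (b i) t₀) - t₀|) U (𝓝 0) := by
      simpa using (hp.sub_const t₀).abs
    have h2 := tendsto_iff_dist_tendsto_zero.mp (h.tendsto_apply ht₀)
    simpa using ((h1.const_mul c).add h.tendsto_error).add h2
  filter_upwards [h1.eventually (gt_mem_nhds (half_pos hκ)), h.eventually_mem t₀, h.osc]
    with i h2 h3 h4 r hr hrσ
  have h5 := norm_sub_le_abs h4 h3 hr
  have h6 : c * |r - max (a i) (min (b i) t₀)| ≤
      c * (|r - t₀| + |max (a i) (min (b i) t₀) - t₀|) := by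
    rw [abs_sub_comm (max _ _) t₀]
    exact mul_le_mul_of_nonneg_left (abs_sub_le _ _ _) hc
  have h7 : c * |r - t₀| ≤ κ / 2 := by
    have : c * |r - t₀| ≤ (c + 1) * (κ / (2 * (c + 1))) := by gcongr; linarith
    calc _ ≤ _ := this
      _ = κ / 2 := by field_simp
  have h8 := dist_triangle (θ i r) (θ i (max (a i) (min (b i) t₀))) (Θ t₀)
  rw [dist_eq_norm (θ i r) (θ i (max (a i) (min (b i) t₀)))] at h8
  linarith

/-- Short intervals near `t₀` are limits of intervals on which `θ i` stays close to `Θ t₀`. -/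
theorem exists_approx (h : IsLimitCurve U θ a b c e Θ a₀ b₀) {t₀ : ℝ}
    (ht₀ : t₀ ∈ Icc a₀ b₀) {κ : ℝ} (hκ : 0 < κ) :
    ∃ σ > 0, ∀ s ∈ Icc a₀ b₀, ∀ t ∈ Icc a₀ b₀, s ≤ t → |s - t₀| < σ → |t - t₀| < σ →
      ∃ s' t' : ι → ℝ, Tendsto s' U (𝓝 s) ∧ Tendsto t' U (𝓝 t) ∧
        Tendsto (fun i => θ i (s' i)) U (𝓝 (Θ s)) ∧ Tendsto (fun i => θ i (t' i)) U (𝓝 (Θ t)) ∧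
        ∀ᶠ i in (U : Filter ι), s' i ∈ Icc (a i) (b i) ∧ t' i ∈ Icc (a i) (b i) ∧ s' i ≤ t' i ∧
          ∀ r ∈ Icc (s' i) (t' i), dist (θ i r) (Θ t₀) < κ := by
  obtain ⟨σ, hσ, hev⟩ := h.exists_eventually_dist_lt ht₀ hκ
  refine ⟨σ, hσ, fun s hs t ht hst hsσ htσ => ?_⟩
  have h1 := tendsto_max_min h.tendsto_left h.tendsto_right hs
  have h2 := tendsto_max_min h.tendsto_left h.tendsto_right ht
  refine ⟨_, _, h1, h2, h.tendsto_apply hs, h.tendsto_apply ht, ?_⟩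
  filter_upwards [hev, h.eventually_mem s, h.eventually_mem t,
    (h1.sub_const t₀).abs.eventually (gt_mem_nhds hsσ),
    (h2.sub_const t₀).abs.eventually (gt_mem_nhds htσ)] with i h3 h4 h5 h6 h7
  refine ⟨h4, h5, max_le_max le_rfl (min_le_min le_rfl hst), fun r hr => ?_⟩
  refine h3 r ⟨h4.1.trans hr.1, hr.2.trans h5.2⟩ ?_
  rw [abs_lt] at h6 h7 ⊢
  exact ⟨by linarith [hr.1], by linarith [hr.2]⟩

end IsLimitCurve

namespace IsLimitCurve

variable {ι V W : Type*} [NormedAddCommGroup V] [NormedAddCommGroup W] {U : Ultrafilter ι} {θ : ι → ℝ → V × W} {a b e : ι → ℝ}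
  {a₀ b₀ c : ℝ} {Θ : ℝ → V × W}

/-- Velocities do not converge, but increments do. The additive error disappears in the limit for
fixed s and t, and only afterwards do s and t approach `t₀`. -/
theorem hasDerivWithinAt_fst [NormedSpace ℝ V] (h : IsLimitCurve U θ a b c e Θ a₀ b₀) {t₀ : ℝ}
    (ht₀ : t₀ ∈ Icc a₀ b₀) {v : V} {e' : ι → ℝ} (he' : Tendsto e' U (𝓝 0))
    (hv : ∀ η > 0, ∃ κ > 0, ∀ᶠ i in (U : Filter ι), ∀ s ∈ Icc (a i) (b i),
      ∀ t ∈ Icc (a i) (b i), s ≤ t → (∀ r ∈ Icc s t, dist (θ i r) (Θ t₀) < κ) →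
        ‖(θ i t).1 - (θ i s).1 - (t - s) • v‖ ≤ η * (t - s) + e' i) :
    HasDerivWithinAt (fun t => (Θ t).1) v (Icc a₀ b₀) t₀ := by
  rw [hasDerivWithinAt_iff_isLittleO, Asymptotics.isLittleO_iff]
  intro η hη
  obtain ⟨κ, hκ, hev⟩ := hv η hη
  obtain ⟨σ, hσ, happ⟩ := h.exists_approx ht₀ hκ
  have key : ∀ s ∈ Icc a₀ b₀, ∀ t ∈ Icc a₀ b₀, s ≤ t → |s - t₀| < σ → |t - t₀| < σ →
      ‖(Θ t).1 - (Θ s).1 - (t - s) • v‖ ≤ η * (t - s) := by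
    intro s hs t ht hst h1 h2
    obtain ⟨s', t', hs', ht', hθs, hθt, hall⟩ := happ s hs t ht hst h1 h2
    have h3 := (((continuous_fst.tendsto _).comp hθt).sub
      ((continuous_fst.tendsto _).comp hθs)).sub ((ht'.sub hs').smul_const v) |>.norm
    have h4 := ((ht'.sub hs').const_mul η).add he'
    rw [add_zero] at h4
    refine le_of_tendsto_of_tendsto h3 h4 ?_
    filter_upwards [hall, hev] with i h5 h6
    exact h6 _ h5.1 _ h5.2.1 h5.2.2.1 h5.2.2.2
  filter_upwards [self_mem_nhdsWithin,
    nhdsWithin_le_nhds (Metric.ball_mem_nhds t₀ hσ)] with t ht htσ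
  rw [Metric.mem_ball, Real.dist_eq] at htσ
  have h0 : |t₀ - t₀| < σ := by simpa using hσ
  rcases le_total t₀ t with hle | hle
  · rw [Real.norm_of_nonneg (by linarith)]
    exact key t₀ ht₀ t ht hle h0 htσ
  · have := key t ht t₀ ht₀ hle htσ h0
    have hneg : (Θ t).1 - (Θ t₀).1 - (t - t₀) • v = -((Θ t₀).1 - (Θ t).1 - (t₀ - t) • v) := by
      module
    rwa [hneg, norm_neg, norm_sub_rev t, Real.norm_of_nonneg (by linarith)]

/-- Difference quotients of the limit near `t₀` are limits of difference quotients of the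
approximating curves. They therefore lie in the closed set `Q`, and so does the derivative. -/
theorem deriv_snd_mem [NormedSpace ℝ W] (h : IsLimitCurve U θ a b c e Θ a₀ b₀) (hab : a₀ < b₀) {t₀ : ℝ}
    (ht₀ : t₀ ∈ Icc a₀ b₀) {v : W} {Q : Set W} (hQ : IsClosed Q)
    (hd : HasDerivWithinAt (fun t => (Θ t).2) v (Icc a₀ b₀) t₀)
    (hv : ∃ κ > 0, ∀ᶠ i in (U : Filter ι), ∀ s ∈ Icc (a i) (b i),
      ∀ t ∈ Icc (a i) (b i), s < t → (∀ r ∈ Icc s t, dist (θ i r) (Θ t₀) < κ) →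
        (t - s)⁻¹ • ((θ i t).2 - (θ i s).2) ∈ Q) : v ∈ Q := by
  obtain ⟨κ, hκ, hev⟩ := hv
  obtain ⟨σ, hσ, happ⟩ := h.exists_approx ht₀ hκ
  have key : ∀ s ∈ Icc a₀ b₀, ∀ t ∈ Icc a₀ b₀, s < t → |s - t₀| < σ → |t - t₀| < σ →
      (t - s)⁻¹ • ((Θ t).2 - (Θ s).2) ∈ Q := by
    intro s hs t ht hst h1 h2
    obtain ⟨s', t', hs', ht', hθs, hθt, hall⟩ := happ s hs t ht hst.le h1 h2
    have h3 := ((ht'.sub hs').inv₀ (by linarith)).smul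
      (((continuous_snd.tendsto _).comp hθt).sub ((continuous_snd.tendsto _).comp hθs))
    refine hQ.mem_of_tendsto h3 ?_
    filter_upwards [hall, hev, hs'.eventually_lt ht' hst] with i h5 h6 h7
    exact h6 _ h5.1 _ h5.2.1 h7 h5.2.2.2
  rw [hasDerivWithinAt_iff_tendsto_slope] at hd
  have hne : (𝓝[Icc a₀ b₀ \ {t₀}] t₀).NeBot := by
    have := (uniqueDiffOn_Icc hab) t₀ ht₀
    rwa [uniqueDiffWithinAt_iff_accPt, accPt_principal_iff_nhdsWithin] at this
  refine hQ.mem_of_tendsto hd ?_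
  filter_upwards [self_mem_nhdsWithin,
    nhdsWithin_le_nhds (Metric.ball_mem_nhds t₀ hσ)] with t ht htσ
  rw [Metric.mem_ball, Real.dist_eq] at htσ
  have h0 : |t₀ - t₀| < σ := by simpa using hσ
  rcases lt_or_gt_of_ne (show t ≠ t₀ from ht.2) with hlt | hlt
  · rw [slope_comm]
    exact key t ht.1 t₀ ht₀ hlt htσ h0
  · exact key t₀ ht₀ t ht.1 hlt h0 htσ

end IsLimitCurve

/-! ### Limits of the oscillatory system -/

section

variable {E F : Type*} [NormedAddCommGroup E] [NormedSpace ℝ E] [NormedAddCommGroup F]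
  [NormedSpace ℝ F] {f : ℝ → E × F} {v : E × F} {s : Set ℝ} {t : ℝ}

theorem HasDerivWithinAt.fst_apply (h : HasDerivWithinAt f v s t) :
    HasDerivWithinAt (fun r => (f r).1) v.1 s t :=
  (ContinuousLinearMap.fst ℝ E F).hasFDerivAt.comp_hasDerivWithinAt t h

theorem HasDerivWithinAt.snd_apply (h : HasDerivWithinAt f v s t) :
    HasDerivWithinAt (fun r => (f r).2) v.2 s t :=
  (ContinuousLinearMap.snd ℝ E F).hasFDerivAt.comp_hasDerivWithinAt t h

end

/-- An absolutely continuous function with almost everywhere constant derivative is affine. -/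
theorem AbsolutelyContinuousOnInterval.eq_add_mul {f : ℝ → ℝ} {a b v : ℝ}
    (hf : AbsolutelyContinuousOnInterval f a b)
    (h : ∀ᵐ t : ℝ, t ∈ Icc a b → HasDerivWithinAt f v (Icc a b) t) {r : ℝ} (hr : r ∈ Icc a b) :
    f r = f a + v * (r - a) := by
  rcases hr.1.eq_or_lt with rfl | har
  · simp
  have hsub : Icc a r ⊆ Icc a b := Icc_subset_Icc le_rfl hr.2
  have := (hf.mono (by rwa [uIcc_of_le har.le, uIcc_of_le (hr.1.trans hr.2)])).slope_mem har
    (convex_singleton v) isClosed_singleton (by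
      filter_upwards [h] with t ht htr
      exact ⟨v, rfl, (ht (hsub htr)).mono hsub⟩)
  rw [mem_singleton_iff, smul_eq_mul, inv_mul_eq_iff_eq_mul₀ (by linarith)] at this
  linarith

namespace OscillatoryData

variable {n₁ n₂ : ℕ} {S : OscillatoryData n₁ n₂} {δ T₁ T₂ : ℝ}

theorem norm_sub_snd_le {ε ρ M : ℝ} {y : ℝ → OscState n₁ n₂ × (ℝ × ℝ)} {a b : ℝ}
    (hM : ∀ θ ∈ S.C ∩ Metric.closedBall 0 ρ, ∀ v ∈ S.Φ θ.2, ‖v‖ ≤ M)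
    (hy : (S.original ε).IsFlowSegment y a b) (hρ : ∀ s ∈ Icc a b, ‖(y s).1‖ ≤ ρ) (hab : a ≤ b) :
    ‖(y b).1.2 - (y a).1.2‖ ≤ M * (b - a) := by
  rcases hab.eq_or_lt with rfl | hlt
  · simp
  obtain ⟨h1, h2, h3⟩ := hy hlt
  refine ((h1.comp_lipschitzWith LipschitzWith.prod_fst).comp_lipschitzWith
    LipschitzWith.prod_snd).norm_sub_le hab ?_
  filter_upwards [h3] with t ht htab
  obtain ⟨v, hv, hd⟩ := ht htab
  exact ⟨v.1.2, hM _ ⟨(h2 t htab).1, by simpa using hρ t htab⟩ _ hv.1.2, hd.fst_apply.snd_apply⟩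

theorem slope_snd_mem {ε : ℝ} {y : ℝ → OscState n₁ n₂ × (ℝ × ℝ)} {a b : ℝ}
    {Q : Set (EuclideanSpace ℝ (Fin n₂))} (hQ : Convex ℝ Q) (hQc : IsClosed Q)
    (hy : (S.original ε).IsFlowSegment y a b) (hab : a < b)
    (hΦ : ∀ r ∈ Icc a b, (y r).1 ∈ S.C → S.Φ (y r).1.2 ⊆ Q) :
    (b - a)⁻¹ • ((y b).1.2 - (y a).1.2) ∈ Q := by
  obtain ⟨h1, h2, h3⟩ := hy hab
  refine ((h1.comp_lipschitzWith LipschitzWith.prod_fst).comp_lipschitzWith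
    LipschitzWith.prod_snd).slope_mem hab hQ hQc ?_
  filter_upwards [h3] with t ht htab
  obtain ⟨v, hv, hd⟩ := ht htab
  exact ⟨v.1.2, hΦ t htab (h2 t htab).1 hv.1.2, hd.fst_apply.snd_apply⟩

/-- The phases have constant velocity and are therefore affine in time. Their values extrapolated to
time 0 may be negative, which is one reason to extend the data to real phases. -/
theorem exists_isFastTrajectory (h : S.OscillationAssumption δ T₁ T₂) {ε ρ M : ℝ}
    {y : ℝ → OscState n₁ n₂ × (ℝ × ℝ)} {a b : ℝ}
    (hM : ∀ θ ∈ S.C ∩ Metric.closedBall 0 ρ, ∀ v ∈ S.Φ θ.2, ‖v‖ ≤ M)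
    (hy : (S.original ε).IsFlowSegment y a b) (hρ : ∀ s ∈ Icc a b, ‖(y s).1‖ ≤ ρ) (hab : a < b) :
    ∃ α β, IsFastTrajectory (S.C ∩ Metric.closedBall 0 ρ) M (extendPhases T₁ T₂ S.φ₁)
      (extendPhases T₁ T₂ S.φ₂) ε α β (fun r => (y r).1.1) (fun r => (y r).1.2) a b := by
  obtain ⟨h1, h2, h3⟩ := hy hab
  have hθ := h1.comp_lipschitzWith LipschitzWith.prod_fst
  have hτ := h1.comp_lipschitzWith LipschitzWith.prod_snd
  have hτ₁ : ∀ r ∈ Icc a b, (y r).2.1 = ((y a).2.1 - a / ε) + r / ε := fun r hr => by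
    rw [(hτ.comp_lipschitzWith LipschitzWith.prod_fst).eq_add_mul (v := ε⁻¹) (by
      filter_upwards [h3] with t ht htab
      obtain ⟨v, hv, hd⟩ := ht htab
      have e : v.2 = (ε⁻¹, (ε ^ 2)⁻¹) := hv.2
      simpa [e] using hd.snd_apply.fst_apply) hr]
    ring
  have hτ₂ : ∀ r ∈ Icc a b, (y r).2.2 = ((y a).2.2 - a / ε ^ 2) + r / ε ^ 2 := fun r hr => by
    rw [(hτ.comp_lipschitzWith LipschitzWith.prod_snd).eq_add_mul (v := (ε ^ 2)⁻¹) (by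
      filter_upwards [h3] with t ht htab
      obtain ⟨v, hv, hd⟩ := ht htab
      have e : v.2 = (ε⁻¹, (ε ^ 2)⁻¹) := hv.2
      simpa [e] using hd.snd_apply.snd_apply) hr]
    ring
  refine ⟨(y a).2.1 - a / ε, (y a).2.2 - a / ε ^ 2,
    hθ.comp_lipschitzWith LipschitzWith.prod_fst, fun r hr => ⟨(h2 r hr).1, by simpa using hρ r hr⟩, fun r hr r' hr' hrr => ?_, ?_⟩
  · exact norm_sub_snd_le hM (hy.mono hr.1 hr'.2)
      (fun s hs => hρ s ⟨hr.1.trans hs.1, hs.2.trans hr'.2⟩) hrr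
  · filter_upwards [h3] with r hr hrab
    obtain ⟨v, hv, hd⟩ := hr hrab
    have e : v.1.1 = S.vectorField ε (y r).1.1 (y r).1.2 (y r).2.1 (y r).2.2 := hv.1.1
    obtain ⟨hC, hp₁, hp₂⟩ := h2 r hrab
    have hC' : (y r).1 ∈ euclideanInflation S.C δ :=
      interior_subset (subset_interior_euclideanInflation S.C h.δ_pos hC)
    have e₁ := h.extend_φ₁_eq hC' 0 0 (a := (y r).2.1) (b := (y r).2.2)
      (by simpa using hp₁) (by simpa using hp₂)
    have e₂ := h.extend_φ₂_eq hC' 0 0 (a := (y r).2.1) (b := (y r).2.2)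
      (by simpa using hp₁) (by simpa using hp₂)
    simp only [Nat.cast_zero, zero_mul, add_zero] at e₁ e₂
    have hd' := hd.fst_apply.fst_apply
    rw [e, vectorField, ← e₁, ← e₂, hτ₁ r hrab, hτ₂ r hrab] at hd'
    exact hd'

/-- Flow segments of the oscillatory system converge to flow segments of its average. -/
theorem exists_limit_segment (hb : S.BasicAssumption) (h : S.OscillationAssumption δ T₁ T₂)
    (U : Ultrafilter ℕ) {ε : ℕ → ℝ} (hε : ∀ i, 0 < ε i) (hε₀ : Tendsto ε U (𝓝 0))
    {y : ℕ → ℝ → OscState n₁ n₂ × (ℝ × ℝ)} {a b : ℕ → ℝ} {a₀ b₀ ρ : ℝ}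
    (ha : Tendsto a U (𝓝 a₀)) (hb₀ : Tendsto b U (𝓝 b₀))
    (hy : ∀ᶠ i in (U : Filter ℕ), a i ≤ b i ∧ (S.original (ε i)).IsFlowSegment (y i) (a i) (b i) ∧
      ∀ s ∈ Icc (a i) (b i), ‖(y i s).1‖ ≤ ρ) :
    ∃ Θ : ℝ → OscState n₁ n₂, (S.average T₁ T₂).IsFlowSegment Θ a₀ b₀ ∧
      Tendsto (fun i => (y i (a i)).1) U (𝓝 (Θ a₀)) ∧
      Tendsto (fun i => (y i (b i)).1) U (𝓝 (Θ b₀)) := by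
  set K := S.C ∩ Metric.closedBall 0 ρ
  have hK : IsCompact K := (isCompact_closedBall 0 ρ).inter_left hb.isClosed_C
  have hCO := subset_interior_euclideanInflation S.C h.δ_pos
  have hKO : K ⊆ interior (euclideanInflation S.C δ) := inter_subset_left.trans hCO
  obtain ⟨M, hM0, hM⟩ := hb.locallyBounded_Φ.exists_norm_le hK inter_subset_left
  obtain ⟨c, Q, hc0, hav⟩ := h.isPeriodicField.exists_averaging hK hKO hM0
  -- The sign of `Q` is not recorded, hence the absolute value.
  have hQε : Tendsto (fun i => |Q| * ε i) U (𝓝 0) := by simpa using hε₀.const_mul |Q|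
  have hosc : ∀ᶠ i in (U : Filter ℕ), ∀ s ∈ Icc (a i) (b i), ∀ t ∈ Icc (a i) (b i), s ≤ t →
      ‖(y i t).1 - (y i s).1‖ ≤ max c M * (t - s) + |Q| * ε i := by
    obtain ⟨κ, -, ε₁, hε₁, hav₁⟩ := hav 1 one_pos
    filter_upwards [hy, hε₀.eventually (gt_mem_nhds hε₁)] with i h1 h2 s hs t ht hst
    have hQ0 : 0 ≤ |Q| * ε i := mul_nonneg (abs_nonneg _) (hε i).le
    rcases hst.eq_or_lt with rfl | hlt
    · simpa using hQ0
    have hflow := h1.2.1.mono hs.1 ht.2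
    have hρ' : ∀ r ∈ Icc s t, ‖(y i r).1‖ ≤ ρ := fun r hr =>
      h1.2.2 r ⟨hs.1.trans hr.1, hr.2.trans ht.2⟩
    obtain ⟨α, β, hfast⟩ := exists_isFastTrajectory h hM hflow hρ' hlt
    have hts : 0 ≤ t - s := by linarith
    have hx := (hav₁ (ε i) (hε i) h2.le α β _ _ s t hst hfast).1
    have hz := norm_sub_snd_le hM hflow hρ' hst
    have hQle : Q * ε i ≤ |Q| * ε i := mul_le_mul_of_nonneg_right (le_abs_self Q) (hε i).le
    have hcm := mul_le_mul_of_nonneg_right (le_max_left c M) hts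
    have hMm := mul_le_mul_of_nonneg_right (le_max_right c M) hts
    rw [Prod.norm_def]
    exact max_le (by simpa using hx.trans (by linarith)) (by simpa using hz.trans (by linarith))
  obtain ⟨Θ, hΘ⟩ := IsLimitCurve.exists (θ := fun i r => (y i r).1) (le_max_of_le_left hc0) ha hb₀
    hQε (hy.mono fun i hi => hi.1) (hy.mono fun i hi => hi.2.2) hosc
  refine ⟨Θ, fun hab => ?_, hΘ.tendsto _ _ (hy.mono fun i hi => left_mem_Icc.mpr hi.1) ha,
    hΘ.tendsto _ _ (hy.mono fun i hi => right_mem_Icc.mpr hi.1) hb₀⟩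
  have hlt : ∀ᶠ i in (U : Filter ℕ), a i < b i := ha.eventually_lt hb₀ hab
  have hmemC : ∀ᶠ i in (U : Filter ℕ), ∀ s ∈ Icc (a i) (b i), (y i s).1 ∈ K := by
    filter_upwards [hy, hlt] with i h1 h2 s hs
    exact ⟨((h1.2.1 h2).2.1 s hs).1, by simpa using h1.2.2 s hs⟩
  have hΘK : ∀ t ∈ Icc a₀ b₀, Θ t ∈ K := fun t ht => hΘ.mem_of_isClosed hK.isClosed hmemC ht
  have hLip := hΘ.lipschitzOnWith
  refine ⟨?_, fun t ht => (hΘK t ht).1, ?_⟩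
  · exact LipschitzOnWith.absolutelyContinuousOnInterval (K := (max c M).toNNReal)
      (by rwa [uIcc_of_le hab.le])
  -- The limit of x is differentiable at every time by averaging. The limit of z is only Lipschitz,
  -- so it is differentiable almost everywhere.
  have hdiff :=
    (LipschitzWith.prod_snd.comp_lipschitzOnWith hLip).ae_differentiableWithinAt_of_mem_real
  filter_upwards [hdiff] with t₀ hd ht₀
  have hθK := hΘK t₀ ht₀
  have hdz := (hd ht₀).hasDerivWithinAt
  have hdx : HasDerivWithinAt (fun t => (Θ t).1) (S.averageMap T₁ T₂ (Θ t₀)) (Icc a₀ b₀) t₀ := by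
    refine hΘ.hasDerivWithinAt_fst ht₀ hQε fun η hη => ?_
    obtain ⟨κ, hκ, ε₁, hε₁, hav₁⟩ := hav η hη
    refine ⟨κ, hκ, ?_⟩
    filter_upwards [hy, hε₀.eventually (gt_mem_nhds hε₁)] with i h1 h2 s hs t ht hst hclose
    rcases hst.eq_or_lt with rfl | hlt
    · simpa using mul_nonneg (abs_nonneg Q) (hε i).le
    obtain ⟨α, β, hfast⟩ := exists_isFastTrajectory h hM (h1.2.1.mono hs.1 ht.2) (fun r hr =>
      h1.2.2 r ⟨hs.1.trans hr.1, hr.2.trans ht.2⟩) hlt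
    have hx := (hav₁ (ε i) (hε i) h2.le α β _ _ s t hst hfast).2 (Θ t₀) hθK hclose
    rw [h.fullAverage_extend (hKO hθK)] at hx
    refine hx.trans ?_
    gcongr
    · exact (hε i).le
    · exact le_abs_self Q
  have hzmem : derivWithin (Prod.snd ∘ Θ) (Icc a₀ b₀) t₀ ∈ S.Φ (Θ t₀).2 := by
    -- `Φ` at the limit point is closed, hence the intersection of its closed thickenings. Each of
    -- these is convex and, by upper semicontinuity, contains all nearby velocities of z, and with
    -- them the difference quotients.
    have hcl := hb.osc_Φ.isClosed hθK.1
    rw [← hcl.closure_eq, Metric.closure_eq_iInter_cthickening, mem_iInter₂]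
    intro σ hσ
    obtain ⟨κ, hκ, hΦ⟩ := hb.osc_Φ.exists_subset_cthickening hb.locallyBounded_Φ hθK.1 hσ
    refine hΘ.deriv_snd_mem hab ht₀ Metric.isClosed_cthickening hdz ⟨κ, hκ, ?_⟩
    filter_upwards [hy] with i h1 s hs t ht hst hclose
    exact slope_snd_mem ((hb.convex_Φ _ hθK.1).cthickening σ) Metric.isClosed_cthickening
      (h1.2.1.mono hs.1 ht.2) hst fun r hr hrC => hΦ _ hrC (hclose r hr)
  exact ⟨(S.averageMap T₁ T₂ (Θ t₀), derivWithin (Prod.snd ∘ Θ) (Icc a₀ b₀) t₀), ⟨rfl, hzmem⟩,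
    hdx.prodMk hdz⟩

/-- Jump times and flow segments converge one by one. Successive segments fit together because the
states before and after a jump converge; a segment whose interval shrinks to a point needs only its
end values. -/
theorem hasChainLimits (hb : S.BasicAssumption) (h : S.OscillationAssumption δ T₁ T₂) :
    HasChainLimits S.original (S.average T₁ T₂) := by
  intro U ε J t x T ρ hε hε₀ hch
  have hlim : ∀ k, ∃ p : ℝ, k ≤ J + 1 → Tendsto (fun i => t i k) U (𝓝 p) := by
    intro k
    by_cases hk : k ≤ J + 1
    · obtain ⟨p, hp⟩ := U.exists_tendsto_of_norm_le (u := fun i => t i k) (c := T) (by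
        filter_upwards [hch] with i hi
        rw [Real.norm_of_nonneg (hi.1.nonneg hk)]
        exact (hi.1.monotone hk le_rfl).trans hi.2.1)
      exact ⟨p, fun _ => hp⟩
    -- Beyond the last interval the value is arbitrary.
    · exact ⟨0, fun h => absurd h hk⟩
  choose t' ht' using hlim
  have hseg : ∀ k, ∃ Θ : ℝ → OscState n₁ n₂, k ≤ J →
      (S.average T₁ T₂).IsFlowSegment Θ (t' k) (t' (k + 1)) ∧
      Tendsto (fun i => (x i k (t i k)).1) U (𝓝 (Θ (t' k))) ∧
      Tendsto (fun i => (x i k (t i (k + 1))).1) U (𝓝 (Θ (t' (k + 1)))) := by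
    intro k
    by_cases hk : k ≤ J
    · obtain ⟨Θ, hΘ⟩ := exists_limit_segment hb h U hε hε₀ (y := fun i => x i k) (ρ := ρ)
        (ht' k (by omega)) (ht' (k + 1) (by omega)) (by
          filter_upwards [hch] with i hi
          exact ⟨hi.1.le k hk, hi.1.flow k hk, hi.2.2 k hk⟩)
      exact ⟨Θ, fun _ => hΘ⟩
    · exact ⟨0, fun h => absurd h hk⟩
  choose x' hx' using hseg
  have hz : t' 0 = 0 := by
    refine tendsto_nhds_unique (ht' 0 (by omega)) (tendsto_const_nhds.congr' ?_)
    filter_upwards [hch] with i hi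
    exact hi.1.zero.symm
  have h0 : Tendsto (fun i => (x i 0 0).1) U (𝓝 (x' 0 0)) := by
    have := (hx' 0 (Nat.zero_le J)).2.1
    rw [hz] at this
    refine this.congr' ?_
    filter_upwards [hch] with i hi
    rw [hi.1.zero]
  refine ⟨t', x', ⟨hz, ?_, fun k hk => ?_, fun k hk => (hx' k hk).1, fun k hk => ?_⟩,
    ht' (J + 1) le_rfl, h0, (hx' J le_rfl).2.2⟩
  · refine (hb.isClosed_C.union hb.isClosed_D).mem_of_tendsto h0 ?_
    filter_upwards [hch] with i hi
    exact hi.1.start.imp And.left And.left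
  · refine le_of_tendsto_of_tendsto (ht' k (by omega)) (ht' (k + 1) (by omega)) ?_
    filter_upwards [hch] with i hi
    exact hi.1.le k hk
  · have h1 := (hx' k hk.le).2.2
    have h2 := (hx' (k + 1) hk).2.1
    have hD : ∀ᶠ i in (U : Filter ℕ), (x i k (t i (k + 1))).1 ∈ S.D := by
      filter_upwards [hch] with i hi
      exact (hi.1.jump k hk).1.1
    have hmem := hb.isClosed_D.mem_of_tendsto h1 hD
    refine ⟨hmem, hb.osc_G.mem_of_tendsto hmem h1 h2 hD ?_⟩
    filter_upwards [hch] with i hi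
    exact (hi.1.jump k hk).2.1

/-- The part of D in a ball is compact and G is locally bounded there. Jumps do not involve ε, so
the bound is uniform in ε. -/
theorem exists_norm_le_of_jump (hb : S.BasicAssumption) (ρ : ℝ) :
    ∃ ρ', ∀ ε p q, p ∈ (S.original ε).D → ‖p.1‖ ≤ ρ → q ∈ (S.original ε).G p → ‖q.1‖ ≤ ρ' := by
  obtain ⟨c, -, hc⟩ := hb.locallyBounded_G.exists_norm_le
    ((isCompact_closedBall (0 : OscState n₁ n₂) ρ).inter_left hb.isClosed_D) inter_subset_left
  exact ⟨c, fun ε p q hp hpρ hq => hc p.1 ⟨hp.1, by simpa using hpρ⟩ q.1 hq.1⟩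

end OscillatoryData

theorem theorem2 (n₁ n₂ : ℕ) (S : OscillatoryData n₁ n₂) (δ T₁ T₂ : ℝ)
    (hbasic : S.BasicAssumption) (hosc : S.OscillationAssumption δ T₁ T₂)
    (A B : Set (OscState n₁ n₂)) (hA : IsCompact A)
    (hUAS : (S.average T₁ T₂).IsUAS A B) :
    IsSGPAS S.original A B := by
  exact (OscillatoryData.hasChainLimits hbasic hosc).isSGPAS
    (OscillatoryData.exists_norm_le_of_jump hbasic) hUAS
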